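/- Let $X$ be a complex manifold (Hausdorff, second countable) of complex dimension $n$ with complex structure $J$, and let $g$ be a Kähler metric on $X$: a smooth Riemannian metric with $g(Ju,Jv)=g(u,v)$ whose fundamental form $\omega=g(J\cdot,\cdot)$ satisfies $d\omega=0$. On smooth complex-valued differential forms consider the following operators: - $L\alpha=\omega\wedge\alpha$, and $\Lambda$, the pointwise adjoint of $L$ for the scalar product $\langle\cdot,\cdot\rangle$ that $g$ induces on forms (extended to be $\mathbb{C}$-bilinear); - the $\mathbb{C}$-linear Hodge operator $*$, determined by $\alpha\wedge *\beta=\langle\alpha,\beta\rangle\,\omega^n/n!$; - $\partial$ and $\bar\partial$, which on forms of type $(p,q)$ are the components of type $(p+1,q)$ and $(p,q+1)$ of the exterior derivative $d$; - $d^*=-*d\,*$, $\ \partial^*=-*\bar\partial\,*$, $\ \bar\partial^*=-*\partial\,*$; - $\Delta=dd^*+d^*d$, $\ \Delta_\partial=\partial\partial^*+\partial^*\partial$, $\ \Delta_{\bar\partial}=\bar\partial\bar\partial^*+\bar\partial^*\bar\partial$. Write $[A,B]=AB-BA$. Then the following identities hold on all smooth complex-valued forms on $X$: 1. $[L,\partial]=[L,\bar\partial]=0$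 and $[\Lambda,\partial^*]=[\Lambda,\bar\partial^*]=0$; 2. $[\Lambda,\bar\partial]=-i\,\partial^*$ and $[\Lambda,\partial]=i\,\bar\partial^*$; 3. $[\bar\partial^*,L]=i\,\partial$ and $[\partial^*,L]=-i\,\bar\partial$; 4. $\Delta_\partial=\Delta_{\bar\partial}=\tfrac12\Delta$. -/

import Mathlib

open scoped Manifold ContDiff Nat

noncomputable section

namespace KahlerIdentities

/-! ### Linear algebra of complex-valued forms on one tangent space -/

section Fibre

theorem update_castAdd {V : Type*} {k l : ℕ} (v : Fin (k + l) → V) (i : Fin k) (x : V) :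
    (fun s => Function.update v (Fin.castAdd l i) x (Fin.castAdd l s)) =
      Function.update (fun s => v (Fin.castAdd l s)) i x :=
  Function.update_comp_eq_of_injective v (Fin.castAdd_injective k l) i x

theorem update_natAdd {V : Type*} {k l : ℕ} (v : Fin (k + l) → V) (j : Fin l) (x : V) :
    (fun s => Function.update v (Fin.natAdd k j) x (Fin.natAdd k s)) =
      Function.update (fun s => v (Fin.natAdd k s)) j x :=
  Function.update_comp_eq_of_injective v (Fin.natAdd_injective l k) j x

theorem update_castAdd_natAdd {V : Type*} {k l : ℕ} (v : Fin (k + l) → V) (i : Fin k) (x : V) :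
    (fun s => Function.update v (Fin.castAdd l i) x (Fin.natAdd k s)) =
      fun s => v (Fin.natAdd k s) := by
  funext s
  rw [Function.update_of_ne]
  simp [Fin.ext_iff]; omega

theorem update_natAdd_castAdd {V : Type*} {k l : ℕ} (v : Fin (k + l) → V) (j : Fin l) (x : V) :
    (fun s => Function.update v (Fin.natAdd k j) x (Fin.castAdd l s)) =
      fun s => v (Fin.castAdd l s) := by
  funext s
  rw [Function.update_of_ne]
  simp [Fin.ext_iff]; omega

theorem append_update {V : Type*} {k j : ℕ} (u : Fin k → V) (v : Fin j → V) (i : Fin j) (x : V) :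
    Fin.append u (Function.update v i x) =
      Function.update (Fin.append u v) (Fin.natAdd k i) x := by
  funext s
  refine Fin.addCases (fun a => ?_) (fun b => ?_) s
  · rw [Fin.append_left, congrFun (update_natAdd_castAdd _ i x) a, Fin.append_left]
  · rw [Fin.append_right, congrFun (update_natAdd _ i x) b]
    simp

variable {V : Type*} [NormedAddCommGroup V] [NormedSpace ℂ V]

/-- Complex-valued, real-multilinear alternating `k`-forms on `V`. -/
abbrev Alt (V : Type*) [NormedAddCommGroup V] [NormedSpace ℂ V] (k : ℕ) : Type _ :=
  V [⋀^Fin k]→L[ℝ] ℂ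

/-- The complexified exterior algebra of the dual: families of forms, one in each degree.
A form of degree larger than the real dimension is zero, so this is also the direct sum. -/
abbrev GAlt (V : Type*) [NormedAddCommGroup V] [NormedSpace ℂ V] : Type _ :=
  ∀ k : ℕ, Alt V k

/-- The complex structure `J` of `V`, and more generally multiplication by a complex number,
as a real-linear map. -/
def mulC (V : Type*) [NormedAddCommGroup V] [NormedSpace ℂ V] (c : ℂ) : V →L[ℝ] V :=
  c • ContinuousLinearMap.id ℝ V

@[simp] theorem mulC_apply (c : ℂ) (v : V) : mulC V c v = c • v := rfl

/-- The multilinear map `(v₁, …, v_{k+l}) ↦ a (v₁, …, v_k) b (v_{k+1}, …, v_{k+l})`. -/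
def tensorMul {k l m : ℕ} (h : k + l = m) (a : Alt V k) (b : Alt V l) :
    ContinuousMultilinearMap ℝ (fun _ : Fin m => V) ℂ where
  toFun v := a (fun i => v (Fin.cast h (Fin.castAdd l i))) *
    b (fun j => v (Fin.cast h (Fin.natAdd k j)))
  map_update_add' := by
    subst h
    intro inst v i x y
    rw [Subsingleton.elim inst (instDecidableEqFin _)]
    refine Fin.addCases (fun i' => ?_) (fun j' => ?_) i
    · simp only [Fin.cast_eq_self, update_castAdd, update_castAdd_natAdd,
        ContinuousAlternatingMap.map_update_add, add_mul]
    · simp only [Fin.cast_eq_self, update_natAdd, update_natAdd_castAdd,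
        ContinuousAlternatingMap.map_update_add, mul_add]
  map_update_smul' := by
    subst h
    intro inst v i c x
    rw [Subsingleton.elim inst (instDecidableEqFin _)]
    refine Fin.addCases (fun i' => ?_) (fun j' => ?_) i
    · simp only [Fin.cast_eq_self, update_castAdd, update_castAdd_natAdd,
        ContinuousAlternatingMap.map_update_smul, smul_mul_assoc]
    · simp only [Fin.cast_eq_self, update_natAdd, update_natAdd_castAdd,
        ContinuousAlternatingMap.map_update_smul, mul_smul_comm]
  cont := by fun_prop

/-- The wedge product `(a ∧ b)(v) = 1/(k! l!) ∑_σ sgn σ a(v_σ(1), …) b(v_σ(k+1), …)`, as a form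
of degree `m = k + l`. -/
def wedge {k l m : ℕ} (h : k + l = m) (a : Alt V k) (b : Alt V l) : Alt V m :=
  ((k ! : ℂ) * (l ! : ℂ))⁻¹ • ContinuousMultilinearMap.alternatization (tensorMul h a b)

/-- The `j`-form `γ (u₁, …, u_k, ·)` for a form `γ` of degree `m = k + j`. -/
def contract {k j m : ℕ} (h : k + j = m) (u : Fin k → V) (γ : Alt V m) : Alt V j where
  toFun v := γ (fun s => Fin.append u v (Fin.cast h.symm s))
  map_update_add' := by
    subst h
    intro inst v i x y
    rw [Subsingleton.elim inst (instDecidableEqFin _)]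
    simp only [Fin.cast_eq_self, append_update, ContinuousAlternatingMap.map_update_add]
  map_update_smul' := by
    subst h
    intro inst v i c x
    rw [Subsingleton.elim inst (instDecidableEqFin _)]
    simp only [Fin.cast_eq_self, append_update, ContinuousAlternatingMap.map_update_smul]
  map_eq_zero_of_eq' := by
    subst h
    intro v a b hv hab
    refine γ.map_eq_zero_of_eq _ (i := Fin.natAdd k a) (j := Fin.natAdd k b) ?_ ?_
    · simpa using hv
    · simpa [Fin.ext_iff] using hab
  cont := by
    subst h
    refine γ.cont.comp (continuous_pi fun s => ?_)
    refine Fin.addCases (fun a => ?_) (fun b => ?_) s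
    · simpa using continuous_const
    · simpa using continuous_apply b

theorem sum_mul_wedge {ι : Type*} [Fintype ι] {k l m : ℕ} (h : k + l = m) (e : ι → V)
    (A : Alt V m) (a : Alt V k) (b : Alt V l) :
    ∑ i : Fin m → ι, A (fun s => e (i s)) * wedge h a b (fun s => e (i s)) =
      (m ! : ℂ) * ((k ! : ℂ) * (l ! : ℂ))⁻¹ *
        ∑ i : Fin m → ι, A (fun s => e (i s)) * tensorMul h a b (fun s => e (i s)) := by
  have h1 : ∀ σ : Equiv.Perm (Fin m), ∑ i : Fin m → ι, A (fun s => e (i s)) *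
      (Equiv.Perm.sign σ • tensorMul h a b ((fun s => e (i s)) ∘ σ)) =
      ∑ i : Fin m → ι, A (fun s => e (i s)) * tensorMul h a b (fun s => e (i s)) := by
    intro σ
    rw [← Equiv.sum_comp (σ.arrowCongr (Equiv.refl ι))
      fun i => A (fun s => e (i s)) * (Equiv.Perm.sign σ • tensorMul h a b ((fun s => e (i s)) ∘ σ))]
    refine Finset.sum_congr rfl fun i _ => ?_
    have h2 : ((fun s => e ((σ.arrowCongr (Equiv.refl ι)) i s)) ∘ σ) = fun s => e (i s) := by
      funext s; simp
    have h3 : A (fun s => e (i s)) =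
        Equiv.Perm.sign σ • A (fun s => e ((σ.arrowCongr (Equiv.refl ι)) i s)) := by
      rw [← h2]
      exact A.toAlternatingMap.map_perm _ σ
    rw [h2, h3, mul_smul_comm, smul_mul_assoc]
  have h4 : ∀ v, wedge h a b v = ((k ! : ℂ) * (l ! : ℂ))⁻¹ *
      ∑ σ : Equiv.Perm (Fin m), Equiv.Perm.sign σ • tensorMul h a b (v ∘ σ) := by
    intro v
    rw [wedge, ContinuousAlternatingMap.smul_apply,
      ContinuousMultilinearMap.alternatization_apply_apply, smul_eq_mul]
  simp_rw [h4, mul_left_comm _ ((k ! : ℂ) * (l ! : ℂ))⁻¹, Finset.mul_sum]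
  rw [Finset.sum_comm' (t' := Finset.univ) (s' := fun _ => Finset.univ) (by simp)]
  simp_rw [← Finset.mul_sum, h1]
  simp [Fintype.card_perm]
  ring

theorem sum_tensorMul {ι : Type*} [Fintype ι] {k l m : ℕ} (h : k + l = m) (e : ι → V)
    (A : Alt V m) (a : Alt V k) (b : Alt V l) :
    ∑ i : Fin m → ι, A (fun s => e (i s)) * tensorMul h a b (fun s => e (i s)) =
      ∑ i : Fin k → ι, ∑ j : Fin l → ι, a (fun s => e (i s)) *
        contract h (fun s => e (i s)) A (fun s => e (j s)) * b (fun s => e (j s)) := by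
  subst h
  rw [← Equiv.sum_comp (Fin.appendEquiv k l), Fintype.sum_prod_type]
  refine Finset.sum_congr rfl fun i _ => Finset.sum_congr rfl fun j _ => ?_
  have h1 : (fun s => e (Fin.appendEquiv k l (i, j) s)) =
      Fin.append (fun s => e (i s)) (fun s => e (j s)) := by
    funext s
    refine Fin.addCases (fun a => ?_) (fun b => ?_) s <;> simp [Fin.appendEquiv]
  rw [h1]
  have h2 : contract rfl (fun s => e (i s)) A (fun s => e (j s)) =
      A (Fin.append (fun s => e (i s)) (fun s => e (j s))) := rfl
  have h3 : tensorMul rfl a b (Fin.append (fun s => e (i s)) (fun s => e (j s))) =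
      a (fun s => e (i s)) * b (fun s => e (j s)) := by
    change a _ * b _ = _
    simp
  rw [h2, h3]
  ring


/-- The permutation of `Fin (k + j)` acting by `π` on the first `k` and by `π'` on the last `j`. -/
def sumPerm {k j : ℕ} (π : Equiv.Perm (Fin k)) (π' : Equiv.Perm (Fin j)) :
    Equiv.Perm (Fin (k + j)) :=
  finSumFinEquiv.permCongr (Equiv.sumCongr π π')

@[simp] theorem sumPerm_castAdd {k j : ℕ} (π : Equiv.Perm (Fin k)) (π' : Equiv.Perm (Fin j))
    (s : Fin k) : sumPerm π π' (Fin.castAdd j s) = Fin.castAdd j (π s) := by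
  simp [sumPerm, Equiv.permCongr_apply]

@[simp] theorem sumPerm_natAdd {k j : ℕ} (π : Equiv.Perm (Fin k)) (π' : Equiv.Perm (Fin j))
    (s : Fin j) : sumPerm π π' (Fin.natAdd k s) = Fin.natAdd k (π' s) := by
  simp [sumPerm, Equiv.permCongr_apply]

theorem sign_sumPerm {k j : ℕ} (π : Equiv.Perm (Fin k)) (π' : Equiv.Perm (Fin j)) :
    Equiv.Perm.sign (sumPerm π π') = Equiv.Perm.sign π * Equiv.Perm.sign π' := by
  rw [sumPerm, Equiv.Perm.sign_permCongr, Equiv.Perm.sign_sumCongr]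

theorem sum_contract_perm {k j m : ℕ} (h : k + j = m) (e : Fin m → V) (β : Alt V k) (γ : Alt V m)
    (ρ : Equiv.Perm (Fin m)) :
    ∑ i : Fin k → Fin m, β (fun s => e (i s)) *
      contract h (fun s => e (i s)) γ (fun s => e (ρ (Fin.cast h (Fin.natAdd k s)))) =
      (k ! : ℂ) * (Equiv.Perm.sign ρ •
        (β (fun s => e (ρ (Fin.cast h (Fin.castAdd j s)))) * γ e)) := by
  subst h
  simp only [Fin.cast_eq_self]
  rw [← Fintype.sum_of_injective
    (fun (π : Equiv.Perm (Fin k)) (s : Fin k) => ρ (Fin.castAdd j (π s)))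
    (fun π π' hπ => by
      refine Equiv.ext fun s => ?_
      have := congrFun hπ s
      simpa using this)
    (fun _ => Equiv.Perm.sign ρ • (β (fun s => e (ρ (Fin.castAdd j s))) * γ e)) _ ?_ ?_]
  · simp [Fintype.card_perm]
  · intro i hi
    have : γ (Fin.append (fun s => e (i s)) (fun s => e (ρ (Fin.natAdd k s)))) = 0 := by
      apply γ.map_eq_zero_of_not_injective
      intro hinj
      apply hi
      have h1 : ∀ s, ∃ t, ρ (Fin.castAdd j t) = i s := by
        intro s
        obtain ⟨r, hr⟩ := ρ.surjective (i s)
        revert hr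
        refine Fin.addCases (fun t ht => ⟨t, ht⟩) (fun t ht => ?_) r
        exfalso
        have := @hinj (Fin.castAdd j s) (Fin.natAdd k t) (by simp [ht])
        simp [Fin.ext_iff] at this
        omega
      choose f hf using h1
      have hfinj : Function.Injective f := by
        intro s s' hs
        have := @hinj (Fin.castAdd j s) (Fin.castAdd j s') (by simp [← hf, hs])
        simpa using this
      exact ⟨Equiv.ofBijective f (Finite.injective_iff_bijective.1 hfinj), by
        funext s; simp [hf]⟩
    change _ * γ (Fin.append _ _) = 0
    rw [this, mul_zero]
  · intro π
    have h1 : β (fun s => e (ρ (Fin.castAdd j (π s)))) =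
        Equiv.Perm.sign π • β (fun s => e (ρ (Fin.castAdd j s))) :=
      β.toAlternatingMap.map_perm (fun s => e (ρ (Fin.castAdd j s))) π
    have h2 : contract rfl (fun s => e (ρ (Fin.castAdd j (π s)))) γ
        (fun s => e (ρ (Fin.natAdd k s))) =
        (Equiv.Perm.sign ρ * Equiv.Perm.sign π) • γ e := by
      have h3 := γ.toAlternatingMap.map_perm e (ρ * sumPerm π 1)
      rw [Equiv.Perm.sign_mul, sign_sumPerm, Equiv.Perm.sign_one, mul_one] at h3
      rw [← ContinuousAlternatingMap.coe_toAlternatingMap γ, ← h3]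
      change γ (Fin.append _ _) = γ _
      congr 1
      funext s
      refine Fin.addCases (fun a => ?_) (fun b => ?_) s <;> simp
    rw [h1, h2, smul_mul_smul_comm, mul_left_comm, Int.units_mul_self, mul_one]

theorem sum_perm_castAdd {k j m : ℕ} (h : k + j = m) (G : (Fin k → Fin m) → ℂ)
    (hG : ∀ i, ¬ Function.Injective i → G i = 0) :
    ∑ ρ : Equiv.Perm (Fin m), G (fun s => ρ (Fin.cast h (Fin.castAdd j s))) =
      (j ! : ℂ) * ∑ i, G i := by
  subst h
  simp only [Fin.cast_eq_self]
  have h1 : ∀ ρ : Equiv.Perm (Fin (k + j)), G (fun s => ρ (Fin.castAdd j s)) =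
      ∑ i, if (fun s => ρ (Fin.castAdd j s)) = i then G i else 0 := by
    intro ρ; simp
  simp_rw [h1]
  rw [Finset.sum_comm, Finset.mul_sum]
  refine Finset.sum_congr rfl fun i _ => ?_
  by_cases hi : Function.Injective i
  swap
  · simp [hG i hi]
  obtain ⟨ρ₀, hρ₀⟩ := (Equiv.Perm.isMultiplyPretransitive (Fin (k + j)) k).exists_smul_eq
    (⟨Fin.castAdd j, Fin.castAdd_injective k j⟩ : Fin k ↪ Fin (k + j)) ⟨i, hi⟩
  have hρ : ∀ s, ρ₀ (Fin.castAdd j s) = i s := fun s => DFunLike.congr_fun hρ₀ s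
  rw [← Fintype.sum_of_injective (fun π : Equiv.Perm (Fin j) => ρ₀ * sumPerm 1 π)
    (fun π π' hπ => by
      refine Equiv.ext fun s => ?_
      have := DFunLike.congr_fun hπ (Fin.natAdd k s)
      simpa using this)
    (fun _ => G i) _ ?_ ?_]
  · simp [Fintype.card_perm]
  · intro ρ hρr
    rw [if_neg]
    intro hh
    apply hρr
    have h2 : ∀ s, ∃ t, ρ₀ (Fin.natAdd k t) = ρ (Fin.natAdd k s) := by
      intro s
      obtain ⟨r, hr⟩ := ρ₀.surjective (ρ (Fin.natAdd k s))
      revert hr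
      refine Fin.addCases (fun t ht => ?_) (fun t ht => ⟨t, ht⟩) r
      exfalso
      have h3 : ρ (Fin.castAdd j t) = ρ (Fin.natAdd k s) := by
        rw [← ht, hρ, ← hh]
      have := ρ.injective h3
      simp [Fin.ext_iff] at this
      omega
    choose f hf using h2
    have hfinj : Function.Injective f := by
      intro s s' hs
      have h4 : ρ (Fin.natAdd k s) = ρ (Fin.natAdd k s') := by rw [← hf, ← hf, hs]
      simpa using ρ.injective h4
    refine ⟨Equiv.ofBijective f (Finite.injective_iff_bijective.1 hfinj), ?_⟩
    ext s
    refine Fin.addCases (fun a => ?_) (fun b => ?_) s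
    · simp [hρ, ← hh]
    · simp [hf]
  · intro π
    rw [if_pos]
    funext s
    simp [hρ]

/-! #### Bidegree -/

/-- `α` has type `(p, q)`: it is homogeneous of degree `p` in `c` and `q` in `conj c` under
multiplication of all its arguments by `c`. -/
def IsType {k : ℕ} (p q : ℕ) (α : Alt V k) : Prop :=
  ∀ (c : ℂ) (v : Fin k → V),
    α (fun i => c • v i) = c ^ p * (starRingEnd ℂ c) ^ q * α v

/-- The `2(k+1)`-th root of unity `exp(π i / (k+1))`. -/
def rootU (k : ℕ) : ℂ := Complex.exp (Real.pi * Complex.I / (k + 1))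

/-- The projection `Π^{p,q}` of a `k`-form onto its component of type `(p, q)` (zero unless
`p + q = k`). Multiplication by `ζ^j`, `ζ = exp(π i / (k+1))`, acts on forms of type `(p', q')`,
`p' + q' = k`, by `ζ^(j (p' - q'))`, so the average over `j = 0, …, k` below
selects the component `(p, q)`; see `typeProj_isType` and `sum_typeProj`. -/
def typeProj {k : ℕ} (p q : ℕ) (α : Alt V k) : Alt V k :=
  if p + q = k then
    ((k : ℂ) + 1)⁻¹ • ∑ j ∈ Finset.range (k + 1),
      ((starRingEnd ℂ (rootU k ^ j)) ^ p * (rootU k ^ j) ^ q) •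
        α.compContinuousLinearMap (mulC V (rootU k ^ j))
  else 0

theorem rootU_mul_conj (k : ℕ) : rootU k * starRingEnd ℂ (rootU k) = 1 := by
  rw [Complex.mul_conj, Complex.normSq_eq_norm_sq, rootU]
  have : (Real.pi * Complex.I / (k + 1) : ℂ) = ((Real.pi / (k + 1) : ℝ) : ℂ) * Complex.I := by
    push_cast; ring
  rw [this, Complex.norm_exp_ofReal_mul_I]
  simp

theorem rootU_sq (k : ℕ) : IsPrimitiveRoot (rootU k ^ 2) (k + 1) := by
  have h := Complex.isPrimitiveRoot_exp (k + 1) (Nat.succ_ne_zero k)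
  convert h using 1
  rw [rootU, ← Complex.exp_nat_mul]
  congr 1
  push_cast
  ring

/-- The average of the characters `j ↦ ζ^(2 (p' - p) j)`. -/
theorem sum_rootU {k p q p' q' : ℕ} (h : p + q = k) (h' : p' + q' = k) :
    ∑ j ∈ Finset.range (k + 1), ((starRingEnd ℂ (rootU k ^ j)) ^ p * (rootU k ^ j) ^ q) *
      ((rootU k ^ j) ^ p' * (starRingEnd ℂ (rootU k ^ j)) ^ q') =
      if p = p' then (k : ℂ) + 1 else 0 := by
  set z := rootU k with hz
  have hzz : z * starRingEnd ℂ z = 1 := rootU_mul_conj k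
  set w := starRingEnd ℂ z with hw
  have key : ∀ j, ((starRingEnd ℂ (z ^ j)) ^ p * (z ^ j) ^ q) *
      ((z ^ j) ^ p' * (starRingEnd ℂ (z ^ j)) ^ q') = ((w ^ (p + q') * z ^ (q + p'))) ^ j := by
    intro j
    rw [map_pow, ← hw]
    ring
  simp_rw [key]
  by_cases hpp : p = p'
  · subst hpp
    obtain rfl : q = q' := by omega
    have : w ^ (p + q) * z ^ (q + p) = 1 := by
      rw [add_comm q p, ← mul_pow, mul_comm w z, hzz, one_pow]
    simp [this]
  · rw [if_neg hpp]
    have hz1 : (z ^ 2) ^ (k + 1) = 1 := (rootU_sq k).pow_eq_one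
    have hw1 : (w ^ 2) ^ (k + 1) = 1 := by
      rw [hw, ← map_pow, ← map_pow, hz1, map_one]
    have hx : w ^ (p + q') * z ^ (q + p') ≠ 1 := by
      intro hx
      rcases lt_or_gt_of_ne hpp with hlt | hlt
      · obtain ⟨r, hr, rfl⟩ : ∃ r, 0 < r ∧ p' = p + r := ⟨p' - p, by omega, by omega⟩
        obtain rfl : q = q' + r := by omega
        have : w ^ (p + q') * z ^ (q' + r + (p + r)) = (z ^ 2) ^ r := by
          calc _ = (z * w) ^ (p + q') * (z ^ 2) ^ r := by ring
            _ = _ := by rw [hzz]; simp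
        rw [this] at hx
        exact (rootU_sq k).pow_ne_one_of_pos_of_lt hr.ne' (by omega) hx
      · obtain ⟨r, hr, rfl⟩ : ∃ r, 0 < r ∧ p = p' + r := ⟨p - p', by omega, by omega⟩
        obtain rfl : q' = q + r := by omega
        have : w ^ (p' + r + (q + r)) * z ^ (q + p') = (w ^ 2) ^ r := by
          calc _ = (z * w) ^ (q + p') * (w ^ 2) ^ r := by ring
            _ = _ := by rw [hzz]; simp
        rw [this, hw, ← map_pow, ← map_pow, map_eq_one_iff _ (RingHom.injective _)] at hx
        exact (rootU_sq k).pow_ne_one_of_pos_of_lt hr.ne' (by omega) hx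
    rw [geom_sum_eq hx]
    have : (w ^ (p + q') * z ^ (q + p')) ^ (k + 1) = 1 := by
      have e1 : p + q' + (q + p') = 2 * k := by omega
      have hzk : (z ^ (k + 1)) ^ 2 = 1 := by rw [← hz1]; ring
      have hzw : w ^ (k + 1) = z ^ (k + 1) := by
        have h1 : z ^ (k + 1) * w ^ (k + 1) = 1 := by rw [← mul_pow, hzz, one_pow]
        calc w ^ (k + 1) = (z ^ (k + 1)) ^ 2 * w ^ (k + 1) := by rw [hzk, one_mul]
          _ = z ^ (k + 1) * (z ^ (k + 1) * w ^ (k + 1)) := by ring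
          _ = _ := by rw [h1, mul_one]
      calc _ = (w ^ (k + 1)) ^ (p + q') * (z ^ (k + 1)) ^ (q + p') := by ring
        _ = ((z ^ (k + 1)) ^ 2) ^ k := by rw [hzw, ← pow_add, e1, pow_mul]
        _ = 1 := by rw [hzk, one_pow]
    rw [this, sub_self, zero_div]

/-- Functions of the form `∑_{p + q = k} a_{p,q} c^p conj(c)^q`. -/
def biHom (k : ℕ) : Submodule ℂ (ℂ → ℂ) :=
  Submodule.span ℂ {f | ∃ p q, p + q = k ∧ f = fun c => c ^ p * (starRingEnd ℂ c) ^ q}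

theorem biHom_mul {k : ℕ} {f : ℂ → ℂ} (hf : f ∈ biHom k) (a b : ℂ) :
    (fun c => (a * c + b * starRingEnd ℂ c) * f c) ∈ biHom (k + 1) := by
  induction hf using Submodule.span_induction with
  | mem f h =>
    obtain ⟨p, q, rfl, rfl⟩ := h
    have h1 : (fun c : ℂ => c ^ (p + 1) * (starRingEnd ℂ c) ^ q) ∈ biHom (p + q + 1) :=
      Submodule.subset_span ⟨p + 1, q, by omega, rfl⟩
    have h2 : (fun c : ℂ => c ^ p * (starRingEnd ℂ c) ^ (q + 1)) ∈ biHom (p + q + 1) :=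
      Submodule.subset_span ⟨p, q + 1, by omega, rfl⟩
    convert! (biHom (p + q + 1)).add_mem (Submodule.smul_mem _ a h1) (Submodule.smul_mem _ b h2)
      using 1
    funext c
    simp only [Pi.add_apply, Pi.smul_apply, smul_eq_mul]
    ring
  | zero => simp only [Pi.zero_apply, mul_zero]; exact Submodule.zero_mem _
  | add f g _ _ hf hg =>
    convert! Submodule.add_mem _ hf hg using 1
    funext c
    simp only [Pi.add_apply]
    ring
  | smul r f _ hf =>
    convert! Submodule.smul_mem _ r hf using 1
    funext c
    simp only [Pi.smul_apply, smul_eq_mul]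
    ring

theorem biHom_pow (r s : ℕ) :
    (fun c : ℂ => ((c.re : ℂ)) ^ r * ((c.im : ℂ)) ^ s) ∈ biHom (r + s) := by
  induction s with
  | zero =>
    induction r with
    | zero => exact Submodule.subset_span ⟨0, 0, rfl, by simp⟩
    | succ r ih =>
      convert! biHom_mul ih (1 / 2) (1 / 2) using 1
      funext c
      have : (c.re : ℂ) = 1 / 2 * c + 1 / 2 * starRingEnd ℂ c := by
        rw [Complex.re_eq_add_conj]; ring
      rw [← this]; ring
  | succ s ih =>
    convert! biHom_mul ih (1 / (2 * Complex.I)) (-1 / (2 * Complex.I)) using 1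
    funext c
    have : (c.im : ℂ) = 1 / (2 * Complex.I) * c + -1 / (2 * Complex.I) * starRingEnd ℂ c := by
      rw [Complex.im_eq_sub_conj]; ring
    rw [← this]; ring

theorem apply_smul_mem_biHom {k : ℕ} (α : Alt V k) (v : Fin k → V) :
    (fun c : ℂ => α (fun i => c • v i)) ∈ biHom k := by
  have h : (fun c : ℂ => α (fun i => c • v i)) = ∑ s : Finset (Fin k),
      α (s.piecewise v fun i => Complex.I • v i) •
        fun c : ℂ => ((c.re : ℂ)) ^ s.card * ((c.im : ℂ)) ^ sᶜ.card := by
    funext c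
    have h1 : (fun i => c • v i) =
        (fun i => c.re • v i) + fun i => c.im • (Complex.I • v i) := by
      funext i
      simp only [Pi.add_apply]
      nth_rewrite 1 [← Complex.re_add_im c]
      rw [add_smul, mul_smul, Complex.coe_smul, Complex.coe_smul]
    rw [h1, α.map_add_univ, Finset.sum_apply]
    refine Finset.sum_congr rfl fun s _ => ?_
    have h2 : (s.piecewise (fun i => c.re • v i) fun i => c.im • (Complex.I • v i)) =
        fun i => (s.piecewise (fun _ => c.re) fun _ => c.im : Fin k → ℝ) i •
          (s.piecewise v fun i => Complex.I • v i) i := by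
      funext i
      by_cases hi : i ∈ s <;> simp [hi]
    rw [h2, α.map_smul_univ, Finset.prod_piecewise]
    simp [Finset.compl_eq_univ_sdiff, mul_comm]
  rw [h]
  refine Submodule.sum_mem _ fun s _ => Submodule.smul_mem _ _ ?_
  have hs : s.card + sᶜ.card = k := by simp [Finset.card_add_card_compl]
  have := biHom_pow s.card sᶜ.card
  rwa [hs] at this

/-- `Π^{p,q} α` has type `(p, q)`. -/
theorem typeProj_isType {k p q : ℕ} (α : Alt V k) : IsType p q (typeProj p q α) := by
  intro c v
  by_cases h : p + q = k
  swap
  · simp [typeProj, h]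
  have key : ∀ f ∈ biHom k, ∑ j ∈ Finset.range (k + 1),
      ((starRingEnd ℂ (rootU k ^ j)) ^ p * (rootU k ^ j) ^ q) * f (rootU k ^ j * c) =
      c ^ p * (starRingEnd ℂ c) ^ q * ∑ j ∈ Finset.range (k + 1),
      ((starRingEnd ℂ (rootU k ^ j)) ^ p * (rootU k ^ j) ^ q) * f (rootU k ^ j) := by
    intro f hf
    induction hf using Submodule.span_induction with
    | mem f hf =>
      obtain ⟨p', q', h', rfl⟩ := hf
      have e : ∀ j, ((starRingEnd ℂ (rootU k ^ j)) ^ p * (rootU k ^ j) ^ q) *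
          ((rootU k ^ j * c) ^ p' * (starRingEnd ℂ (rootU k ^ j * c)) ^ q') =
          c ^ p' * (starRingEnd ℂ c) ^ q' *
          (((starRingEnd ℂ (rootU k ^ j)) ^ p * (rootU k ^ j) ^ q) *
          ((rootU k ^ j) ^ p' * (starRingEnd ℂ (rootU k ^ j)) ^ q')) := by
        intro j
        rw [map_mul]
        ring
      simp_rw [e]
      rw [← Finset.mul_sum, sum_rootU h h']
      by_cases hp : p = p'
      · obtain rfl : q = q' := by omega
        rw [hp]
      · simp [hp]
    | zero => simp
    | add f g _ _ hf hg =>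
      simp only [Pi.add_apply, mul_add, Finset.sum_add_distrib]
      rw [hf, hg]
    | smul r f _ hf =>
      simp only [Pi.smul_apply, smul_eq_mul, mul_left_comm _ r, ← Finset.mul_sum]
      rw [hf]
  have := key _ (apply_smul_mem_biHom α v)
  simp only [typeProj, h, if_true, ContinuousAlternatingMap.smul_apply,
    ContinuousAlternatingMap.sum_apply, ContinuousAlternatingMap.compContinuousLinearMap_apply,
    smul_eq_mul, Function.comp_def, mulC_apply, smul_smul]
  rw [this]
  ring

/-- A `k`-form is the sum of its components of type `(p, q)`, `p + q = k`. -/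
theorem sum_typeProj {k : ℕ} (α : Alt V k) :
    ∑ pq ∈ Finset.HasAntidiagonal.antidiagonal k, typeProj pq.1 pq.2 α = α := by
  ext v
  have h1 : ∀ pq ∈ Finset.HasAntidiagonal.antidiagonal k, typeProj pq.1 pq.2 α v =
      ((k : ℂ) + 1)⁻¹ * ∑ j ∈ Finset.range (k + 1),
      ((starRingEnd ℂ (rootU k ^ j)) ^ pq.1 * (rootU k ^ j) ^ pq.2) *
        α (fun i => rootU k ^ j • v i) := by
    intro pq hpq
    simp only [typeProj, Finset.HasAntidiagonal.mem_antidiagonal.1 hpq, if_true,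
      ContinuousAlternatingMap.smul_apply,
      ContinuousAlternatingMap.sum_apply, ContinuousAlternatingMap.compContinuousLinearMap_apply,
      smul_eq_mul, Function.comp_def, mulC_apply]
  rw [ContinuousAlternatingMap.sum_apply, Finset.sum_congr rfl h1, ← Finset.mul_sum]
  have key : ∀ f ∈ biHom k, ((k : ℂ) + 1)⁻¹ * ∑ pq ∈ Finset.HasAntidiagonal.antidiagonal k,
      ∑ j ∈ Finset.range (k + 1),
      ((starRingEnd ℂ (rootU k ^ j)) ^ pq.1 * (rootU k ^ j) ^ pq.2) * f (rootU k ^ j) = f 1 := by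
    intro f hf
    induction hf using Submodule.span_induction with
    | mem f hf =>
      obtain ⟨p', q', h', rfl⟩ := hf
      rw [Finset.sum_congr rfl fun pq hpq => sum_rootU (Finset.HasAntidiagonal.mem_antidiagonal.1 hpq) h']
      rw [Finset.sum_eq_single (p', q')]
      · have : (k : ℂ) + 1 ≠ 0 := by exact_mod_cast Nat.succ_ne_zero k
        simp [this]
      · rintro ⟨a, b⟩ hab hne
        rw [if_neg]
        rintro rfl
        have := Finset.HasAntidiagonal.mem_antidiagonal.1 hab
        exact hne (by ext <;> simp; omega)
      · intro h
        exact absurd (Finset.HasAntidiagonal.mem_antidiagonal.2 h') h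
    | zero => simp
    | add f g _ _ hf hg =>
      simp only [Pi.add_apply, mul_add, Finset.sum_add_distrib] at hf hg ⊢
      rw [hf, hg]
    | smul r f _ hf =>
      simp only [Pi.smul_apply, smul_eq_mul, mul_left_comm _ r, ← Finset.mul_sum] at hf ⊢
      rw [hf]
  simpa using key _ (apply_smul_mem_biHom α v)

/-! #### Hermitian scalar products -/

theorem exists_orthonormal_basis {W : Type*} [AddCommGroup W] [Module ℝ W] [FiniteDimensional ℝ W]
    (B : W → W → ℝ) (hadd : ∀ u v w, B (u + v) w = B u w + B v w)
    (hsmul : ∀ (c : ℝ) u v, B (c • u) v = c * B u v)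
    (hsymm : ∀ u v, B u v = B v u) (hpos : ∀ v, v ≠ 0 → 0 < B v v) :
    ∃ e : Module.Basis (Fin (Module.finrank ℝ W)) ℝ W,
      ∀ i j, B (e i) (e j) = if i = j then 1 else 0 := by
  have h0 : B 0 0 = 0 := by simpa using hsmul 0 0 0
  let core : InnerProductSpace.Core ℝ W :=
    { inner := B
      conj_inner_symm := fun u v => by simpa using hsymm v u
      re_inner_nonneg := fun v => by
        by_cases hv : v = 0
        · simp [hv, h0]
        · simpa using (hpos v hv).le
      add_left := hadd
      smul_left := fun u v c => by simpa using hsmul c u v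
      definite := fun v hv => by
        by_contra h
        exact (hpos v h).ne' hv }
  let i1 : NormedAddCommGroup W := core.toNormedAddCommGroup
  let i2 : InnerProductSpace ℝ W := InnerProductSpace.ofCore core.toCore
  let b := stdOrthonormalBasis ℝ W
  refine ⟨b.toBasis, fun i j => ?_⟩
  have h : B (b i) (b j) = if i = j then 1 else 0 := orthonormal_iff_ite.1 b.orthonormal i j
  simpa using h

/-- A real scalar product on `V` that is invariant under the complex structure. -/
structure HermInner (V : Type*) [NormedAddCommGroup V] [NormedSpace ℂ V] where
  /-- the scalar product -/
  inner : V →L[ℝ] V →L[ℝ] ℝ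
  symm : ∀ u v, inner u v = inner v u
  pos : ∀ v, v ≠ 0 → 0 < inner v v
  J_isometry : ∀ u v, inner (Complex.I • u) (Complex.I • v) = inner u v

namespace HermInner

variable (g : HermInner V)

theorem inner_J_self (v : V) : g.inner (Complex.I • v) v = 0 := by
  have h := g.J_isometry (Complex.I • v) v
  rw [smul_smul, Complex.I_mul_I, neg_one_smul, map_neg, neg_apply,
    g.symm v] at h
  linarith

/-- The fundamental form `ω = g(J ·, ·)`. -/
def fundForm : Alt V 2 where
  toFun v := ((g.inner (Complex.I • v 0) (v 1) : ℝ) : ℂ)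
  map_update_add' := by
    intro inst v i x y
    rw [Subsingleton.elim inst (instDecidableEqFin _)]
    fin_cases i <;> simp
  map_update_smul' := by
    intro inst v i c x
    rw [Subsingleton.elim inst (instDecidableEqFin _)]
    fin_cases i <;> simp [smul_comm Complex.I c x]
  map_eq_zero_of_eq' := by
    intro v i j hv hij
    have h01 : v 0 = v 1 := by
      fin_cases i <;> fin_cases j <;> simp_all
    simp [h01, g.inner_J_self]
  cont := by fun_prop

/-- The Lefschetz operator `L α = ω ∧ α`. -/
def lef (α : GAlt V) : GAlt V
  | 0 => 0
  | 1 => 0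
  | k + 2 => wedge (Nat.add_comm 2 k) g.fundForm (α k)

/-- The unit `1` of the exterior algebra. -/
def oneForm : GAlt V :=
  Pi.single 0 (ContinuousAlternatingMap.constOfIsEmpty ℝ V (Fin 0) (1 : ℂ))

/-- The volume form `ω^n / n!`, `n = dim_ℂ V`. -/
def vol : Alt V (2 * Module.finrank ℂ V) :=
  ((Module.finrank ℂ V)! : ℂ)⁻¹ •
    (g.lef^[Module.finrank ℂ V] oneForm) (2 * Module.finrank ℂ V)

variable [FiniteDimensional ℂ V]

theorem exists_frame : ∃ e : Module.Basis (Fin (2 * Module.finrank ℂ V)) ℝ V,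
    ∀ i j, g.inner (e i) (e j) = if i = j then 1 else 0 := by
  have : FiniteDimensional ℝ V := FiniteDimensional.complexToReal V
  obtain ⟨b, hb⟩ := exists_orthonormal_basis (fun u v => g.inner u v) (by simp) (by simp)
    g.symm g.pos
  refine ⟨b.reindex (finCongr (finrank_real_of_complex V)), fun i j => ?_⟩
  simpa [Fin.ext_iff] using hb ((finCongr (finrank_real_of_complex V)).symm i)
    ((finCongr (finrank_real_of_complex V)).symm j)

/-- A real basis of `V` which is orthonormal for `g`. -/
def frame : Module.Basis (Fin (2 * Module.finrank ℂ V)) ℝ V := g.exists_frame.choose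

/-- The (complex bilinear) scalar product induced on `k`-forms, for which the
`e^{i₁} ∧ … ∧ e^{i_k}`, `i₁ < … < i_k`, are orthonormal. -/
def formInner {k : ℕ} (α β : Alt V k) : ℂ :=
  (k ! : ℂ)⁻¹ * ∑ i : Fin k → Fin (2 * Module.finrank ℂ V),
    α (fun s => g.frame (i s)) * β (fun s => g.frame (i s))

/-- The Hodge operator from degree `k` to degree `j`, where `k + j` is the real dimension:
`(* β)(v) = 1/k! ∑_{i₁, …, i_k} β(e_{i₁}, …, e_{i_k}) vol(e_{i₁}, …, e_{i_k}, v)`.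
It satisfies `α ∧ * β = ⟨α, β⟩ vol`, see `wedge_hodge`. -/
def hodge {k j : ℕ} (h : k + j = 2 * Module.finrank ℂ V) (β : Alt V k) : Alt V j :=
  (k ! : ℂ)⁻¹ • ∑ i : Fin k → Fin (2 * Module.finrank ℂ V),
    β (fun s => g.frame (i s)) • contract h (fun s => g.frame (i s)) g.vol

/-- The Hodge operator on forms of all degrees. -/
def star (α : GAlt V) : GAlt V := fun j =>
  if h : j ≤ 2 * Module.finrank ℂ V then
    g.hodge (Nat.sub_add_cancel h) (α (2 * Module.finrank ℂ V - j))
  else 0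

/-- The dual Lefschetz operator, contraction with `ω`. It is the adjoint of `L`,
see `formInner_lam`. -/
def lam (α : GAlt V) : GAlt V := fun k =>
  (2 : ℂ)⁻¹ • ∑ a, ∑ b, g.fundForm ![g.frame a, g.frame b] •
    contract (Nat.add_comm 2 k) ![g.frame a, g.frame b] (α (k + 2))

/-- The defining property of `Λ`: it is the adjoint of `L`. -/
theorem formInner_lam {k : ℕ} (α : GAlt V) (β : GAlt V) :
    g.formInner (g.lam α k) (β k) = g.formInner (α (k + 2)) (g.lef β (k + 2)) := by
  change _ = g.formInner (α (k + 2)) (wedge (Nat.add_comm 2 k) g.fundForm (β k))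
  rw [formInner, formInner, sum_mul_wedge, sum_tensorMul]
  have h1 : ∀ v, g.lam α k v = (2 : ℂ)⁻¹ * ∑ i : Fin 2 → Fin (2 * Module.finrank ℂ V),
      g.fundForm (fun s => g.frame (i s)) *
        contract (Nat.add_comm 2 k) (fun s => g.frame (i s)) (α (k + 2)) v := by
    intro v
    rw [← Equiv.sum_comp (finTwoArrowEquiv _).symm, Fintype.sum_prod_type]
    simp only [lam, ContinuousAlternatingMap.smul_apply, ContinuousAlternatingMap.sum_apply,
      smul_eq_mul]
    have h2 : ∀ a b, (fun s => g.frame ((finTwoArrowEquiv _).symm (a, b) s)) =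
        ![g.frame a, g.frame b] := by
      intro a b
      funext s
      fin_cases s <;> rfl
    simp_rw [h2]
  simp_rw [h1]
  have hk : ((k + 2)! : ℂ) ≠ 0 := by exact_mod_cast (Nat.factorial_pos _).ne'
  have hk' : (k ! : ℂ) ≠ 0 := by exact_mod_cast (Nat.factorial_pos _).ne'
  rw [Finset.sum_comm, ← mul_assoc, ← mul_assoc, inv_mul_cancel₀ hk, one_mul]
  simp only [mul_assoc, ← Finset.mul_sum]
  simp_rw [← mul_assoc, ← Finset.sum_mul]
  simp

/-- The defining property of the Hodge operator: `α ∧ * β = ⟨α, β⟩ vol`. -/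
theorem wedge_hodge {k j : ℕ} (h : k + j = 2 * Module.finrank ℂ V) (α β : Alt V k) :
    wedge h α (g.hodge h β) = g.formInner α β • g.vol := by
  apply ContinuousAlternatingMap.toAlternatingMap_injective
  refine Module.Basis.ext_alternating g.frame fun v hv => ?_
  have hperm : (fun s => g.frame (v s)) =
      g.frame ∘ (Equiv.ofBijective v (Finite.injective_iff_bijective.1 hv)) := rfl
  rw [hperm, AlternatingMap.map_perm, AlternatingMap.map_perm]
  congr 1
  change wedge h α (g.hodge h β) g.frame = g.formInner α β * g.vol g.frame
  rw [wedge, ContinuousAlternatingMap.smul_apply,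
    ContinuousMultilinearMap.alternatization_apply_apply, smul_eq_mul]
  have hk : (k ! : ℂ) ≠ 0 := by exact_mod_cast (Nat.factorial_pos _).ne'
  have hj : (j ! : ℂ) ≠ 0 := by exact_mod_cast (Nat.factorial_pos _).ne'
  have h1 : ∀ ρ : Equiv.Perm (Fin (2 * Module.finrank ℂ V)),
      Equiv.Perm.sign ρ • tensorMul h α (g.hodge h β) (g.frame ∘ ρ) =
      (fun i : Fin k → Fin (2 * Module.finrank ℂ V) =>
        α (fun s => g.frame (i s)) * β (fun s => g.frame (i s)) * g.vol g.frame)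
        (fun s => ρ (Fin.cast h (Fin.castAdd j s))) := by
    intro ρ
    have h2 : g.hodge h β (fun s => g.frame (ρ (Fin.cast h (Fin.natAdd k s)))) =
        Equiv.Perm.sign ρ •
        (β (fun s => g.frame (ρ (Fin.cast h (Fin.castAdd j s)))) * g.vol g.frame) := by
      rw [hodge, ContinuousAlternatingMap.smul_apply, ContinuousAlternatingMap.sum_apply]
      simp only [ContinuousAlternatingMap.smul_apply, smul_eq_mul]
      rw [sum_contract_perm, inv_mul_cancel_left₀ hk]
    change Equiv.Perm.sign ρ • (α _ * g.hodge h β _) = _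
    simp only [Function.comp_apply]
    rw [h2, mul_smul_comm, smul_smul, Int.units_mul_self, one_smul, mul_assoc]
  rw [Finset.sum_congr rfl fun ρ _ => h1 ρ, sum_perm_castAdd h
    (fun i : Fin k → Fin (2 * Module.finrank ℂ V) =>
      α (fun s => g.frame (i s)) * β (fun s => g.frame (i s)) * g.vol g.frame) ?_]
  · rw [formInner, ← Finset.sum_mul]
    field_simp
  · intro i hi
    have : α (fun s => g.frame (i s)) = 0 := by
      apply α.map_eq_zero_of_not_injective
      exact fun hh => hi (Function.Injective.of_comp (f := g.frame) hh)
    simp [this]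

end HermInner

end Fibre

/-! ### Differential forms on a complex manifold

`X` is a complex manifold with charts in the finite dimensional complex vector space `E`. The
tangent space `TangentSpace 𝓘(ℝ, E) x` is by definition a copy of `E`, identified with it by the
differential of the preferred chart `chartAt E x`; the complex structure of `T_x X` is thereby
multiplication by `i` on `E`. -/

section Manifold

variable {E : Type*} [NormedAddCommGroup E] [NormedSpace ℂ E]
  {X : Type*} [TopologicalSpace X] [ChartedSpace E X]

/-- A complex manifold is a real smooth manifold. -/
instance realManifold [IsManifold 𝓘(ℂ, E) ω X] : IsManifold 𝓘(ℝ, E) ω X := by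
  refine isManifold_of_contDiffOn _ _ _ fun e e' he he' => ?_
  have h := HasGroupoid.compatible (G := contDiffGroupoid ω 𝓘(ℂ, E)) he he'
  rw [contDiffGroupoid, mem_groupoid_of_pregroupoid] at h
  have h2 : ContDiffOn ℂ ω (e.symm ≫ₕ e') (e.symm ≫ₕ e').source := by
    simpa [contDiffPregroupoid] using h.1
  simpa using h2.restrict_scalars ℝ

/-- Complex-valued `k`-forms on `X` (no smoothness): `α x` is a form on `T_x X`. -/
abbrev Form (E X : Type*) [NormedAddCommGroup E] [NormedSpace ℂ E] (k : ℕ) : Type _ :=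
  X → Alt E k

/-- Complex-valued forms of all degrees on `X`. -/
abbrev GForm (E X : Type*) [NormedAddCommGroup E] [NormedSpace ℂ E] : Type _ :=
  ∀ k : ℕ, Form E X k

/-- The expression of a form in the chart `φ` at `x₀`: the pull-back by `φ⁻¹`. -/
def chartRep {k : ℕ} (α : Form E X k) (x₀ : X) : E → Alt E k := fun y =>
  (α ((chartAt E x₀).symm y)).compContinuousLinearMap
    (mfderiv 𝓘(ℝ, E) 𝓘(ℝ, E) (chartAt E x₀).symm y : E →L[ℝ] E)

/-- A `k`-form is smooth if it is smooth in charts. -/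
def IsSmoothForm {k : ℕ} (α : Form E X k) : Prop :=
  ∀ x₀ : X, ContDiffOn ℝ ∞ (chartRep α x₀) (chartAt E x₀).target

/-- Smooth forms of all degrees. -/
def IsSmooth (α : GForm E X) : Prop := ∀ k, IsSmoothForm (α k)

/-- The exterior derivative of a `k`-form: at `x`, it is computed in the chart `φ` at `x`, as
`φ^* d ((φ⁻¹)^* α)`. -/
def dForm {k : ℕ} (α : Form E X k) : Form E X (k + 1) := fun x =>
  (extDeriv (chartRep α x) (chartAt E x x)).compContinuousLinearMap
    (mfderiv 𝓘(ℝ, E) 𝓘(ℝ, E) (chartAt E x) x : E →L[ℝ] E)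

/-- The exterior derivative. -/
def d (α : GForm E X) : GForm E X
  | 0 => 0
  | k + 1 => dForm (α k)

/-- The operator `∂`, equal to `Π^{p+1,q} ∘ d` on forms of type `(p, q)`. -/
def del (α : GForm E X) : GForm E X
  | 0 => 0
  | k + 1 => fun x => ∑ pq ∈ Finset.HasAntidiagonal.antidiagonal k,
      typeProj (pq.1 + 1) pq.2 (dForm (fun y => typeProj pq.1 pq.2 (α k y)) x)

/-- The operator `∂̄`, equal to `Π^{p,q+1} ∘ d` on forms of type `(p, q)`. -/
def delBar (α : GForm E X) : GForm E X
  | 0 => 0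
  | k + 1 => fun x => ∑ pq ∈ Finset.HasAntidiagonal.antidiagonal k,
      typeProj pq.1 (pq.2 + 1) (dForm (fun y => typeProj pq.1 pq.2 (α k y)) x)

/-! #### Hermitian and Kähler metrics -/

variable (E X) in
/-- A Hermitian metric: a smooth Riemannian metric for which `J` is an isometry. -/
structure HermitianMetric [IsManifold 𝓘(ℂ, E) ω X] extends
    Bundle.ContMDiffRiemannianMetric 𝓘(ℝ, E) ∞ E (TangentSpace 𝓘(ℝ, E) : X → Type _) where
  J_isometry : ∀ (x : X) (u v : E), inner x (Complex.I • u : E) (Complex.I • v : E) = inner x u v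

namespace HermitianMetric

variable [IsManifold 𝓘(ℂ, E) ω X] (g : HermitianMetric E X)

/-- The scalar product on `T_x X`. -/
def fibre (x : X) : HermInner E where
  inner := g.inner x
  symm := g.symm x
  pos := g.pos x
  J_isometry := g.J_isometry x

/-- The fundamental form of a Hermitian metric. -/
def fundForm : Form E X 2 := fun x => (g.fibre x).fundForm

/-- A Kähler metric is a Hermitian metric whose fundamental form is closed. -/
def IsKahler : Prop := dForm g.fundForm = 0

/-- The Lefschetz operator `L`. -/
def L (α : GForm E X) : GForm E X := fun k x => (g.fibre x).lef (fun l => α l x) k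

variable [FiniteDimensional ℂ E]

/-- The Hodge operator `*`. -/
def star (α : GForm E X) : GForm E X := fun k x => (g.fibre x).star (fun l => α l x) k

/-- The dual Lefschetz operator `Λ`. -/
def Lam (α : GForm E X) : GForm E X := fun k x => (g.fibre x).lam (fun l => α l x) k

/-- `d^* = - * d *` (the real dimension is even). -/
def dStar (α : GForm E X) : GForm E X := -g.star (d (g.star α))

/-- `∂^* = - * ∂̄ *`. -/
def delStar (α : GForm E X) : GForm E X := -g.star (delBar (g.star α))

/-- `∂̄^* = - * ∂ *`. -/
def delBarStar (α : GForm E X) : GForm E X := -g.star (del (g.star α))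

/-- The Laplacian `Δ = d d^* + d^* d`. -/
def lap (α : GForm E X) : GForm E X := d (g.dStar α) + g.dStar (d α)

/-- The Laplacian `Δ_∂ = ∂ ∂^* + ∂^* ∂`. -/
def lapDel (α : GForm E X) : GForm E X := del (g.delStar α) + g.delStar (del α)

/-- The Laplacian `Δ_∂̄ = ∂̄ ∂̄^* + ∂̄^* ∂̄`. -/
def lapDelBar (α : GForm E X) : GForm E X :=
  delBar (g.delBarStar α) + g.delBarStar (delBar α)

end HermitianMetric

end Manifold

/-- The commutator `[A, B] α = A (B α) - B (A α)` of two operators. -/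
def comm {M : Type*} [AddCommGroup M] (A B : M → M) (α : M) : M := A (B α) - B (A α)

end KahlerIdentities

end

/-! A Kähler metric agrees with a flat one to first order at each point, so identities between
first-order operators built from the Hermitian structure reduce to algebra in a single tangent
space. The reduction rests on `exists_adapted_frame`: near a point `p` the tangent spaces are
identified with the one at `p` by complex-linear isometries, given in the chart by a smooth family
`A` that is the identity at `p` and whose first derivative there is a symmetric bilinear map. The
symmetry is where `dω = 0` enters.

Differentiating the components of a form in such a frame (`jet`) plays the role of the Levi-Civita
derivative `∇` at `p`. Two facts make it usable. The symmetry of the derivative of `A` means that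
there is no torsion, so `d = ∑ e^a ∧ ∇_a` (`HermitianMetric.IsAdapted.dForm_eq`). An operator that
is natural for complex-linear isometries (`IsNatural`) has constant coefficients in the frame and
hence commutes with `∇` (`HermitianMetric.IsAdapted.jet_act`); this covers `L`, `Λ`, `*` and the
projections onto types. Therefore `∂ = ∑ (e^a)^{1,0} ∧ ∇_a` and `∂̄ = ∑ (e^a)^{0,1} ∧ ∇_a`.
Conjugation by `*` turns exterior multiplication by `g(v, ·)` into contraction with `v`, so `∂^* =
-∑ ι(e_a^{1,0}) ∇_a` and `∂̄^* = -∑ ι(e_a^{0,1}) ∇_a`.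

In the fibre, everything follows from `ι_u ξ∧ + ξ∧ ι_u = ξ(u)` and the formulas `L = ½ ∑ e^a ∧ (J
e_a)^♭ ∧` and `Λ = ½ ∑ ι_{J e_a} ι_{e_a}`. Exterior multiplications anticommute with each other, and
so do contractions, which gives identities 1. Further `[Λ, v^♭ ∧] = ι_{J v}` and `[ι_v, L] = (J v)^♭
∧`, and the type components of these are the symbols of identities 2 and 3. The Hodge operator is
normalised by `ω^n / n!`, and `** = (-1)^k` on `k`-forms requires this form to have length one; this
comes from the `sl₂` computation `Λ L^{j+1} 1 = (j+1)(n-j) L^j 1`.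

Identities 4 follow formally from identities 2 together with `∂² = ∂̄² = ∂∂̄ + ∂̄∂ = 0`
(`laplacian_identities`). The latter relations come from `d² = 0`: rotating all tangent vectors by
`c ≠ 0` intertwines `|c|² d` with `c̄ ∂ + c ∂̄`, which therefore squares to zero for every such `c`,
and the coefficients of `c²`, `|c|²` and `c̄²` can be separated (`components_of_sq_eq_zero`). -/

open scoped Manifold ContDiff Nat

noncomputable section

namespace KahlerIdentities

/-! ### Exterior multiplication, contraction and their anticommutation relations. -/

section ExteriorAlgebra

open ContinuousAlternatingMap

variable {V : Type*} [NormedAddCommGroup V] [NormedSpace ℂ V]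

/-- The complexified exterior algebra `GAlt V`, wrapped as a type with its own instances. -/
structure GA (V : Type*) [NormedAddCommGroup V] [NormedSpace ℂ V] where
  /-- the component of degree `k` -/
  toFun : GAlt V

namespace GA

instance : DFunLike (GA V) ℕ (Alt V) := ⟨toFun, fun ⟨_⟩ ⟨_⟩ => congrArg mk⟩

@[ext] theorem ext {α β : GA V} (h : ∀ k, α k = β k) : α = β := DFunLike.ext _ _ h

@[simp] theorem mk_apply (α : GAlt V) (k : ℕ) : mk α k = α k := rfl

instance : Zero (GA V) := ⟨⟨0⟩⟩
instance : Add (GA V) := ⟨fun α β => ⟨fun k => α k + β k⟩⟩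
instance : Sub (GA V) := ⟨fun α β => ⟨fun k => α k - β k⟩⟩
instance : Neg (GA V) := ⟨fun α => ⟨fun k => -α k⟩⟩
instance {R : Type*} [SMul R (GAlt V)] : SMul R (GA V) := ⟨fun c α => ⟨c • α.toFun⟩⟩

theorem toFun_injective : Function.Injective (toFun : GA V → GAlt V) :=
  fun _ _ h => ext fun k => congrFun h k

instance : AddCommGroup (GA V) :=
  toFun_injective.addCommGroup _ rfl (fun _ _ => rfl) (fun _ => rfl) (fun _ _ => rfl)
    (fun _ _ => rfl) (fun _ _ => rfl)

instance : Module ℂ (GA V) :=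
  toFun_injective.module ℂ ⟨⟨toFun, rfl⟩, fun _ _ => rfl⟩ fun _ _ => rfl

@[simp] theorem zero_apply (k : ℕ) : (0 : GA V) k = 0 := rfl

@[simp] theorem add_apply (α β : GA V) (k : ℕ) : (α + β) k = α k + β k := rfl

@[simp] theorem sub_apply (α β : GA V) (k : ℕ) : (α - β) k = α k - β k := rfl

@[simp] theorem neg_apply (α : GA V) (k : ℕ) : (-α) k = -α k := rfl

@[simp] theorem smul_apply (c : ℂ) (α : GA V) (k : ℕ) : (c • α) k = c • α k := rfl

@[simp] theorem sum_apply {ι : Type*} (s : Finset ι) (α : ι → GA V) (k : ℕ) :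
    (∑ i ∈ s, α i) k = ∑ i ∈ s, α i k :=
  map_sum (⟨⟨fun β => β k, rfl⟩, fun _ _ => rfl⟩ : GA V →+ Alt V k) α s

end GA

/-- Exterior multiplication of `k`-forms by a complex-valued covector. -/
def extMulHom (k : ℕ) (ξ : V →L[ℝ] ℂ) : Alt V k →ₗ[ℂ] Alt V (k + 1) where
  toFun β := alternatizeUncurryFin (ξ.smulRight β)
  map_add' β γ := by
    rw [← alternatizeUncurryFin_add]; congr 1; ext; simp
  map_smul' c β := by
    rw [RingHom.id_apply, ← alternatizeUncurryFin_smul]; congr 1; ext; simp; ring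

theorem extMulHom_apply {k : ℕ} (ξ : V →L[ℝ] ℂ) (β : Alt V k) (v : Fin (k + 1) → V) :
    extMulHom k ξ β v = ∑ i : Fin (k + 1), (-1) ^ (i : ℕ) * (ξ (v i) * β (i.removeNth v)) := by
  change alternatizeUncurryFin _ _ = _
  rw [alternatizeUncurryFin_apply]
  simp

/-- Exterior multiplication by a complex-valued covector. -/
def extMul (ξ : V →L[ℝ] ℂ) : Module.End ℂ (GA V) where
  toFun β := ⟨fun
    | 0 => 0
    | k + 1 => extMulHom k ξ (β k)⟩
  map_add' β γ := by
    ext1 k; cases k <;> simp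
  map_smul' c β := by
    ext1 k; cases k
    · exact (smul_zero (A := Alt V 0) c).symm
    · simp

@[simp] theorem extMul_zero_apply (ξ : V →L[ℝ] ℂ) (β : GA V) : extMul ξ β 0 = 0 := rfl

@[simp] theorem extMul_succ_apply (ξ : V →L[ℝ] ℂ) (β : GA V) (k : ℕ) :
    extMul ξ β (k + 1) = extMulHom k ξ (β k) := rfl

/-- Contraction with a vector. -/
def intMul (v : V) : Module.End ℂ (GA V) where
  toFun β := ⟨fun k => (β (k + 1)).curryLeft v⟩
  map_add' _ _ := rfl
  map_smul' _ _ := rfl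

@[simp] theorem intMul_apply (v : V) (β : GA V) (k : ℕ) :
    intMul v β k = (β (k + 1)).curryLeft v := rfl

theorem intMul_add (u v : V) : intMul (u + v) = intMul u + intMul v := by
  ext β k w; simp

theorem intMul_smul (c : ℝ) (v : V) : intMul (c • v) = (c : ℂ) • intMul v := by
  ext β k w
  rw [LinearMap.smul_apply, GA.smul_apply, intMul_apply, intMul_apply, map_smul]
  simp

theorem extMul_add (ξ η : V →L[ℝ] ℂ) : extMul (ξ + η) = extMul ξ + extMul η := by
  ext β k w
  cases k <;> simp [extMulHom_apply, add_mul, mul_add, Finset.sum_add_distrib]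

theorem extMul_smul (c : ℂ) (ξ : V →L[ℝ] ℂ) : extMul (c • ξ) = c • extMul ξ := by
  ext β k w
  cases k <;> simp [extMulHom_apply, Finset.mul_sum, mul_left_comm, mul_assoc]

/-- The term `i = 0` of the alternating sum feeds `v` to the covector. In every other term `v` stays
in the first slot of the form, and the shift of the index by one produces the minus sign. -/
theorem intMul_mul_extMul (v : V) (ξ : V →L[ℝ] ℂ) :
    intMul v * extMul ξ = ξ v • (1 : Module.End ℂ (GA V)) - extMul ξ * intMul v := by
  ext β k w
  rcases k with _ | k
  · simp [extMulHom_apply]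
  · simp only [Module.End.mul_apply, intMul_apply, extMul_succ_apply, curryLeft_apply_apply,
      extMulHom_apply, LinearMap.sub_apply, LinearMap.smul_apply, Module.End.one_apply,
      GA.sub_apply, GA.smul_apply, ContinuousAlternatingMap.sub_apply,
      ContinuousAlternatingMap.smul_apply, smul_eq_mul]
    rw [Fin.sum_univ_succ, sub_eq_add_neg, ← Finset.sum_neg_distrib]
    congr 1
    · simp [Matrix.vecCons]
    · refine Finset.sum_congr rfl fun i _ => ?_
      have : (i.succ.removeNth (Matrix.vecCons v w) : Fin (k + 1) → V) =
          Matrix.vecCons v (i.removeNth w) := by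
        funext j
        refine Fin.cases ?_ (fun j => ?_) j <;> simp [Fin.removeNth, Matrix.vecCons]
      rw [this]
      simp [pow_succ]

/-- This drives inductions on the degree: a relation between operators holds in degree `k + 1` once
it holds in degree `k` after every contraction. -/
theorem GA.eq_zero_of_intMul {β : GA V} {k : ℕ} (h : ∀ v, intMul v β k = 0) : β (k + 1) = 0 := by
  ext w
  have := congrArg (fun γ : Alt V k => γ (Fin.tail w)) (h (w 0))
  simp only [intMul_apply, curryLeft_apply_apply] at this
  change β (k + 1) (Fin.cons (w 0) (Fin.tail w)) = _ at this
  rwa [Fin.cons_self_tail] at this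

/-- The anticommutator commutes with all contractions, by `intMul_mul_extMul`, and it has no
component in degree zero; induction on the degree by contraction shows that it vanishes. -/
theorem extMul_mul_extMul (ξ η : V →L[ℝ] ℂ) :
    extMul ξ * extMul η = -(extMul η * extMul ξ) := by
  rw [eq_neg_iff_add_eq_zero]
  set D : Module.End ℂ (GA V) := extMul ξ * extMul η + extMul η * extMul ξ with hD
  have hI (v : V) : intMul v * D = D * intMul v := by
    rw [hD, mul_add, ← mul_assoc, ← mul_assoc, intMul_mul_extMul, intMul_mul_extMul,
      sub_mul, sub_mul, mul_assoc, mul_assoc, intMul_mul_extMul, intMul_mul_extMul]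
    simp only [mul_sub, smul_mul_assoc, mul_smul_comm, one_mul, mul_one, add_mul, mul_assoc]
    abel
  suffices ∀ k (β : GA V), D β k = 0 from LinearMap.ext fun β => GA.ext fun k => this k β
  intro k
  induction k with
  | zero => intro β; simp [hD]
  | succ k ih =>
    refine fun β => GA.eq_zero_of_intMul fun v => ?_
    rw [← Module.End.mul_apply, hI, Module.End.mul_apply, ih]

/-- Polarisation of the vanishing of a form with a repeated argument, applied to `u + v`, `u` and
`v`. -/
theorem intMul_mul_intMul (u v : V) : intMul u * intMul v = -(intMul v * intMul u) := by
  rw [eq_neg_iff_add_eq_zero]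
  ext β k w
  have h := (β (k + 2)).curryLeft_same (u + v)
  have hu := (β (k + 2)).curryLeft_same u
  have hv := (β (k + 2)).curryLeft_same v
  have h' := congrArg (fun γ : Alt V k => γ w) h
  have hu' := congrArg (fun γ : Alt V k => γ w) hu
  have hv' := congrArg (fun γ : Alt V k => γ w) hv
  simp only [map_add, curryLeft_add, _root_.add_apply, ContinuousAlternatingMap.add_apply,
    ContinuousAlternatingMap.coe_zero, Pi.zero_apply] at h' hu' hv'
  simp only [LinearMap.add_apply, Module.End.mul_apply, GA.add_apply, intMul_apply,
    ContinuousAlternatingMap.add_apply]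
  rw [LinearMap.zero_apply, GA.zero_apply, ContinuousAlternatingMap.coe_zero, Pi.zero_apply]
  linear_combination h' - hu' - hv'

end ExteriorAlgebra

/-! ### The operators `L` and `Λ` in a tight frame. -/

namespace HermInner

open ContinuousAlternatingMap

variable {V : Type*} [NormedAddCommGroup V] [NormedSpace ℂ V] (g : HermInner V)

/-- The covector `g(v, ·)`. -/
def flat (v : V) : V →L[ℝ] ℂ := Complex.ofRealCLM ∘L g.inner v

@[simp] theorem flat_apply (u v : V) : g.flat u v = (g.inner u v : ℂ) := rfl

/-- Exterior multiplication by the covector `g(v, ·)`. -/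
def ext (v : V) : Module.End ℂ (GA V) := extMul (g.flat v)

theorem ext_add (u v : V) : g.ext (u + v) = g.ext u + g.ext v := by
  rw [ext, ext, ext, ← extMul_add]
  congr 1
  ext w; simp

theorem ext_smul (c : ℝ) (v : V) : g.ext (c • v) = (c : ℂ) • g.ext v := by
  rw [ext, ext, ← extMul_smul]
  congr 1
  ext w; simp

theorem ext_neg (v : V) : g.ext (-v) = -g.ext v := by
  have := g.ext_smul (-1) v
  simpa using this

theorem _root_.KahlerIdentities.intMul_neg (v : V) : intMul (-v) = -intMul v := by
  have := intMul_smul (-1) v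
  simpa using this

theorem ext_sum {ι : Type*} (s : Finset ι) (f : ι → V) :
    g.ext (∑ i ∈ s, f i) = ∑ i ∈ s, g.ext (f i) :=
  map_sum (AddMonoidHom.mk' g.ext g.ext_add) f s

theorem _root_.KahlerIdentities.intMul_sum {ι : Type*} (s : Finset ι) (f : ι → V) :
    intMul (∑ i ∈ s, f i) = ∑ i ∈ s, intMul (f i) :=
  map_sum (AddMonoidHom.mk' (intMul (V := V)) intMul_add) f s

theorem intMul_mul_ext (u v : V) :
    intMul u * g.ext v = (g.inner v u : ℂ) • (1 : Module.End ℂ (GA V)) - g.ext v * intMul u :=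
  intMul_mul_extMul u (g.flat v)

theorem ext_mul_ext (u v : V) : g.ext u * g.ext v = -(g.ext v * g.ext u) :=
  extMul_mul_extMul _ _

theorem inner_J_left (u v : V) : g.inner (Complex.I • u) v = -g.inner u (Complex.I • v) := by
  have := g.J_isometry u (-(Complex.I • v))
  rw [smul_neg, smul_smul, Complex.I_mul_I, neg_one_smul, neg_neg] at this
  rw [this, map_neg]

/-- A finite family is a tight frame for `g` if the identity is the sum of the corresponding rank
one maps; for a basis this means that it is orthonormal. -/
def IsFrame {ι : Type*} [Fintype ι] (e : ι → V) : Prop :=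
  ∀ v, ∑ a, g.inner (e a) v • e a = v

/-- Apply `J` to the expansion of `-J v` and use that `J` is skew. -/
theorem IsFrame.J {ι : Type*} [Fintype ι] {e : ι → V} (he : g.IsFrame e) :
    g.IsFrame fun a => Complex.I • e a := by
  intro v
  have h := congrArg (fun w => Complex.I • w) (he (-(Complex.I • v)))
  simp only [Finset.smul_sum, map_neg, smul_neg, smul_smul, Complex.I_mul_I] at h
  rw [neg_one_smul, neg_neg] at h
  refine Eq.trans (Finset.sum_congr rfl fun a _ => ?_) h
  rw [inner_J_left, smul_comm]

section Frame

variable {g} {ι : Type*} [Fintype ι] {e : ι → V}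

theorem IsFrame.sum_intMul (he : g.IsFrame e) (v : V) :
    ∑ a, (g.inner (e a) v : ℂ) • intMul (e a) = intMul v := by
  conv_rhs => rw [← he v, KahlerIdentities.intMul_sum]
  simp only [intMul_smul]

theorem IsFrame.sum_ext (he : g.IsFrame e) (v : V) :
    ∑ a, (g.inner (e a) v : ℂ) • g.ext (e a) = g.ext v := by
  conv_rhs => rw [← he v, ext_sum]
  simp only [ext_smul]

/-- The operator `∑ e^a ∧ ι_{e_a}` is multiplication by the degree. -/
theorem IsFrame.sum_ext_intMul (he : g.IsFrame e) (β : GA V) (k : ℕ) :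
    (∑ a, g.ext (e a) * intMul (e a)) β k = (k : ℂ) • β k := by
  rcases k with _ | k
  · rw [Nat.cast_zero]
    refine Eq.trans ?_ (zero_smul ℂ (β 0)).symm
    simp [LinearMap.sum_apply, ext]
  ext w
  have h1 (i : Fin (k + 1)) : ∑ a, (g.inner (e a) (w i) : ℂ) *
      β (k + 1) (Matrix.vecCons (e a) (i.removeNth w)) =
        β (k + 1) (Matrix.vecCons (w i) (i.removeNth w)) := by
    conv_rhs => rw [← curryLeft_apply_apply, ← he (w i), _root_.map_sum]
    simp
  -- Alternating the contractions of a form of degree `k + 1` returns `k + 1` times the form; this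
  -- is the source of the factor.
  have h2 := congrArg (fun γ : Alt V (k + 1) => γ w) (alternatizeUncurryFin_curryLeft (β (k + 1)))
  simp only [alternatizeUncurryFin_apply, curryLeft_apply_apply, ← h1] at h2
  simp only [LinearMap.sum_apply, GA.sum_apply, Module.End.mul_apply, ext, extMul_succ_apply,
    extMulHom_apply, ContinuousAlternatingMap.sum_apply, intMul_apply, curryLeft_apply_apply,
    flat_apply]
  rw [Finset.sum_comm]
  simp only [← Finset.mul_sum]
  simpa using h2

end Frame

/-- The operator `½ ∑ e^a ∧ (J e_a)^♭ ∧`, which is the Lefschetz operator. -/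
def lefOp {ι : Type*} [Fintype ι] (e : ι → V) : Module.End ℂ (GA V) :=
  (2 : ℂ)⁻¹ • ∑ a, g.ext (e a) * g.ext (Complex.I • e a)

/-- The operator `½ ∑ ι_{J e_a} ι_{e_a}`, which is the dual Lefschetz operator. -/
def lamOp {ι : Type*} [Fintype ι] (e : ι → V) : Module.End ℂ (GA V) :=
  (2 : ℂ)⁻¹ • ∑ a, intMul (Complex.I • e a) * intMul (e a)

section Frame

variable {g} {ι : Type*} [Fintype ι] {e : ι → V}

theorem lefOp_mul_ext (v : V) : g.lefOp e * g.ext v = g.ext v * g.lefOp e := by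
  simp only [lefOp, smul_mul_assoc, mul_smul_comm, Finset.sum_mul, Finset.mul_sum]
  congr 1
  refine Finset.sum_congr rfl fun a _ => ?_
  rw [mul_assoc, ext_mul_ext, mul_neg, ← mul_assoc, ext_mul_ext, neg_mul, neg_neg, mul_assoc]

theorem lamOp_mul_intMul (v : V) : lamOp e * intMul v = intMul v * lamOp e := by
  simp only [lamOp, smul_mul_assoc, mul_smul_comm, Finset.sum_mul, Finset.mul_sum]
  congr 1
  refine Finset.sum_congr rfl fun a _ => ?_
  rw [mul_assoc, intMul_mul_intMul, mul_neg, ← mul_assoc, intMul_mul_intMul, neg_mul, neg_neg,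
    mul_assoc]

/-- The algebraic core of identities 2. Moving `v^♭ ∧` past two contractions leaves two sums of
single contractions. By the frame property of `J e` for one and of `e` for the other, each
contributes half of `ι_{J v}`. -/
theorem IsFrame.lamOp_mul_ext (he : g.IsFrame e) (v : V) :
    lamOp e * g.ext v = g.ext v * lamOp e + intMul (Complex.I • v) := by
  have h1 (a : ι) : intMul (Complex.I • e a) * intMul (e a) * g.ext v =
      g.ext v * (intMul (Complex.I • e a) * intMul (e a)) +
      ((g.inner v (e a) : ℂ) • intMul (Complex.I • e a) -
        (g.inner v (Complex.I • e a) : ℂ) • intMul (e a)) := by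
    rw [mul_assoc, intMul_mul_ext, mul_sub, ← mul_assoc, intMul_mul_ext]
    simp only [mul_smul_comm, mul_one, sub_mul, smul_mul_assoc, one_mul, mul_assoc]
    abel
  have h2 : ∑ a, (g.inner v (e a) : ℂ) • intMul (Complex.I • e a) = intMul (Complex.I • v) := by
    rw [← he.J.sum_intMul]
    simp only [J_isometry, g.symm v]
  have h3 : ∑ a, (g.inner v (Complex.I • e a) : ℂ) • intMul (e a) = -intMul (Complex.I • v) := by
    rw [← he.sum_intMul, ← Finset.sum_neg_distrib]
    refine Finset.sum_congr rfl fun a _ => ?_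
    rw [← neg_smul, g.symm v, inner_J_left]
    simp
  simp only [lamOp, smul_mul_assoc, mul_smul_comm, Finset.sum_mul, Finset.mul_sum, h1,
    Finset.sum_add_distrib, Finset.sum_sub_distrib, h2, h3, smul_add]
  module

/-- The counterpart for identities 3, with the roles of exterior multiplication and contraction
exchanged. -/
theorem IsFrame.intMul_mul_lefOp (he : g.IsFrame e) (v : V) :
    intMul v * g.lefOp e = g.lefOp e * intMul v + g.ext (Complex.I • v) := by
  have h1 (a : ι) : intMul v * (g.ext (e a) * g.ext (Complex.I • e a)) =
      g.ext (e a) * g.ext (Complex.I • e a) * intMul v +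
      ((g.inner (e a) v : ℂ) • g.ext (Complex.I • e a) -
        (g.inner (Complex.I • e a) v : ℂ) • g.ext (e a)) := by
    rw [← mul_assoc, intMul_mul_ext, sub_mul, mul_assoc _ (intMul v), intMul_mul_ext]
    simp only [mul_smul_comm, mul_one, mul_sub, smul_mul_assoc, one_mul, mul_assoc]
    abel
  have h2 : ∑ a, (g.inner (e a) v : ℂ) • g.ext (Complex.I • e a) = g.ext (Complex.I • v) := by
    rw [← he.J.sum_ext]
    simp only [J_isometry]
  have h3 : ∑ a, (g.inner (Complex.I • e a) v : ℂ) • g.ext (e a) = -g.ext (Complex.I • v) := by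
    rw [← he.sum_ext, ← Finset.sum_neg_distrib]
    refine Finset.sum_congr rfl fun a _ => ?_
    rw [← neg_smul, inner_J_left]
    simp
  simp only [lefOp, smul_mul_assoc, mul_smul_comm, Finset.sum_mul, Finset.mul_sum, h1,
    Finset.sum_add_distrib, Finset.sum_sub_distrib, h2, h3, smul_add]
  module

/-- `[Λ, L]` is multiplication by `n - k` on `k`-forms. -/
theorem IsFrame.lamOp_mul_lefOp (he : g.IsFrame e)
    (h1 : ∀ a, g.inner (e a) (e a) = 1) (β : GA V) (k : ℕ) :
    lamOp e (g.lefOp e β) k = g.lefOp e (lamOp e β) k +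
      ((Fintype.card ι : ℂ) / 2 - k) • β k := by
  -- Two applications of `lamOp_mul_ext`. Summed over `a`, the last two terms are number operators,
  -- for the frames `J e` and `e`, and each of them is multiplication by the degree.
  have h2 (a : ι) : lamOp e * (g.ext (e a) * g.ext (Complex.I • e a)) =
      g.ext (e a) * g.ext (Complex.I • e a) * lamOp e +
      (1 - g.ext (Complex.I • e a) * intMul (Complex.I • e a) - g.ext (e a) * intMul (e a)) := by
    rw [← mul_assoc, he.lamOp_mul_ext, add_mul, mul_assoc _ (lamOp e), he.lamOp_mul_ext,
      intMul_mul_ext, J_isometry, h1, smul_smul, Complex.I_mul_I, neg_one_smul, intMul_neg]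
    simp only [mul_add, mul_assoc, Complex.ofReal_one, one_smul, mul_neg]
    abel
  have h3 : lamOp e * g.lefOp e = g.lefOp e * lamOp e + (2 : ℂ)⁻¹ •
      ((Fintype.card ι : ℂ) • (1 : Module.End ℂ (GA V)) -
        ∑ a, g.ext (Complex.I • e a) * intMul (Complex.I • e a) -
        ∑ a, g.ext (e a) * intMul (e a)) := by
    conv_lhs => rw [lefOp, mul_smul_comm, Finset.mul_sum]
    simp only [h2, Finset.sum_add_distrib, Finset.sum_sub_distrib, ← Finset.sum_mul]
    rw [smul_add, ← smul_mul_assoc]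
    congr 3
    rw [Finset.sum_const, Finset.card_univ, Nat.cast_smul_eq_nsmul]
  have h4 := congrArg (fun A : Module.End ℂ (GA V) => A β k) h3
  simp only [Module.End.mul_apply, LinearMap.add_apply, LinearMap.smul_apply, LinearMap.sub_apply,
    GA.add_apply, GA.smul_apply, GA.sub_apply, Module.End.one_apply, he.J.sum_ext_intMul,
    he.sum_ext_intMul] at h4
  rw [h4]
  congr 1
  module

end Frame

end HermInner

/-! ### The operators of the statement in an orthonormal basis. -/

namespace HermInner

open ContinuousAlternatingMap

variable {V : Type*} [NormedAddCommGroup V] [NormedSpace ℂ V] [FiniteDimensional ℂ V]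
  (g : HermInner V)

theorem frame_orthonormal (i j : Fin (2 * Module.finrank ℂ V)) :
    g.inner (g.frame i) (g.frame j) = if i = j then 1 else 0 := g.exists_frame.choose_spec i j

theorem isFrame_frame : g.IsFrame g.frame := by
  intro v
  have h (a) : g.inner (g.frame a) v = g.frame.repr v a := by
    conv_lhs => rw [← g.frame.sum_repr v, _root_.map_sum]
    simp [frame_orthonormal]
  simp only [h, g.frame.sum_repr]

/-! #### The scalar product on forms -/

theorem formInner_comm {k : ℕ} (α β : Alt V k) : g.formInner α β = g.formInner β α := by
  simp only [formInner, mul_comm]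

theorem formInner_add_right {k : ℕ} (α β γ : Alt V k) :
    g.formInner α (β + γ) = g.formInner α β + g.formInner α γ := by
  simp [formInner, mul_add, Finset.sum_add_distrib]

theorem formInner_smul_right {k : ℕ} (c : ℂ) (α β : Alt V k) :
    g.formInner α (c • β) = c * g.formInner α β := by
  simp [formInner, Finset.mul_sum, mul_left_comm]

theorem formInner_sum_right {k : ℕ} {ι : Type*} (s : Finset ι) (α : Alt V k) (β : ι → Alt V k) :
    g.formInner α (∑ i ∈ s, β i) = ∑ i ∈ s, g.formInner α (β i) :=
  _root_.map_sum (AddMonoidHom.mk' (g.formInner α) (g.formInner_add_right α)) β s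

theorem formInner_smul_left {k : ℕ} (c : ℂ) (α β : Alt V k) :
    g.formInner (c • α) β = c * g.formInner α β := by
  rw [formInner_comm, formInner_smul_right, formInner_comm]

theorem formInner_sum_left {k : ℕ} {ι : Type*} (s : Finset ι) (α : ι → Alt V k) (β : Alt V k) :
    g.formInner (∑ i ∈ s, α i) β = ∑ i ∈ s, g.formInner (α i) β := by
  simp only [formInner_comm _ _ β, formInner_sum_right]

theorem eq_of_apply_frame {k : ℕ} {α β : Alt V k}
    (h : ∀ i : Fin k → Fin (2 * Module.finrank ℂ V),
      α (fun s => g.frame (i s)) = β (fun s => g.frame (i s))) : α = β :=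
  ContinuousAlternatingMap.toAlternatingMap_injective
    (Module.Basis.ext_alternating g.frame fun v _ => h v)

/-- The pairing is complex bilinear, so definiteness is not available directly; the difference is
tested against its own complex conjugate. -/
theorem eq_of_formInner {k : ℕ} {α β : Alt V k}
    (h : ∀ γ, g.formInner γ α = g.formInner γ β) : α = β := by
  rw [← sub_eq_zero]
  set δ : Alt V k := α - β with hδ
  have h0 (γ) : g.formInner γ δ = 0 := by
    have : δ = α + (-1 : ℂ) • β := by rw [hδ]; ext; simp [sub_eq_add_neg]
    rw [this, formInner_add_right, formInner_smul_right, h]; ring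
  have h1 := h0 ((Complex.conjCLE : ℂ →L[ℝ] ℂ).compContinuousAlternatingMap δ)
  have hk : (k ! : ℂ)⁻¹ ≠ 0 := inv_ne_zero (by exact_mod_cast (Nat.factorial_pos _).ne')
  have h2 : ∑ i : Fin k → Fin (2 * Module.finrank ℂ V),
      Complex.normSq (δ (fun s => g.frame (i s))) = 0 := by
    have h3 := (mul_eq_zero.1 h1).resolve_left hk
    have h4 (z : ℂ) : (starRingEnd ℂ z) * z = (Complex.normSq z : ℂ) := by
      rw [mul_comm, Complex.mul_conj]
    simp only [ContinuousLinearMap.compContinuousAlternatingMap_coe, Function.comp_apply,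
      ContinuousLinearEquiv.coe_coe, Complex.conjCLE_apply, h4] at h3
    exact_mod_cast h3
  rw [Finset.sum_eq_zero_iff_of_nonneg fun _ _ => Complex.normSq_nonneg _] at h2
  refine g.eq_of_apply_frame fun i => ?_
  simpa using h2 i (Finset.mem_univ i)

/-- Contraction with `v` is adjoint to exterior multiplication by `g(v, ·)`. -/
theorem formInner_curryLeft {k : ℕ} (v : V) (α : Alt V (k + 1)) (β : Alt V k) :
    g.formInner (α.curryLeft v) β = g.formInner α (extMulHom k (g.flat v) β) := by
  -- Moving slot `s` of `α` to the front costs `(-1)^s`, which cancels the sign in the exterior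
  -- product. The `k + 1` slots thus give equal sums, and this accounts for `1/(k+1)!` against
  -- `1/k!`.
  have h1 (s : Fin (k + 1)) : ∑ i : Fin (k + 1) → Fin (2 * Module.finrank ℂ V),
      α (fun t => g.frame (i t)) * ((-1) ^ (s : ℕ) * ((g.inner v (g.frame (i s)) : ℂ) *
        β (s.removeNth fun t => g.frame (i t)))) =
      ∑ i : Fin k → Fin (2 * Module.finrank ℂ V), α.curryLeft v (fun t => g.frame (i t)) *
        β (fun t => g.frame (i t)) := by
    rw [← Equiv.sum_comp (Fin.insertNthEquiv (fun _ => Fin (2 * Module.finrank ℂ V)) s),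
      Fintype.sum_prod_type, Finset.sum_comm]
    refine Finset.sum_congr rfl fun i _ => ?_
    have h2 : α.curryLeft v (fun t => g.frame (i t)) = ∑ a, (g.inner v (g.frame a) : ℂ) *
        α.curryLeft (g.frame a) (fun t => g.frame (i t)) := by
      conv_lhs => rw [← g.isFrame_frame v, _root_.map_sum, ContinuousAlternatingMap.sum_apply]
      simp [g.symm v]
    rw [h2, Finset.sum_mul]
    refine Finset.sum_congr rfl fun a _ => ?_
    have h3 := α.neg_one_pow_smul_map_insertNth s (g.frame a) (fun t => g.frame (i t))
    have h4 : (fun t => g.frame ((Fin.insertNthEquiv (fun _ => Fin (2 * Module.finrank ℂ V)) s)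
        (a, i) t)) = s.insertNth (g.frame a) (fun t => g.frame (i t)) := by
      funext t
      refine Fin.succAboveCases s ?_ (fun t => ?_) t <;> simp
    have h5 : (s.removeNth (s.insertNth (α := fun _ => V) (g.frame a) (fun t => g.frame (i t)))) =
        fun t => g.frame (i t) := by simp
    rw [curryLeft_apply_apply]
    change _ = (g.inner v (g.frame a) : ℂ) * α (Matrix.vecCons _ _) * _
    rw [← h3, h4, h5]
    simp
    ring
  have hk : ((k : ℂ) + 1) ≠ 0 := by exact_mod_cast Nat.succ_ne_zero k
  have hk' : (k ! : ℂ) ≠ 0 := by exact_mod_cast (Nat.factorial_pos _).ne'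
  simp only [formInner, extMulHom_apply, Finset.mul_sum, flat_apply]
  rw [Finset.sum_comm]
  simp only [← Finset.mul_sum, h1]
  rw [Finset.sum_const, Finset.card_univ, Fintype.card_fin, Nat.factorial_succ]
  push_cast
  rw [nsmul_eq_mul]
  push_cast
  field_simp

/-! #### The operators `L` and `Λ` -/

theorem lam_eq (β : GAlt V) (k : ℕ) : g.lam β k = lamOp g.frame ⟨β⟩ k := by
  -- The sum over `b` is the expansion of `J e_a` in the frame, since `ω(e_a, e_b) = g(J e_a, e_b)`.
  have h (a : Fin (2 * Module.finrank ℂ V)) : ∑ b, g.fundForm ![g.frame a, g.frame b] •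
      contract (Nat.add_comm 2 k) ![g.frame a, g.frame b] (β (k + 2)) =
      ((β (k + 2)).curryLeft (g.frame a)).curryLeft (Complex.I • g.frame a) := by
    conv_rhs => rw [← g.isFrame_frame (Complex.I • g.frame a), _root_.map_sum]
    refine Finset.sum_congr rfl fun b _ => ?_
    ext w
    rw [map_smul, ContinuousAlternatingMap.smul_apply, ContinuousAlternatingMap.smul_apply,
      curryLeft_apply_apply, curryLeft_apply_apply]
    have h1 : g.fundForm ![g.frame a, g.frame b] =
        ((g.inner (g.frame b) (Complex.I • g.frame a) : ℝ) : ℂ) := by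
      rw [g.symm]; rfl
    have h2 : contract (Nat.add_comm 2 k) ![g.frame a, g.frame b] (β (k + 2)) w =
        β (k + 2) (Matrix.vecCons (g.frame a) (Matrix.vecCons (g.frame b) w)) := by
      change β (k + 2) _ = _
      congr 1
      funext s
      refine Fin.cases ?_ (fun s => Fin.cases ?_ (fun s => ?_) s) s
      · exact Fin.append_left _ _ (0 : Fin 2)
      · exact Fin.append_left _ _ (1 : Fin 2)
      · have : Fin.cast (Nat.add_comm 2 k).symm s.succ.succ = Fin.natAdd 2 s := by
          ext; simp; omega
        rw [this, Fin.append_right]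
        rfl
    rw [h1, h2]
    simp
  simp only [lam, h]
  simp [lamOp, LinearMap.sum_apply]

/-- Both sides are adjoint to `Λ`: the wedge product with `ω` by `formInner_lam`, the sum of
exterior products by `lam_eq` and the adjointness of `ι_v` and `v^♭ ∧`. The permutation sum in the
wedge product need not be expanded. -/
theorem lef_eq (β : GAlt V) (k : ℕ) : g.lef β k = g.lefOp g.frame ⟨β⟩ k := by
  match k with
  | 0 => simp [lefOp, LinearMap.sum_apply, lef, ext]
  | 1 => simp [lefOp, LinearMap.sum_apply, lef, ext]
  | k + 2 =>
    refine g.eq_of_formInner fun γ => ?_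
    have h := g.formInner_lam (k := k) (Pi.single (k + 2) γ) β
    rw [Pi.single_eq_same] at h
    rw [← h, lam_eq]
    simp only [lefOp, lamOp, LinearMap.smul_apply, LinearMap.sum_apply, GA.smul_apply,
      GA.sum_apply, formInner_smul_left, formInner_smul_right, formInner_sum_left,
      formInner_sum_right]
    congr 1
    refine Finset.sum_congr rfl fun a _ => ?_
    simp only [Module.End.mul_apply, intMul_apply, GA.mk_apply, Pi.single_eq_same, ext,
      extMul_succ_apply, formInner_curryLeft]

end HermInner

/-! ### Reordered contractions and the degree sign. -/

section

variable {V : Type*} [NormedAddCommGroup V] [NormedSpace ℂ V]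

/-- `1` as an element of `GA V`. -/
def GA.one : GA V := ⟨HermInner.oneForm⟩

theorem GA.one_apply_of_ne {k : ℕ} (hk : k ≠ 0) :
    (GA.one : GA V) k = 0 := Pi.single_eq_of_ne hk _

/-- Reindexing the arguments of an alternating form. -/
def altReindex {k m : ℕ} (σ : Fin m ≃ Fin k) (γ : Alt V m) : Alt V k :=
  { γ.toAlternatingMap.domDomCongr σ with
    cont := γ.cont.comp (continuous_pi fun s => continuous_apply (σ s)) }

/-- The `k`-form `γ (·, w₁, …, w_j)` for a form `γ` of degree `m = k + j`. -/
def contractRight {k j m : ℕ} (h : k + j = m) (w : Fin j → V) (γ : Alt V m) : Alt V k :=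
  contract rfl w (altReindex ((finCongr h.symm).trans finAddFlip) γ)

theorem contractRight_apply {k j m : ℕ} (h : k + j = m) (w : Fin j → V) (γ : Alt V m)
    (u : Fin k → V) :
    contractRight h w γ u = γ (fun s => Fin.append u w (Fin.cast h.symm s)) := by
  subst h
  change γ _ = γ _
  congr 1
  funext s
  refine Fin.addCases (fun a => ?_) (fun a => ?_) s <;> simp

/-- The sign comes from moving `v` in front of the `k` free arguments. -/
theorem contractRight_cons {k j m : ℕ} (h : k + 1 + j = m) (h' : k + (j + 1) = m) (v : V)
    (w : Fin j → V) (γ : Alt V m) :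
    contractRight h' (Matrix.vecCons v w) γ =
      (-1 : ℂ) ^ k • (contractRight h w γ).curryLeft v := by
  ext u
  have h1 := (contractRight h w γ).map_insertNth (Fin.last k) v u
  rw [Fin.insertNth_last', contractRight_apply] at h1
  rw [ContinuousAlternatingMap.smul_apply, ContinuousAlternatingMap.curryLeft_apply_apply,
    contractRight_apply]
  change γ (fun s => Fin.append u (Fin.cons v w) _) = _
  rw [Fin.append_right_cons]
  refine Eq.trans h1 ?_
  simp

theorem alt_eq_zero_of_finrank_lt [FiniteDimensional ℂ V] {k : ℕ} (β : Alt V k)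
    (hk : 2 * Module.finrank ℂ V < k) : β = 0 := by
  have : FiniteDimensional ℝ V := FiniteDimensional.complexToReal V
  ext w
  refine β.toAlternatingMap.map_linearDependent w fun hw => ?_
  have := hw.fintype_card_le_finrank
  rw [Fintype.card_fin, finrank_real_of_complex] at this
  omega

/-- Multiplication by `(-1)^k` on `k`-forms. -/
def parity (V : Type*) [NormedAddCommGroup V] [NormedSpace ℂ V] : Module.End ℂ (GA V) where
  toFun β := ⟨fun k => (-1 : ℂ) ^ k • β k⟩
  map_add' β γ := by ext1 k; exact smul_add (A := Alt V k) _ _ _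
  map_smul' c β := by ext1 k; exact smul_comm ((-1 : ℂ) ^ k) c (β k)

@[simp] theorem parity_apply (β : GA V) (k : ℕ) : parity V β k = (-1 : ℂ) ^ k • β k := rfl

theorem parity_mul_parity : parity V * parity V = 1 := by
  ext β k w
  simp [← mul_assoc, ← pow_add, ← two_mul]

theorem parity_mul_extMul (ξ : V →L[ℝ] ℂ) : parity V * extMul ξ = -(extMul ξ * parity V) := by
  ext1 β
  ext1 k
  rw [LinearMap.neg_apply, GA.neg_apply, Module.End.mul_apply, Module.End.mul_apply]
  rcases k with _ | k
  · ext w; simp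
  · rw [parity_apply, extMul_succ_apply, extMul_succ_apply, parity_apply, map_smul]
    ext w
    simp [pow_succ]

theorem parity_mul_intMul (v : V) : parity V * intMul v = -(intMul v * parity V) := by
  ext β k w
  rw [LinearMap.neg_apply, GA.neg_apply]
  simp [pow_succ]

theorem HermInner.lamOp_one {ι : Type*} [Fintype ι] (e : ι → V) : HermInner.lamOp e (GA.one : GA V) = 0 := by
  ext1 k
  have h2 : (GA.one : GA V) (k + 2) = 0 := GA.one_apply_of_ne (by omega)
  simp only [HermInner.lamOp, LinearMap.smul_apply, LinearMap.sum_apply, GA.smul_apply, GA.sum_apply,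
    Module.End.mul_apply, intMul_apply, h2]
  ext w
  simp

end

/-! ### Length of the volume form, and the Hodge operator on exterior products. -/

namespace HermInner

open ContinuousAlternatingMap

variable {V : Type*} [NormedAddCommGroup V] [NormedSpace ℂ V] [FiniteDimensional ℂ V]
  (g : HermInner V)

/-! #### The volume form -/

theorem vol_eq : g.vol = ((Module.finrank ℂ V)! : ℂ)⁻¹ •
    (g.lefOp g.frame ^ Module.finrank ℂ V) GA.one (2 * Module.finrank ℂ V) := by
  have h (j : ℕ) : (g.lef^[j] oneForm) = ((g.lefOp g.frame ^ j) GA.one).toFun := by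
    induction j with
    | zero => rfl
    | succ j ih =>
      rw [Function.iterate_succ_apply', ih, pow_succ', Module.End.mul_apply]
      funext k
      exact g.lef_eq _ k
  rw [vol, h]
  rfl

theorem lefOp_pow_one_apply_of_ne (j k : ℕ) (h : k ≠ 2 * j) :
    (g.lefOp g.frame ^ j) GA.one k = 0 := by
  induction j generalizing k with
  | zero => exact Pi.single_eq_of_ne h _
  | succ j ih =>
    rw [pow_succ', Module.End.mul_apply]
    match k with
    | 0 => exact (g.lef_eq _ 0).symm
    | 1 => exact (g.lef_eq _ 1).symm
    | k + 2 =>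
      have h0 := ih k (by omega)
      generalize (g.lefOp g.frame ^ j) GA.one = β at h0 ⊢
      simp only [lefOp, LinearMap.smul_apply, LinearMap.sum_apply, GA.smul_apply, GA.sum_apply,
        Module.End.mul_apply, ext, extMul_succ_apply, h0, _root_.map_zero, Finset.sum_const_zero]
      exact smul_zero (2 : ℂ)⁻¹

/-- The `sl₂` recursion starting from `Λ 1 = 0`: since `L^{j+1} 1` has degree `2(j+1)`, the
commutator `[Λ, L]` adds `n - 2(j+1)`, and `(j+1)(n-j) + n - 2(j+1) = (j+2)(n-j-1)`. -/
theorem lamOp_lefOp_pow (j : ℕ) :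
    lamOp g.frame ((g.lefOp g.frame ^ (j + 1)) GA.one) =
      (((j : ℂ) + 1) * (Module.finrank ℂ V - j)) • (g.lefOp g.frame ^ j) GA.one := by
  have key (β : GA V) (j : ℕ) (hβ : ∀ k, k ≠ 2 * j → β k = 0) :
      lamOp g.frame (g.lefOp g.frame β) = g.lefOp g.frame (lamOp g.frame β) +
        ((Module.finrank ℂ V : ℂ) - 2 * j) • β := by
    ext1 k
    rw [g.isFrame_frame.lamOp_mul_lefOp (fun a => by simp [frame_orthonormal]), GA.add_apply,
      GA.smul_apply]
    congr 1
    by_cases hk : k = 2 * j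
    · subst hk
      congr 1
      simp
    · rw [hβ k hk]
      exact (smul_zero (A := Alt V k) ((Fintype.card (Fin (2 * Module.finrank ℂ V)) : ℂ) / 2 - k)).trans
        (smul_zero (A := Alt V k) ((Module.finrank ℂ V : ℂ) - 2 * j)).symm
  induction j with
  | zero =>
    rw [zero_add, pow_one, pow_zero, Module.End.one_apply,
      key GA.one 0 (g.lefOp_pow_one_apply_of_ne 0)]
    rw [lamOp_one, _root_.map_zero]
    simp
  | succ j ih =>
    rw [pow_succ', Module.End.mul_apply, key _ (j + 1) (g.lefOp_pow_one_apply_of_ne (j + 1)), ih,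
      map_smul, ← Module.End.mul_apply, ← pow_succ', ← add_smul]
    congr 1
    push_cast
    ring

/-- This is `|ω^j|² = j! n! / (n-j)!`, proved by moving one `L` across the pairing. The variable `r`
stands for `n - j` and avoids both the subtraction and the division. -/
theorem formInner_lefOp_pow (j r : ℕ) (h : j + r = Module.finrank ℂ V) :
    g.formInner ((g.lefOp g.frame ^ j) GA.one (2 * j)) ((g.lefOp g.frame ^ j) GA.one (2 * j)) *
      (r ! : ℂ) = (j ! : ℂ) * ((Module.finrank ℂ V)! : ℂ) := by
  induction j generalizing r with
  | zero =>
    obtain rfl : r = Module.finrank ℂ V := by omega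
    have : ((g.lefOp g.frame ^ 0) (GA.one : GA V) (2 * 0)) =
      ContinuousAlternatingMap.constOfIsEmpty ℝ V (Fin 0) (1 : ℂ) := rfl
    rw [this]
    simp [formInner]
  | succ j ih =>
    have h1 := g.formInner_lam (k := 2 * j) ((g.lefOp g.frame ^ (j + 1)) GA.one).toFun
      ((g.lefOp g.frame ^ j) GA.one).toFun
    rw [lef_eq, lam_eq] at h1
    change g.formInner (lamOp g.frame ((g.lefOp g.frame ^ (j + 1)) GA.one) (2 * j))
      ((g.lefOp g.frame ^ j) GA.one (2 * j)) = g.formInner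
      ((g.lefOp g.frame ^ (j + 1)) GA.one (2 * j + 2))
      ((g.lefOp g.frame * g.lefOp g.frame ^ j) GA.one (2 * j + 2)) at h1
    rw [← pow_succ', lamOp_lefOp_pow, GA.smul_apply, formInner_smul_left] at h1
    change g.formInner ((g.lefOp g.frame ^ (j + 1)) GA.one (2 * j + 2))
      ((g.lefOp g.frame ^ (j + 1)) GA.one (2 * j + 2)) * _ = _
    rw [← h1]
    have h2 := ih (r + 1) (by omega)
    have h3 : (Module.finrank ℂ V : ℂ) - j = r + 1 := by
      rw [← h]; push_cast; ring
    rw [Nat.factorial_succ] at h2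
    rw [h3, Nat.factorial_succ]
    push_cast at h2 ⊢
    linear_combination ((j : ℂ) + 1) * h2

/-- Without this normalisation `**` would be known only up to a constant factor. The length is found
without choosing a basis in which `ω` has standard form. -/
theorem formInner_vol : g.formInner g.vol g.vol = 1 := by
  rw [vol_eq, formInner_smul_left, formInner_smul_right]
  have h := g.formInner_lefOp_pow (Module.finrank ℂ V) 0 (by omega)
  have hn : ((Module.finrank ℂ V)! : ℂ) ≠ 0 := by exact_mod_cast (Nat.factorial_pos _).ne'
  rw [Nat.factorial_zero, Nat.cast_one, mul_one] at h
  rw [h]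
  field_simp

/-! #### The Hodge operator -/

/-- Written as a pairing with `vol` whose last slots are filled, the Hodge operator becomes
accessible to adjointness. -/
theorem hodge_apply {k j : ℕ} (h : k + j = 2 * Module.finrank ℂ V) (β : Alt V k)
    (w : Fin j → V) : g.hodge h β w = g.formInner β (contractRight h w g.vol) := by
  rw [hodge, formInner, ContinuousAlternatingMap.smul_apply, ContinuousAlternatingMap.sum_apply,
    smul_eq_mul]
  congr 1
  refine Finset.sum_congr rfl fun i _ => ?_
  rw [contractRight_apply]
  rfl

theorem hodge_extMulHom {k j : ℕ} (h : k + 1 + j = 2 * Module.finrank ℂ V)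
    (h' : k + (j + 1) = 2 * Module.finrank ℂ V) (v : V) (β : Alt V k) :
    g.hodge h (extMulHom k (g.flat v) β) = (-1 : ℂ) ^ k • (g.hodge h' β).curryLeft v := by
  ext w
  rw [ContinuousAlternatingMap.smul_apply, curryLeft_apply_apply, hodge_apply, hodge_apply,
    contractRight_cons h h', formInner_smul_right, ← formInner_comm, ← formInner_curryLeft,
    formInner_comm, smul_eq_mul, ← mul_assoc, ← pow_add, ← two_mul]
  simp

/-- The Hodge operator as a linear operator. -/
def starOp : Module.End ℂ (GA V) where
  toFun β := ⟨g.star β.toFun⟩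
  map_add' α β := by
    ext1 j
    change g.star _ j = g.star _ j + g.star _ j
    by_cases hj : j ≤ 2 * Module.finrank ℂ V
    · simp only [star, hj, dif_pos]
      ext w
      simp only [ContinuousAlternatingMap.add_apply, hodge_apply, formInner_comm _ _
        (contractRight _ _ _), ← formInner_add_right]
      rfl
    · simp [star, hj]
  map_smul' c α := by
    ext1 j
    change g.star _ j = c • g.star _ j
    by_cases hj : j ≤ 2 * Module.finrank ℂ V
    · simp only [star, hj, dif_pos]
      ext w
      simp only [ContinuousAlternatingMap.smul_apply, hodge_apply, smul_eq_mul,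
        ← formInner_smul_left]
      rfl
    · simp only [star, hj, dif_neg, not_false_eq_true]
      exact (smul_zero (A := Alt V j) c).symm

theorem starOp_apply {k j : ℕ} (h : k + j = 2 * Module.finrank ℂ V) (β : GA V) :
    g.starOp β j = g.hodge h (β k) := by
  obtain rfl : k = 2 * Module.finrank ℂ V - j := by omega
  exact dif_pos (by omega)

theorem starOp_apply_of_lt {j : ℕ} (h : 2 * Module.finrank ℂ V < j) (β : GA V) :
    g.starOp β j = 0 := dif_neg (by omega)

theorem hodge_zero {k j : ℕ} (h : k + j = 2 * Module.finrank ℂ V) : g.hodge h 0 = 0 := by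
  ext w; simp [hodge_apply, formInner]

theorem starOp_mul_ext (v : V) : g.starOp * g.ext v = intMul v * g.starOp * parity V := by
  ext1 β
  ext1 j
  simp only [Module.End.mul_apply, intMul_apply]
  by_cases hj : j < 2 * Module.finrank ℂ V
  · obtain ⟨k, hk⟩ : ∃ k, k + 1 + j = 2 * Module.finrank ℂ V :=
      ⟨2 * Module.finrank ℂ V - j - 1, by omega⟩
    rw [g.starOp_apply hk, g.starOp_apply (show k + (j + 1) = _ by omega), ext, extMul_succ_apply,
      g.hodge_extMulHom hk (by omega)]
    ext w
    simp only [ContinuousAlternatingMap.smul_apply, curryLeft_apply_apply, hodge_apply,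
      parity_apply, formInner_smul_left, smul_eq_mul]
  -- For `j ≥ 2n` both sides vanish. In the borderline case `j = 2n` the left side is `*` of the
  -- degree zero component of an exterior product, which is zero.
  · rw [g.starOp_apply_of_lt (show _ < j + 1 by omega), curryLeft_zero]
    rcases lt_or_eq_of_le (not_lt.1 hj) with h | h
    · rw [g.starOp_apply_of_lt h]; rfl
    · rw [g.starOp_apply (show 0 + j = _ by omega)]
      exact g.hodge_zero _

theorem intMul_mul_starOp (v : V) : intMul v * g.starOp = g.starOp * g.ext v * parity V := by
  rw [starOp_mul_ext, mul_assoc, parity_mul_parity, mul_one]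

/-- The difference `D v` of the two sides satisfies `ι_u D_v = D_v (u^♭ ∧) (±1)`, by the formula for
`ι_u *` and the anticommutation relations. Induction on the degree of the result, by contraction,
then gives `D v = 0`; `**` is not yet known at this point. -/
theorem starOp_mul_intMul (v : V) : g.starOp * intMul v = -(g.ext v * g.starOp * parity V) := by
  rw [eq_neg_iff_add_eq_zero]
  set D : V → Module.End ℂ (GA V) :=
    fun v => g.starOp * intMul v + g.ext v * g.starOp * parity V with hD
  have hpe (u : V) : parity V * g.ext u = -(g.ext u * parity V) := parity_mul_extMul _
  have hI (u v : V) : intMul u * D v = D v * g.ext u * parity V := by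
    have h1 : intMul u * (g.starOp * intMul v) = -((g.inner u v : ℂ) • (g.starOp * parity V)) +
        g.starOp * intMul v * g.ext u * parity V := by
      rw [← mul_assoc, intMul_mul_starOp, mul_assoc, parity_mul_intMul, mul_assoc _ (intMul v),
        intMul_mul_ext, mul_neg, mul_assoc, ← mul_assoc (g.ext u)]
      simp only [mul_sub, sub_mul, mul_smul_comm, smul_mul_assoc, mul_one, mul_assoc]
      abel
    have h2 : intMul u * (g.ext v * g.starOp * parity V) =
        (g.inner u v : ℂ) • (g.starOp * parity V) - g.ext v * g.starOp * g.ext u := by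
      rw [← mul_assoc, ← mul_assoc, intMul_mul_ext, sub_mul, sub_mul, mul_assoc _ (intMul u),
        intMul_mul_starOp, mul_assoc (g.ext v), mul_assoc _ (parity V), parity_mul_parity, mul_one,
        g.symm v u, mul_assoc (g.ext v)]
      simp only [smul_mul_assoc, one_mul]
    have h3 : g.ext v * g.starOp * parity V * g.ext u * parity V =
        -(g.ext v * g.starOp * g.ext u) := by
      rw [mul_assoc _ (parity V), hpe, mul_neg, neg_mul, mul_assoc, mul_assoc (g.ext u),
        parity_mul_parity, mul_one]
    simp only [hD, mul_add, add_mul, h1, h2, h3]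
    abel
  suffices ∀ j (β : GA V) v, D v β j = 0 from LinearMap.ext fun β => GA.ext fun j => this j β v
  intro j
  induction j with
  | zero =>
    intro β v
    -- The degree zero part of `*` sees only the component of degree `2n`, here the contraction of a
    -- form of degree `2n + 1`, which is zero.
    have h1 : g.starOp (intMul v β) 0 = 0 := by
      rw [g.starOp_apply (k := 2 * Module.finrank ℂ V) (by omega), intMul_apply,
        alt_eq_zero_of_finrank_lt (β (2 * Module.finrank ℂ V + 1)) (by omega), curryLeft_zero]
      exact g.hodge_zero _
    simp [hD, h1, ext]
  | succ j ih =>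
    refine fun β v => GA.eq_zero_of_intMul fun u => ?_
    rw [← Module.End.mul_apply, hI, Module.End.mul_apply, Module.End.mul_apply, ih]

/-- The degrees `k` and `2n - k` have the same parity. -/
theorem starOp_mul_parity : g.starOp * parity V = parity V * g.starOp := by
  ext β j w
  simp only [Module.End.mul_apply, parity_apply, ContinuousAlternatingMap.smul_apply, smul_eq_mul]
  by_cases hj : j ≤ 2 * Module.finrank ℂ V
  · obtain ⟨k, hk⟩ : ∃ k, k + j = 2 * Module.finrank ℂ V :=
      ⟨2 * Module.finrank ℂ V - j, by omega⟩
    rw [g.starOp_apply hk, g.starOp_apply hk, hodge_apply, hodge_apply, parity_apply,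
      formInner_smul_left]
    congr 1
    have : (-1 : ℂ) ^ k * (-1 : ℂ) ^ j = 1 := by
      rw [← pow_add, hk, pow_mul]; simp
    have h2 : (-1 : ℂ) ^ j * (-1 : ℂ) ^ j = 1 := by
      rw [← pow_add, ← two_mul, pow_mul]; simp
    calc (-1 : ℂ) ^ k = (-1 : ℂ) ^ k * ((-1 : ℂ) ^ j * (-1 : ℂ) ^ j) := by rw [h2, mul_one]
      _ = _ := by rw [← mul_assoc, this, one_mul]
  · rw [g.starOp_apply_of_lt (not_le.1 hj), g.starOp_apply_of_lt (not_le.1 hj)]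
    simp

/-- The exterior algebra is generated by `1` under exterior multiplication by covectors. -/
theorem ga_induction {p : GA V → Prop} (one : p GA.one) (add : ∀ α β, p α → p β → p (α + β))
    (smul : ∀ (c : ℂ) α, p α → p (c • α)) (ext : ∀ v α, p α → p (g.ext v α)) (β : GA V) : p β := by
  have h0 : p 0 := by simpa using smul 0 _ one
  have hsum {ι : Type} (s : Finset ι) (f : ι → GA V) (hf : ∀ i ∈ s, p (f i)) :
      p (∑ i ∈ s, f i) := Finset.sum_induction f p add h0 hf
  have hom (k : ℕ) : ∀ β : GA V, (∀ l, l ≠ k → β l = 0) → p β := by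
    induction k with
    | zero =>
      intro β hβ
      have : β = (β 0 0) • GA.one := by
        ext k w
        by_cases hk : k = 0
        · subst hk
          obtain rfl : w = 0 := Subsingleton.elim _ _
          rw [GA.smul_apply, ContinuousAlternatingMap.smul_apply, smul_eq_mul]
          exact (mul_one _).symm
        · have h1 : (GA.one : GA V) k = 0 := GA.one_apply_of_ne hk
          rw [hβ k hk, GA.smul_apply, h1]
          simp
      rw [this]
      exact smul _ _ one
    | succ k ih =>
      intro β hβ
      -- Euler's formula: on forms of degree `k + 1` the number operator is invertible, so such a
      -- form is a combination of exterior products of covectors with forms of degree `k`.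
      have h1 : β = ((k : ℂ) + 1)⁻¹ • (∑ a, g.ext (g.frame a) * intMul (g.frame a)) β := by
        have hk : (k : ℂ) + 1 ≠ 0 := by exact_mod_cast Nat.succ_ne_zero k
        ext1 l
        rw [GA.smul_apply, g.isFrame_frame.sum_ext_intMul]
        by_cases hl : l = k + 1
        · subst hl
          ext w
          simp [hk]
        · rw [hβ l hl]
          ext w
          simp
      rw [h1, LinearMap.sum_apply]
      refine smul _ _ (hsum _ _ fun a _ => ?_)
      rw [Module.End.mul_apply]
      refine ext _ _ (ih _ fun l hl => ?_)
      rw [intMul_apply, hβ (l + 1) (by omega), curryLeft_zero]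
      rfl
  have h1 : β = ∑ k ∈ Finset.range (2 * Module.finrank ℂ V + 1), (⟨Pi.single k (β k)⟩ : GA V) := by
    ext1 l
    rw [GA.sum_apply]
    by_cases hl : l < 2 * Module.finrank ℂ V + 1
    · rw [Finset.sum_eq_single l]
      · simp
      · intro k _ hk
        exact Pi.single_eq_of_ne hk.symm _
      · simp [hl]
    · rw [alt_eq_zero_of_finrank_lt (β l) (by omega), Finset.sum_eq_zero]
      intro k hk
      refine Pi.single_eq_of_ne ?_ _
      rintro rfl
      exact hl (Finset.mem_range.1 hk)
  rw [h1]
  refine hsum _ _ fun k _ => hom k _ fun l hl => Pi.single_eq_of_ne hl _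

theorem starOp_one : g.starOp GA.one (2 * Module.finrank ℂ V) = g.vol := by
  rw [g.starOp_apply (zero_add _)]
  have : (GA.one : GA V) 0 = ContinuousAlternatingMap.constOfIsEmpty ℝ V (Fin 0) (1 : ℂ) := rfl
  ext w
  rw [this, hodge_apply, formInner]
  simp only [Nat.factorial_zero, Nat.cast_one, inv_one, one_mul, contractRight_apply]
  simp
  congr 1
  funext s
  have := Fin.append_right (fun t : Fin 0 => g.frame ((default : Fin 0 → Fin _) t)) w s
  convert this using 2
  ext; simp

/-- Here `* 1 = vol`, and the degree zero part of `* vol` is `⟨vol, vol⟩ = 1`. -/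
theorem starOp_starOp_one : g.starOp (g.starOp GA.one) = GA.one := by
  ext k w
  by_cases hk : k = 0
  · subst hk
    rw [g.starOp_apply (add_zero _), starOp_one, hodge_apply]
    have : contractRight (add_zero _) w g.vol = g.vol := by
      ext u
      rw [contractRight_apply]
      congr 1
      funext s
      exact Fin.append_left u w s
    rw [this, formInner_vol]
    rfl
  · have h1 : (GA.one : GA V) k = 0 := GA.one_apply_of_ne hk
    rw [h1]
    by_cases hk' : k ≤ 2 * Module.finrank ℂ V
    · obtain ⟨l, hl⟩ : ∃ l, l + k = 2 * Module.finrank ℂ V :=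
        ⟨2 * Module.finrank ℂ V - k, by omega⟩
      rw [g.starOp_apply hl, g.starOp_apply (k := k) (by omega), h1, hodge_zero, hodge_zero]
    · rw [g.starOp_apply_of_lt (not_le.1 hk')]

/-- Both operators fix `1` and anticommute with every `v^♭ ∧`, and these exterior multiplications
generate all forms from `1`. -/
theorem starOp_mul_starOp : g.starOp * g.starOp = parity V := by
  ext1 β
  have hpe (u : V) : parity V * g.ext u = -(g.ext u * parity V) := parity_mul_extMul _
  have h1 (v : V) : g.starOp * g.starOp * g.ext v = -(g.ext v * (g.starOp * g.starOp)) := by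
    rw [mul_assoc, starOp_mul_ext, ← mul_assoc, ← mul_assoc, starOp_mul_intMul]
    simp only [neg_mul, mul_assoc, ← starOp_mul_parity, parity_mul_parity, mul_one]
  induction β using g.ga_induction with
  | one =>
    rw [Module.End.mul_apply, starOp_starOp_one]
    ext k w
    by_cases hk : k = 0
    · subst hk; simp
    · have h1 : (GA.one : GA V) k = 0 := GA.one_apply_of_ne hk
      simp [h1]
  | add α β hα hβ => rw [map_add, map_add, hα, hβ]
  | smul c α hα => rw [map_smul, map_smul, hα]
  | ext v α hα =>
    rw [← Module.End.mul_apply, ← Module.End.mul_apply, h1, hpe, LinearMap.neg_apply,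
      LinearMap.neg_apply, Module.End.mul_apply, hα, ← Module.End.mul_apply]

/-- Conjugation by the Hodge operator turns exterior multiplication into contraction. -/
theorem starOp_mul_ext_mul_starOp (v : V) : g.starOp * g.ext v * g.starOp = intMul v := by
  rw [starOp_mul_ext, mul_assoc, ← starOp_mul_parity, mul_assoc, ← mul_assoc g.starOp,
    starOp_mul_starOp, parity_mul_parity, mul_one]

end HermInner

/-! ### Naturality under complex-linear isometries, and type decomposition. -/

section Pullback

open ContinuousAlternatingMap

variable {V : Type*} [NormedAddCommGroup V] [NormedSpace ℂ V]

/-- Pull-back by a real-linear map. -/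
def pull (F : V →L[ℝ] V) : Module.End ℂ (GA V) where
  toFun β := ⟨fun k => (β k).compContinuousLinearMap F⟩
  map_add' _ _ := rfl
  map_smul' _ _ := rfl

@[simp] theorem pull_apply (F : V →L[ℝ] V) (β : GA V) (k : ℕ) :
    pull F β k = (β k).compContinuousLinearMap F := rfl

theorem pull_mul_extMul (F : V →L[ℝ] V) (ξ : V →L[ℝ] ℂ) :
    pull F * extMul ξ = extMul (ξ ∘L F) * pull F := by
  ext β k w
  rcases k with _ | k
  · simp
  · simp [extMulHom_apply]
    rfl

theorem pull_mul_intMul (F : V →L[ℝ] V) (v : V) :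
    pull F * intMul (F v) = intMul v * pull F := by
  ext β k w
  simp only [Module.End.mul_apply, pull_apply, intMul_apply, compContinuousLinearMap_apply,
    curryLeft_apply_apply]
  congr 1
  funext s
  refine Fin.cases ?_ (fun s => ?_) s <;> simp

theorem pull_mul_parity (F : V →L[ℝ] V) : pull F * parity V = parity V * pull F := by
  ext β k w
  simp

theorem pull_one (F : V →L[ℝ] V) : pull F (GA.one : GA V) = GA.one := by
  ext k w
  by_cases hk : k = 0
  · subst hk; rfl
  · simp [GA.one_apply_of_ne hk]

theorem wedge_compContinuousLinearMap {k l m : ℕ} (h : k + l = m) (a : Alt V k) (b : Alt V l)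
    (F : V →L[ℝ] V) : (wedge h a b).compContinuousLinearMap F =
      wedge h (a.compContinuousLinearMap F) (b.compContinuousLinearMap F) := by
  ext w
  simp only [wedge, compContinuousLinearMap_apply, ContinuousAlternatingMap.smul_apply,
    ContinuousMultilinearMap.alternatization_apply_apply]
  rfl

/-- An operator on forms defined from a Hermitian scalar product is natural if it is compatible
with complex-linear isometries. -/
structure HermInner.IsIso (g g' : HermInner V) (F : V →L[ℝ] V) : Prop where
  map_smul : ∀ (c : ℂ) v, F (c • v) = c • F v
  inner_map : ∀ u v, g'.inner (F u) (F v) = g.inner u v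
  surjective : Function.Surjective F

/-- Operators on forms, defined from a Hermitian scalar product, that are compatible with
complex-linear isometries. -/
def IsNatural (T : HermInner V → Module.End ℂ (GA V)) : Prop :=
  ∀ g g' F, HermInner.IsIso g g' F → pull F * T g' = T g * pull F

namespace HermInner

variable {g g' : HermInner V} {F : V →L[ℝ] V}

theorem IsIso.pull_mul_ext (h : IsIso g g' F) (v : V) :
    pull F * g'.ext (F v) = g.ext v * pull F := by
  rw [ext, pull_mul_extMul]
  congr 2
  ext w
  simp [h.inner_map]

variable [FiniteDimensional ℂ V]

/-- An isometry need not map the chosen frame of `g` to that of `g'`, so the description of `L` as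
the wedge product with `ω` is used: `ω` is preserved by pull-back. -/
theorem isNatural_lefOp : IsNatural fun g : HermInner V => g.lefOp g.frame := by
  intro g g' F h
  have hω : (g'.fundForm).compContinuousLinearMap F = g.fundForm := by
    ext w
    change ((g'.inner (Complex.I • F (w 0)) (F (w 1)) : ℝ) : ℂ) =
      ((g.inner (Complex.I • w 0) (w 1) : ℝ) : ℂ)
    rw [← h.map_smul, h.inner_map]
  ext1 β
  ext1 k
  simp only [Module.End.mul_apply, pull_apply]
  rw [← show g'.lef β.toFun k = g'.lefOp g'.frame β k from g'.lef_eq _ _,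
    ← show g.lef (pull F β).toFun k = g.lefOp g.frame (pull F β) k from g.lef_eq _ _]
  match k with
  | 0 => rfl
  | 1 => rfl
  | k + 2 => rw [lef, lef, wedge_compContinuousLinearMap, hω]; rfl

theorem IsIso.pull_vol (h : IsIso g g' F) : (g'.vol).compContinuousLinearMap F = g.vol := by
  have key (n : ℕ) : pull F ((g'.lefOp g'.frame ^ n) GA.one) = (g.lefOp g.frame ^ n) GA.one := by
    induction n with
    | zero => exact pull_one F
    | succ n ih =>
      rw [pow_succ', pow_succ', Module.End.mul_apply, ← Module.End.mul_apply (pull F),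
        isNatural_lefOp g g' F h, Module.End.mul_apply, ih, Module.End.mul_apply]
  rw [vol_eq, vol_eq, ← key]
  rfl

/-- Independently of the frame, `Λ` is determined by `Λ 1 = 0` and `[Λ, v^♭ ∧] = ι_{J v}`, and
pull-back by a complex-linear isometry respects both. -/
theorem isNatural_lamOp : IsNatural fun g : HermInner V => lamOp g.frame := by
  intro g g' F h
  ext1 β
  induction β using g'.ga_induction with
  | one =>
    simp only [Module.End.mul_apply, lamOp_one, pull_one, _root_.map_zero]
  | add α β hα hβ => rw [map_add, map_add, hα, hβ]
  | smul c α hα => rw [map_smul, map_smul, hα]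
  | ext w α hα =>
    obtain ⟨v, rfl⟩ := h.surjective w
    have h1 : lamOp g'.frame (g'.ext (F v) α) =
        g'.ext (F v) (lamOp g'.frame α) + intMul (Complex.I • F v) α :=
      LinearMap.congr_fun (g'.isFrame_frame.lamOp_mul_ext (F v)) α
    have h2 : lamOp g.frame (g.ext v (pull F α)) =
        g.ext v (lamOp g.frame (pull F α)) + intMul (Complex.I • v) (pull F α) :=
      LinearMap.congr_fun (g.isFrame_frame.lamOp_mul_ext v) (pull F α)
    have h3 (β) : pull F (g'.ext (F v) β) = g.ext v (pull F β) :=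
      LinearMap.congr_fun (h.pull_mul_ext v) β
    have h4 : pull F (intMul (Complex.I • F v) α) = intMul (Complex.I • v) (pull F α) := by
      rw [← h.map_smul]
      exact LinearMap.congr_fun (pull_mul_intMul F (Complex.I • v)) α
    rw [Module.End.mul_apply, Module.End.mul_apply] at hα ⊢
    rw [h1, map_add, h3, h3, h2, h4, hα]

/-- As for `Λ`: the operator `*` is determined by `* 1 = vol` and its rule for exterior products,
and `vol` is natural because `L` is. -/
theorem isNatural_starOp : IsNatural fun g : HermInner V => g.starOp := by
  intro g g' F h
  ext1 β
  induction β using g'.ga_induction with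
  | one =>
    rw [Module.End.mul_apply, Module.End.mul_apply, pull_one]
    ext1 k
    by_cases hk : k = 2 * Module.finrank ℂ V
    · subst hk
      rw [pull_apply, starOp_one, starOp_one, h.pull_vol]
    · have h0 (g : HermInner V) : g.starOp GA.one k = 0 := by
        by_cases hk' : k ≤ 2 * Module.finrank ℂ V
        · obtain ⟨l, hl⟩ : ∃ l, l + k = 2 * Module.finrank ℂ V :=
            ⟨2 * Module.finrank ℂ V - k, by omega⟩
          rw [g.starOp_apply hl, GA.one_apply_of_ne (by omega), hodge_zero]
        · rw [g.starOp_apply_of_lt (not_le.1 hk')]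
      rw [pull_apply, h0, h0]
      rfl
  | add α β hα hβ => rw [map_add, map_add, hα, hβ]
  | smul c α hα => rw [map_smul, map_smul, hα]
  | ext w α hα =>
    obtain ⟨v, rfl⟩ := h.surjective w
    have h1 : g'.starOp (g'.ext (F v) α) = intMul (F v) (g'.starOp (parity V α)) :=
      LinearMap.congr_fun (g'.starOp_mul_ext (F v)) α
    have h2 : g.starOp (g.ext v (pull F α)) = intMul v (g.starOp (parity V (pull F α))) :=
      LinearMap.congr_fun (g.starOp_mul_ext v) (pull F α)
    have h3 : pull F (g'.ext (F v) α) = g.ext v (pull F α) :=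
      LinearMap.congr_fun (h.pull_mul_ext v) α
    have h4 (β) : pull F (intMul (F v) β) = intMul v (pull F β) :=
      LinearMap.congr_fun (pull_mul_intMul F v) β
    have h5 (g : HermInner V) (β) : g.starOp (parity V β) = parity V (g.starOp β) :=
      LinearMap.congr_fun g.starOp_mul_parity β
    have h6 (β) : pull F (parity V β) = parity V (pull F β) :=
      LinearMap.congr_fun (pull_mul_parity F) β
    rw [Module.End.mul_apply, Module.End.mul_apply] at hα ⊢
    rw [h1, h3, h2, h4, h5, h5, h6, hα]

end HermInner

/-- Used to pass from `d² = 0` to the relations between `∂` and `∂̄`. -/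
theorem isNatural_pull_mulC (c : ℂ) : IsNatural fun _ : HermInner V => pull (mulC V c) := by
  intro g g' F h
  ext β k w
  simp [Function.comp_def, h.map_smul]

/-! #### Types -/

/-- The projection onto type `(p, q)`, in all degrees. -/
def typeOp (V : Type*) [NormedAddCommGroup V] [NormedSpace ℂ V] (p q : ℕ) :
    Module.End ℂ (GA V) where
  toFun β := ⟨fun k => typeProj p q (β k)⟩
  map_add' β γ := by
    ext k w
    by_cases h : p + q = k
    · simp [typeProj, h, mul_add, Finset.sum_add_distrib]
    · simp [typeProj, h]
  map_smul' c β := by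
    ext k w
    by_cases h : p + q = k
    · simp [typeProj, h, Finset.mul_sum, mul_left_comm]
    · simp [typeProj, h]

theorem isNatural_typeOp (p q : ℕ) : IsNatural fun _ : HermInner V => typeOp V p q := by
  intro g g' F h
  ext β k w
  change typeProj p q (β k) (F ∘ w) = typeProj p q ((β k).compContinuousLinearMap F) w
  by_cases hk : p + q = k
  · simp [typeProj, hk, Function.comp_def, h.map_smul]
  · simp [typeProj, hk]

/-- Orthogonality of the characters in `sum_rootU`. -/
theorem IsType.typeProj_eq {k p q p' q' : ℕ} {α : Alt V k} (hα : IsType p q α) (h : p + q = k)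
    (h' : p' + q' = k) : typeProj p' q' α = if p' = p then α else 0 := by
  ext w
  have hk : (k : ℂ) + 1 ≠ 0 := by exact_mod_cast Nat.succ_ne_zero k
  have h1 := sum_rootU h' h
  simp only [typeProj, h', if_true, ContinuousAlternatingMap.smul_apply,
    ContinuousAlternatingMap.sum_apply, compContinuousLinearMap_apply, Function.comp_def,
    mulC_apply, hα _ w, smul_eq_mul, ← mul_assoc]
  rw [← Finset.sum_mul]
  simp only [← mul_assoc] at h1
  rw [h1]
  split_ifs <;> simp [hk]

/-- The complex-linear part of a covector. -/
def holPart (ξ : V →L[ℝ] ℂ) : V →L[ℝ] ℂ := (2 : ℂ)⁻¹ • (ξ - Complex.I • (ξ ∘L mulC V Complex.I))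

/-- The antilinear part of a covector. -/
def antiholPart (ξ : V →L[ℝ] ℂ) : V →L[ℝ] ℂ :=
  (2 : ℂ)⁻¹ • (ξ + Complex.I • (ξ ∘L mulC V Complex.I))

theorem holPart_add_antiholPart (ξ : V →L[ℝ] ℂ) : holPart ξ + antiholPart ξ = ξ := by
  ext v
  simp [holPart, antiholPart]
  ring

theorem apply_complex_smul (ξ : V →L[ℝ] ℂ) (c : ℂ) (v : V) :
    ξ (c • v) = c.re * ξ v + c.im * ξ (Complex.I • v) := by
  have : c • v = c.re • v + c.im • (Complex.I • v) := by
    nth_rewrite 1 [← Complex.re_add_im c]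
    rw [add_smul, mul_smul, Complex.coe_smul, Complex.coe_smul]
  rw [this, map_add, map_smul, map_smul]
  simp

theorem holPart_smul (ξ : V →L[ℝ] ℂ) (c : ℂ) (v : V) : holPart ξ (c • v) = c * holPart ξ v := by
  have h1 := apply_complex_smul ξ c v
  have h2 := apply_complex_smul ξ (Complex.I * c) v
  rw [mul_smul] at h2
  simp only [Complex.mul_re, Complex.I_re, zero_mul, Complex.I_im, one_mul, zero_sub,
    Complex.mul_im, zero_add] at h2
  simp only [holPart, _root_.smul_apply, _root_.sub_apply, ContinuousLinearMap.comp_apply,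
    mulC_apply, smul_eq_mul, h1, h2]
  conv_rhs => rw [← Complex.re_add_im c]
  push_cast
  linear_combination ((c.im : ℂ) / 2 * ξ (Complex.I • v)) * Complex.I_sq

theorem antiholPart_smul (ξ : V →L[ℝ] ℂ) (c : ℂ) (v : V) :
    antiholPart ξ (c • v) = starRingEnd ℂ c * antiholPart ξ v := by
  have h1 := apply_complex_smul ξ c v
  have h2 := apply_complex_smul ξ (Complex.I * c) v
  rw [mul_smul] at h2
  simp only [Complex.mul_re, Complex.I_re, zero_mul, Complex.I_im, one_mul, zero_sub,
    Complex.mul_im, zero_add] at h2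
  simp only [antiholPart, _root_.smul_apply, _root_.add_apply, ContinuousLinearMap.comp_apply,
    mulC_apply, smul_eq_mul, h1, h2]
  have : starRingEnd ℂ c = c.re - c.im * Complex.I := by
    apply Complex.ext <;> simp
  rw [this]
  push_cast
  linear_combination ((c.im : ℂ) / 2 * ξ (Complex.I • v)) * Complex.I_sq

theorem IsType.extMulHom_holPart {k p q : ℕ} {α : Alt V k} (hα : IsType p q α) (ξ : V →L[ℝ] ℂ) :
    IsType (p + 1) q (extMulHom k (holPart ξ) α) := by
  intro c w
  rw [extMulHom_apply, extMulHom_apply, Finset.mul_sum]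
  refine Finset.sum_congr rfl fun i _ => ?_
  have := hα c (i.removeNth w)
  rw [holPart_smul]
  change _ * (_ * α (fun s => c • i.removeNth w s)) = _
  rw [this]
  ring

theorem IsType.extMulHom_antiholPart {k p q : ℕ} {α : Alt V k} (hα : IsType p q α)
    (ξ : V →L[ℝ] ℂ) : IsType p (q + 1) (extMulHom k (antiholPart ξ) α) := by
  intro c w
  rw [extMulHom_apply, extMulHom_apply, Finset.mul_sum]
  refine Finset.sum_congr rfl fun i _ => ?_
  have := hα c (i.removeNth w)
  rw [antiholPart_smul]
  change _ * (_ * α (fun s => c • i.removeNth w s)) = _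
  rw [this]
  ring

theorem extMulHom_holPart_add {k : ℕ} (ξ : V →L[ℝ] ℂ) (β : Alt V k) :
    extMulHom k ξ β = extMulHom k (holPart ξ) β + extMulHom k (antiholPart ξ) β := by
  have h := LinearMap.congr_fun (extMul_add (holPart ξ) (antiholPart ξ)) ⟨Pi.single k β⟩
  rw [holPart_add_antiholPart] at h
  have h2 := congrArg (fun γ : GA V => γ (k + 1)) h
  simpa using h2

theorem typeProj_add {k : ℕ} (p q : ℕ) (α β : Alt V k) :
    typeProj p q (α + β) = typeProj p q α + typeProj p q β := by
  have h := congrArg (fun γ : GA V => γ k)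
    ((typeOp V p q).map_add ⟨Pi.single k α⟩ ⟨Pi.single k β⟩)
  simpa [typeOp] using h

/-- The left side is the symbol of `∂` as it is defined through types. On a component of type `(p,
q)` only the product with the `(1, 0)` part of `ξ` has type `(p+1, q)`. -/
theorem sum_typeProj_extMulHom {k : ℕ} (ξ : V →L[ℝ] ℂ) (β : Alt V k) :
    ∑ pq ∈ Finset.HasAntidiagonal.antidiagonal k,
      typeProj (pq.1 + 1) pq.2 (extMulHom k ξ (typeProj pq.1 pq.2 β)) =
        extMulHom k (holPart ξ) β := by
  conv_rhs => rw [← sum_typeProj β, _root_.map_sum]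
  refine Finset.sum_congr rfl fun pq hpq => ?_
  have hk := Finset.HasAntidiagonal.mem_antidiagonal.1 hpq
  rw [extMulHom_holPart_add, typeProj_add,
    ((typeProj_isType β).extMulHom_holPart ξ).typeProj_eq (by omega) (by omega),
    ((typeProj_isType β).extMulHom_antiholPart ξ).typeProj_eq (by omega) (by omega)]
  simp

theorem sum_typeProj_extMulHom' {k : ℕ} (ξ : V →L[ℝ] ℂ) (β : Alt V k) :
    ∑ pq ∈ Finset.HasAntidiagonal.antidiagonal k,
      typeProj pq.1 (pq.2 + 1) (extMulHom k ξ (typeProj pq.1 pq.2 β)) =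
        extMulHom k (antiholPart ξ) β := by
  conv_rhs => rw [← sum_typeProj β, _root_.map_sum]
  refine Finset.sum_congr rfl fun pq hpq => ?_
  have hk := Finset.HasAntidiagonal.mem_antidiagonal.1 hpq
  rw [extMulHom_holPart_add, typeProj_add,
    ((typeProj_isType β).extMulHom_holPart ξ).typeProj_eq (by omega) (by omega),
    ((typeProj_isType β).extMulHom_antiholPart ξ).typeProj_eq (by omega) (by omega)]
  simp

/-- The sign differs from that in `holPart` because `J` is skew: `v^♭ ∘ J = -(J v)^♭`. -/
theorem HermInner.holPart_flat (g : HermInner V) (v : V) :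
    holPart (g.flat v) = (2 : ℂ)⁻¹ • (g.flat v + Complex.I • g.flat (Complex.I • v)) := by
  ext w
  simp only [holPart, _root_.smul_apply, _root_.sub_apply, _root_.add_apply,
    ContinuousLinearMap.comp_apply, mulC_apply, HermInner.flat_apply, g.inner_J_left v w]
  simp [sub_eq_add_neg]

theorem HermInner.antiholPart_flat (g : HermInner V) (v : V) :
    antiholPart (g.flat v) = (2 : ℂ)⁻¹ • (g.flat v - Complex.I • g.flat (Complex.I • v)) := by
  ext w
  simp only [antiholPart, _root_.smul_apply, _root_.sub_apply, _root_.add_apply,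
    ContinuousLinearMap.comp_apply, mulC_apply, HermInner.flat_apply, g.inner_J_left v w]
  simp [sub_eq_add_neg]

end Pullback

/-! ### Smooth unitary frames that are adapted to first order. -/

section

set_option maxSynthPendingDepth 3

section Frames

open scoped Topology
open ContinuousLinearMap (precomp postcomp)

/-- A smooth square root near `1` in a Banach algebra, compatible with bounded linear maps that
preserve squares. -/
theorem exists_contDiffAt_sqrt (R : Type*) [NormedRing R] [NormedAlgebra ℝ R] [CompleteSpace R] :
    ∃ S : R → R, S 1 = 1 ∧ ContDiffAt ℝ ∞ S 1 ∧ (∀ᶠ x in 𝓝 (1 : R), S x * S x = x) ∧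
      ∀ σ : R →L[ℝ] R, σ 1 = 1 → (∀ x, σ (x * x) = σ x * σ x) →
        ∀ᶠ x in 𝓝 (1 : R), σ x = x → σ (S x) = S x := by
  have h2 : (2 : ℝ) ≠ 0 := two_ne_zero
  -- The derivative of squaring at `1` is multiplication by `2`, so the inverse function theorem
  -- applies.
  let f' : R ≃L[ℝ] R := ContinuousLinearEquiv.smulLeft (Units.mk0 (2 : ℝ) h2)
  have hc : ContDiffAt ℝ ∞ (fun x : R => x * x) 1 := (contDiff_id.mul contDiff_id).contDiffAt
  have hf : HasFDerivAt (fun x : R => x * x) (f' : R →L[ℝ] R) 1 := by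
    have h := (hasFDerivAt_id (𝕜 := ℝ) (1 : R)).mul' (hasFDerivAt_id (𝕜 := ℝ) (1 : R))
    convert! h using 1
    ext x
    have : f' x = (2 : ℝ) • x := rfl
    simp [this, two_smul]
  have hs := hc.hasStrictFDerivAt' hf (by simp)
  refine ⟨hc.localInverse hf (by simp), ?_, ?_, ?_, fun σ h1 hσ => ?_⟩
  · have := hc.localInverse_apply_image hf (by simp)
    simpa using this
  · have := hc.to_localInverse hf (by simp)
    simpa using this
  · have := hs.eventually_right_inverse
    simp only [mul_one] at this
    exact this
  · have h3 := hs.eventually_right_inverse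
    have h4 := hs.eventually_left_inverse
    have h5 := hs.localInverse_continuousAt
    have h6 := hs.localInverse_apply_image
    simp only [mul_one] at h3 h5 h6
    -- If `σ x = x`, then `σ (S x)` is another square root of `x`; being near `1`, it equals `S x`
    -- by local uniqueness.
    have h7 : Filter.Tendsto (fun x => σ (hs.localInverse _ _ _ x)) (𝓝 1) (𝓝 1) := by
      have := (σ.continuous.continuousAt).tendsto.comp h5.tendsto
      rwa [h6, h1] at this
    filter_upwards [h3, h7.eventually h4] with x hx hx' hσx
    change σ (hs.localInverse _ _ _ x) = hs.localInverse _ _ _ x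
    rw [← hσ, hx, hσx] at hx'
    exact hx'.symm

variable {E : Type*} [NormedAddCommGroup E] [NormedSpace ℂ E]

theorem HermInner.ext_inner (h : HermInner E) {u v : E} (huv : ∀ w, h.inner u w = h.inner v w) :
    u = v := by
  by_contra hne
  have h1 := h.pos (u - v) (sub_ne_zero.2 hne)
  have h2 := huv (u - v)
  rw [map_sub (h.inner), _root_.sub_apply, h2, sub_self] at h1
  exact lt_irrefl _ h1

variable [FiniteDimensional ℂ E]

/-- The inverse of the isomorphism `E → E^*` given by a scalar product. -/
def HermInner.sharp (h : HermInner E) : (E →L[ℝ] ℝ) →L[ℝ] E :=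
  ∑ a, (ContinuousLinearMap.apply ℝ ℝ (h.frame a)).smulRight (h.frame a)

@[simp] theorem HermInner.inner_sharp (h : HermInner E) (f : E →L[ℝ] ℝ) (v : E) :
    h.inner (h.sharp f) v = f v := by
  conv_rhs => rw [← h.isFrame_frame v, _root_.map_sum]
  simp [HermInner.sharp, mul_comm]

set_option maxHeartbeats 1000000 in
/-- Adapted unitary frames: a smooth family of Hermitian scalar products can be trivialised by a
smooth family of complex-linear maps, whose derivative at the base point is symmetric if the
fundamental form is closed there. -/
theorem exists_adapted_frame (h : HermInner E) (G : E → E →L[ℝ] E →L[ℝ] ℝ) (y₀ : E)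
    (hG : ContDiffAt ℝ ∞ G y₀) (h0 : G y₀ = h.inner)
    (hsymm : ∀ᶠ y in 𝓝 y₀, ∀ u v, G y u v = G y v u)
    (hJ : ∀ᶠ y in 𝓝 y₀, ∀ u v, G y (Complex.I • u) (Complex.I • v) = G y u v) :
    ∃ A : E → E →L[ℝ] E, ContDiffAt ℝ ∞ A y₀ ∧ A y₀ = ContinuousLinearMap.id ℝ E ∧
      (∀ᶠ y in 𝓝 y₀, (∀ u v, G y (A y u) (A y v) = h.inner u v) ∧
        ∀ v, A y (Complex.I • v) = Complex.I • A y v) ∧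
      ((∀ a b c, fderiv ℝ G y₀ a (Complex.I • b) c + fderiv ℝ G y₀ b (Complex.I • c) a +
        fderiv ℝ G y₀ c (Complex.I • a) b = 0) →
        ∀ u v, fderiv ℝ A y₀ u v = fderiv ℝ A y₀ v u) := by
  have : FiniteDimensional ℝ E := FiniteDimensional.complexToReal E
  have : CompleteSpace E := FiniteDimensional.complete ℝ E
  have II (v : E) : Complex.I • Complex.I • v = -v := by
    rw [smul_smul, Complex.I_mul_I, neg_one_smul]
  -- the derivative of the metric
  set D := fderiv ℝ G y₀ with hD
  have hGd : HasFDerivAt G D y₀ := (hG.differentiableAt (by simp)).hasFDerivAt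
  have hDapp (u v : E) : HasFDerivAt (fun y => G y u v) ((D.flip u).flip v) y₀ := by
    have := (hGd.clm_apply (hasFDerivAt_const u y₀)).clm_apply (hasFDerivAt_const v y₀)
    convert! this using 1
    ext w; simp
  have hDsymm (w u v : E) : D w u v = D w v u := by
    have h1 := (hDapp u v).congr_of_eventuallyEq
      (f₁ := fun y => G y v u) (hsymm.mono fun y hy => hy v u)
    have := ((hDapp v u).unique h1)
    have := DFunLike.congr_fun this w
    simpa using this.symm
  have hDJ (w u v : E) : D w (Complex.I • u) (Complex.I • v) = D w u v := by
    have h1 := (hDapp u v).congr_of_eventuallyEq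
      (f₁ := fun y => G y (Complex.I • u) (Complex.I • v)) (hJ.mono fun y hy => hy u v)
    have := ((hDapp _ _).unique h1)
    have := DFunLike.congr_fun this w
    simpa using this
  have hDJ' (w u v : E) : D w u (Complex.I • v) = -D w (Complex.I • u) v := by
    rw [← hDJ w u, II, map_neg]
  -- the Christoffel symbols
  let J : E →L[ℝ] E := mulC E Complex.I
  -- With `h(Q_w u, v) = ½ (D_w(u, v) - D_{Jw}(Ju, v))`, three things hold: `Q_w` commutes with `J`;
  -- its symmetrised form `h(Q_w u, v) + h(u, Q_w v)` is `D_w(u, v)`; and `Q_w u` is symmetric in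
  -- `w` and `u` when the fundamental form is closed.
  let Q : E →L[ℝ] E →L[ℝ] E :=
    (postcomp E h.sharp) ∘L ((2 : ℝ)⁻¹ • (D - precomp (E →L[ℝ] ℝ) J ∘L D ∘L J))
  have hQ (w u v : E) : h.inner (Q w u) v =
      2⁻¹ * (D w u v - D (Complex.I • w) (Complex.I • u) v) := by
    simp [Q, J]
  have hQJ (w u : E) : Q w (Complex.I • u) = Complex.I • Q w u := by
    refine h.ext_inner fun v => ?_
    rw [hQ, h.inner_J_left, hQ, II, hDJ', hDJ, map_neg, _root_.neg_apply]
    ring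
  let B : E → E →L[ℝ] E := fun y => ContinuousLinearMap.id ℝ E - Q (y - y₀)
  have hBc : ContDiffAt ℝ ∞ B y₀ := by
    refine (contDiff_const.sub (Q.contDiff.comp (contDiff_id.sub contDiff_const))).contDiffAt
  have hB0 : B y₀ = ContinuousLinearMap.id ℝ E := by simp [B]
  have hBd : HasFDerivAt B (-Q) y₀ := by
    have := HasFDerivAt.comp (f := fun y => y - y₀) y₀ (Q.hasFDerivAt (x := y₀ - y₀))
      ((hasFDerivAt_id y₀).sub_const y₀)
    have := this.const_sub (ContinuousLinearMap.id ℝ E)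
    convert! this using 1
  have hBJ (y v : E) : B y (Complex.I • v) = Complex.I • B y v := by
    simp [B, hQJ, smul_sub]
  -- the metric in the frame `B`
  let P : E → E →L[ℝ] E := fun y =>
    h.sharp ∘L ((ContinuousLinearMap.compL ℝ E E ℝ).flip (B y) ∘L (G y ∘L B y))
  have hP (y u v : E) : h.inner (P y u) v = G y (B y u) (B y v) := by
    simp [P]
  have hPc : ContDiffAt ℝ ∞ P y₀ := by
    refine contDiffAt_const.clm_comp (ContDiffAt.clm_comp ?_ (hG.clm_comp hBc))
    exact (ContinuousLinearMap.compL ℝ E E ℝ).flip.contDiff.contDiffAt.comp y₀ hBc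
  have hP0 : P y₀ = 1 := by
    ext u
    refine h.ext_inner fun v => ?_
    rw [hP, hB0, h0]
    rfl
  -- The derivative of the metric cancels against the two copies of `Q`; the remaining terms
  -- `D_{Jw}(Ju, v)` and `D_{Jw}(u, Jv)` are opposite.
  have hPd : HasFDerivAt P (0 : E →L[ℝ] E →L[ℝ] E) y₀ := by
    have h1 := (hPc.differentiableAt (by simp)).hasFDerivAt
    convert! h1 using 1
    ext w u
    refine h.ext_inner fun v => ?_
    have h2 : HasFDerivAt (fun y => h.inner (P y u) v)
        ((h.inner.flip v) ∘L ((fderiv ℝ P y₀).flip u)) y₀ := by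
      have h3 := h1.clm_apply (hasFDerivAt_const u y₀)
      have h4 := (h.inner.flip v).hasFDerivAt.comp y₀ h3
      convert! h4 using 1
      ext; simp
    have h5 (u : E) : HasFDerivAt (fun y => B y u) (-Q.flip u) y₀ := by
      have h3 := hBd.clm_apply (hasFDerivAt_const u y₀)
      convert! h3 using 1
      ext; simp
    have h6 := (hGd.clm_apply (h5 u)).clm_apply (h5 v)
    have h7 := DFunLike.congr_fun (h2.unique (h6.congr_of_eventuallyEq
      (Filter.Eventually.of_forall fun y => hP y u v))) w
    simp [hB0, h0] at h7
    rw [h7, hQ, h.symm u, hQ, hDsymm w v u, hDsymm (Complex.I • w) (Complex.I • v), hDJ']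
    simp
    ring
  have hPsymm : ∀ᶠ y in 𝓝 y₀, ∀ u v, h.inner (P y u) v = h.inner u (P y v) := by
    filter_upwards [hsymm] with y hy u v
    rw [h.symm u, hP, hP, hy]
  have hPJ : ∀ᶠ y in 𝓝 y₀, ∀ u, P y (Complex.I • u) = Complex.I • P y u := by
    filter_upwards [hJ] with y hy u
    refine h.ext_inner fun v => ?_
    rw [hP, h.inner_J_left, hP, hBJ, hBJ, ← hy (B y u), II, map_neg, neg_neg]
  -- its square root
  obtain ⟨S, hS1, hSc, hSS, hSσ⟩ := exists_contDiffAt_sqrt (E →L[ℝ] E)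
  let adj : (E →L[ℝ] E) →L[ℝ] (E →L[ℝ] E) :=
    postcomp E h.sharp ∘L (precomp (E →L[ℝ] ℝ) h.inner ∘L
      (ContinuousLinearMap.compL ℝ E E ℝ).flip)
  have hadj (X : E →L[ℝ] E) (u v : E) : h.inner (adj X u) v = h.inner u (X v) := by
    simp [adj]
  let conjJ : (E →L[ℝ] E) →L[ℝ] (E →L[ℝ] E) := -(postcomp E J ∘L precomp E J)
  have hconjJ (X : E →L[ℝ] E) (u : E) : conjJ X u = -(Complex.I • X (Complex.I • u)) := by
    simp [conjJ, J]
  -- The square root inherits symmetry for `h` and commutation with `J` from `P`. Taking adjoints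
  -- reverses products but preserves squares, which is all that is required; conjugation by `J`
  -- preserves all products.
  have hS_adj := hSσ adj (by
      ext u; refine h.ext_inner fun v => ?_
      rw [hadj]; rfl) (fun X => by
      ext u; refine h.ext_inner fun v => ?_
      simp only [hadj, mul_apply_eq_comp]) 
  have hS_J := hSσ conjJ (by
      ext u; rw [hconjJ]; simp [II]) (fun X => by
      ext u; simp [hconjJ, II])
  have hPt : Filter.Tendsto P (𝓝 y₀) (𝓝 1) := by
    have := hPc.continuousAt.tendsto
    rwa [hP0] at this
  have hSP : ContDiffAt ℝ ∞ (fun y => S (P y)) y₀ := by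
    refine ContDiffAt.comp y₀ ?_ hPc
    rwa [hP0]
  have hSPd : HasFDerivAt (fun y => S (P y)) (0 : E →L[ℝ] E →L[ℝ] E) y₀ := by
    have h1 : HasFDerivAt S (fderiv ℝ S 1) (P y₀) := by
      rw [hP0]
      exact (hSc.differentiableAt (by simp)).hasFDerivAt
    have := h1.comp y₀ hPd
    rwa [ContinuousLinearMap.comp_zero] at this
  have hSP1 : S (P y₀) = 1 := by rw [hP0, hS1]
  -- Correcting `B` by `P^{-1/2}` makes it isometric. Since `P` is stationary at `y₀`, this does not
  -- change the first derivative.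
  let T : E → E →L[ℝ] E := fun y => Ring.inverse (S (P y))
  have hinv : ContDiffAt ℝ ∞ (Ring.inverse : (E →L[ℝ] E) → E →L[ℝ] E) (S (P y₀)) := by
    rw [hSP1]
    exact contDiffAt_ringInverse ℝ (1 : (E →L[ℝ] E)ˣ)
  have hTc : ContDiffAt ℝ ∞ T y₀ :=
    ContDiffAt.comp (f := fun y => S (P y)) y₀ hinv hSP
  have hT0 : T y₀ = 1 := by simp [T, hSP1]
  have hTd : HasFDerivAt T (0 : E →L[ℝ] E →L[ℝ] E) y₀ := by
    have := HasFDerivAt.comp (f := fun y => S (P y)) y₀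
      (hinv.differentiableAt (by simp)).hasFDerivAt hSPd
    rwa [ContinuousLinearMap.comp_zero] at this
  have hunit : ∀ᶠ y in 𝓝 y₀, IsUnit (S (P y)) := by
    refine hSP.continuousAt.eventually (Units.isOpen.mem_nhds ?_)
    change IsUnit (S (P y₀))
    rw [hSP1]
    exact isUnit_one
  refine ⟨fun y => B y ∘L T y, hBc.clm_comp hTc, ?_, ?_, fun hcl u v => ?_⟩
  · simp only [hB0, hT0]; rfl
  · filter_upwards [hunit, hPsymm, hPJ, hPt.eventually hSS, hPt.eventually hS_adj,
      hPt.eventually hS_J] with y hu hs hj hss ha hJ'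
    have ha := ha (by
      ext u; refine h.ext_inner fun v => ?_
      rw [hadj, hs])
    have hJ' := hJ' (by
      ext u; rw [hconjJ, hj, II, neg_neg])
    have hST : S (P y) * T y = 1 := Ring.mul_inverse_cancel _ hu
    have hTS : T y * S (P y) = 1 := Ring.inverse_mul_cancel _ hu
    have hSTv (v : E) : S (P y) (T y v) = v := DFunLike.congr_fun hST v
    have hTSv (v : E) : T y (S (P y) v) = v := DFunLike.congr_fun hTS v
    have hSJ (v : E) : S (P y) (Complex.I • v) = Complex.I • S (P y) v := by
      have h1 := hconjJ (S (P y)) v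
      rw [hJ'] at h1
      rw [h1, smul_neg, II, neg_neg]
    constructor
    · intro u v
      change G y (B y (T y u)) (B y (T y v)) = _
      rw [← hP]
      conv_lhs => rw [← hss]
      change h.inner (S (P y) (S (P y) (T y u))) _ = _
      rw [hSTv]
      conv_lhs => rw [← ha]
      rw [hadj, hSTv]
    · intro v
      change B y (T y (Complex.I • v)) = Complex.I • B y (T y v)
      rw [← hBJ]
      congr 1
      rw [← hTSv (Complex.I • T y v), hSJ, hSTv]
  · have hA : HasFDerivAt (fun y => B y ∘L T y) (-Q) y₀ := by
      have := hBd.clm_comp hTd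
      convert! this using 1
      ext w u
      simp [hT0]
    rw [hA.fderiv]
    simp only [_root_.neg_apply]
    congr 1
    refine h.ext_inner fun w => ?_
    rw [hQ, hQ]
    -- Closedness on `(u, v, Jw)` and on `(Ju, Jv, Jw)`: both relations contain `D_{Jw}(Ju, v)`, and
    -- their difference is the symmetry of `Q`.
    have h1 := hcl u v (Complex.I • w)
    have h2 := hcl (Complex.I • u) (Complex.I • v) (Complex.I • w)
    have h3 := hDJ' (Complex.I • v) w u
    rw [hDsymm _ w, hDsymm _ (Complex.I • w)] at h3
    simp only [II, map_neg, _root_.neg_apply, hDJ, hDJ', neg_neg] at h1 h2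
    rw [hDsymm v u w, hDsymm _ (Complex.I • w)] at *
    linarith

end Frames

end

/-! ### Smoothness and derivatives of families of forms. -/

section

set_option maxSynthPendingDepth 3

section FormCalculus

open scoped Topology

variable {E : Type*} [NormedAddCommGroup E] [NormedSpace ℂ E] [FiniteDimensional ℂ E]

/-- The components of a form in a basis. -/
def altCoords (E : Type*) [NormedAddCommGroup E] [NormedSpace ℂ E] (k : ℕ) :
    Alt E k →L[ℝ] ((Fin k → Module.Basis.ofVectorSpaceIndex ℝ E) → ℂ) :=
  ContinuousLinearMap.pi fun i => ContinuousAlternatingMap.apply ℝ E ℂ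
    fun s => Module.Basis.ofVectorSpace ℝ E (i s)

omit [FiniteDimensional ℂ E] in
theorem altCoords_injective (k : ℕ) : Function.Injective (altCoords E k) := by
  intro α β h
  apply ContinuousAlternatingMap.toAlternatingMap_injective
  exact Module.Basis.ext_alternating (Module.Basis.ofVectorSpace ℝ E) fun v _ => congrFun h v

instance finiteDimensional_alt (k : ℕ) : FiniteDimensional ℝ (Alt E k) := by
  have : FiniteDimensional ℝ E := FiniteDimensional.complexToReal E
  exact Module.Finite.of_injective (altCoords E k).toLinearMap (altCoords_injective k)

/-- The map to components in a basis is linear and injective, hence has a linear left inverse, which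
is continuous in finite dimension. -/
theorem contDiffAt_alt {F : Type*} [NormedAddCommGroup F] [NormedSpace ℝ F] {n : WithTop ℕ∞}
    {k : ℕ} {f : F → Alt E k} {y : F} (h : ∀ v, ContDiffAt ℝ n (fun z => f z v) y) :
    ContDiffAt ℝ n f y := by
  have : FiniteDimensional ℝ E := FiniteDimensional.complexToReal E
  obtain ⟨r, hr⟩ := (altCoords E k).toLinearMap.exists_leftInverse_of_injective
    (LinearMap.ker_eq_bot.2 (altCoords_injective k))
  have h1 : ContDiffAt ℝ n (fun z => altCoords E k (f z)) y := contDiffAt_pi.2 fun i => h _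
  have h2 := r.toContinuousLinearMap.contDiff.contDiffAt.comp y h1
  convert! h2 using 1
  funext z
  exact (LinearMap.congr_fun hr (f z)).symm

theorem contDiffAt_compContinuousLinearMap {F : Type*} [NormedAddCommGroup F] [NormedSpace ℝ F]
    {n : WithTop ℕ∞} {k : ℕ} {f : F → Alt E k} {A : F → E →L[ℝ] E} {y : F}
    (hf : ContDiffAt ℝ n f y) (hA : ContDiffAt ℝ n A y) :
    ContDiffAt ℝ n (fun z => (f z).compContinuousLinearMap (A z)) y := by
  refine contDiffAt_alt fun v => ?_
  have h1 : ContDiffAt ℝ n (fun z =>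
      ContinuousMultilinearMap.compContinuousLinearMapContinuousMultilinear ℝ
        (fun _ : Fin k => E) (fun _ => E) ℂ (fun _ => A z)) y :=
    (ContinuousMultilinearMap.contDiff _).contDiffAt.comp y (contDiffAt_pi.2 fun _ => hA)
  have h2 : ContDiffAt ℝ n (fun z => (f z).toContinuousMultilinearMap) y :=
    (ContinuousAlternatingMap.toContinuousMultilinearMapCLM (E := E) (F := ℂ) (ι := Fin k) (𝕜 := ℝ)
      ℝ).contDiff.contDiffAt.comp y hf
  exact (ContinuousMultilinearMap.apply ℝ (fun _ : Fin k => E) ℂ v).contDiff.contDiffAt.comp y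
    (h1.clm_apply h2)

/-- The form of degree `l`, as an element of the exterior algebra. -/
def GA.single {V : Type*} [NormedAddCommGroup V] [NormedSpace ℂ V] (l : ℕ) :
    Alt V l →ₗ[ℂ] GA V where
  toFun β := ⟨Pi.single l β⟩
  map_add' β γ := by ext1 k; exact congrFun (Pi.single_add l β γ) k
  map_smul' c β := by ext1 k; exact congrFun (Pi.single_smul l c β) k

theorem GA.sum_single (β : GA E) :
    ∑ l ∈ Finset.range (2 * Module.finrank ℂ E + 1), GA.single l (β l) = β := by
  ext1 k
  rw [GA.sum_apply]
  by_cases hk : k < 2 * Module.finrank ℂ E + 1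
  · rw [Finset.sum_eq_single k]
    · exact Pi.single_eq_same (M := Alt E) k _
    · intro l _ hl
      exact Pi.single_eq_of_ne (M := Alt E) hl.symm _
    · exact fun h => absurd (Finset.mem_range.2 hk) h
  · rw [alt_eq_zero_of_finrank_lt (β k) (by omega)]
    exact alt_eq_zero_of_finrank_lt _ (by omega)

/-- An operator on the exterior algebra acts by finitely many continuous components. -/
theorem exists_components (T : Module.End ℂ (GA E)) (k : ℕ) :
    ∃ S : ∀ l, Alt E l →L[ℝ] Alt E k, ∀ β : GA E,
      T β k = ∑ l ∈ Finset.range (2 * Module.finrank ℂ E + 1), S l (β l) := by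
  let ev : GA E →ₗ[ℂ] Alt E k := ⟨⟨fun β => β k, fun _ _ => rfl⟩, fun _ _ => rfl⟩
  refine ⟨fun l => (((ev ∘ₗ T ∘ₗ GA.single l).restrictScalars ℝ)).toContinuousLinearMap,
    fun β => ?_⟩
  conv_lhs => rw [← GA.sum_single β]
  rw [_root_.map_sum, GA.sum_apply]
  rfl

theorem contDiffAt_end_apply (T : Module.End ℂ (GA E)) {F : Type*} [NormedAddCommGroup F]
    [NormedSpace ℝ F] {n : WithTop ℕ∞} {f : F → GA E} {y : F}
    (hf : ∀ l, ContDiffAt ℝ n (fun z => f z l) y) (k : ℕ) :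
    ContDiffAt ℝ n (fun z => T (f z) k) y := by
  obtain ⟨S, hS⟩ := exists_components T k
  simp_rw [hS]
  exact ContDiffAt.sum fun l _ => (S l).contDiff.contDiffAt.comp y (hf l)

/-- An operator with constant coefficients commutes with differentiation. The statement is made
degree by degree because `GA E` carries no norm here. -/
theorem fderiv_end_apply (T : Module.End ℂ (GA E)) {F : Type*} [NormedAddCommGroup F]
    [NormedSpace ℝ F] {f : F → GA E} {y : F}
    (hf : ∀ l, DifferentiableAt ℝ (fun z => f z l) y) (k : ℕ) (v : F) :
    fderiv ℝ (fun z => T (f z) k) y v = T ⟨fun l => fderiv ℝ (fun z => f z l) y v⟩ k := by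
  obtain ⟨S, hS⟩ := exists_components T k
  simp_rw [hS]
  have h := HasFDerivAt.fun_sum (u := Finset.range (2 * Module.finrank ℂ E + 1))
    fun l _ => (S l).hasFDerivAt.comp y (hf l).hasFDerivAt
  have h' := DFunLike.congr_fun h.fderiv v
  rw [_root_.sum_apply] at h'
  exact h'

end FormCalculus

end

/-! ### Forms and the exterior derivative in arbitrary charts. -/

section

set_option maxSynthPendingDepth 3

section Charts

open scoped Topology

variable {E : Type*} [NormedAddCommGroup E] [NormedSpace ℂ E]
  {X : Type*} [TopologicalSpace X] [ChartedSpace E X]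

/-- The differential of the inverse of the chart at `x₀`. -/
def chartDeriv (E : Type*) [NormedAddCommGroup E] [NormedSpace ℂ E] {X : Type*}
    [TopologicalSpace X] [ChartedSpace E X] (x₀ : X) (y : E) : E →L[ℝ] E :=
  mfderiv 𝓘(ℝ, E) 𝓘(ℝ, E) (chartAt E x₀).symm y

/-- The transition map from the chart at `x₀` to the chart at `x₁`. -/
def transition (E : Type*) [NormedAddCommGroup E] {X : Type*}
    [TopologicalSpace X] [ChartedSpace E X] (x₀ x₁ : X) : E → E :=
  chartAt E x₁ ∘ (chartAt E x₀).symm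

variable [IsManifold 𝓘(ℂ, E) ω X]

omit [NormedSpace ℂ E] [IsManifold 𝓘(ℂ, E) ω X] in
theorem contDiffAt_transition (𝕜 : Type*) [NontriviallyNormedField 𝕜] [NormedSpace 𝕜 E]
    [IsManifold 𝓘(𝕜, E) ω X] {x₀ x₁ : X} {y : E} (hy : y ∈ (chartAt E x₀).target)
    (hy' : (chartAt E x₀).symm y ∈ (chartAt E x₁).source) :
    ContDiffAt 𝕜 ω (transition E x₀ x₁) y := by
  have := contDiffWithinAt_ext_coord_change (n := ω) (I := 𝓘(𝕜, E)) x₁ x₀ (y := y)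
    (by simp [hy, hy'])
  simpa [transition, contDiffWithinAt_univ] using this

/-- The tangent space at a point is identified with `E` by the preferred chart of that point, so the
differential of `φ⁻¹` at `y` is that of a transition map whose target chart depends on `y`. -/
theorem chartDeriv_eq_fderiv (x₀ : X) {y : E} (hy : y ∈ (chartAt E x₀).target) :
    chartDeriv E x₀ y = fderiv ℝ (transition E x₀ ((chartAt E x₀).symm y)) y := by
  have h : MDifferentiableAt 𝓘(ℝ, E) 𝓘(ℝ, E) (chartAt E x₀).symm y :=
    mdifferentiableAt_atlas_symm (chart_mem_atlas E x₀) hy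
  have h1 : HasFDerivWithinAt (transition E x₀ ((chartAt E x₀).symm y)) (chartDeriv E x₀ y)
      (Set.range 𝓘(ℝ, E)) y := h.hasMFDerivAt.2
  rw [modelWithCornersSelf_coe, Set.range_id] at h1
  exact (hasFDerivWithinAt_univ.1 h1).fderiv.symm

/-- Transition maps are holomorphic; this is where the complex structure of `X` enters. -/
theorem chartDeriv_smul (x₀ : X) {y : E} (hy : y ∈ (chartAt E x₀).target) (c : ℂ) (v : E) :
    chartDeriv E x₀ y (c • v) = c • chartDeriv E x₀ y v := by
  rw [chartDeriv_eq_fderiv x₀ hy]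
  have h := contDiffAt_transition ℂ hy (mem_chart_source E ((chartAt E x₀).symm y))
  have h1 := (h.differentiableAt (by simp)).hasFDerivAt.restrictScalars ℝ
  rw [h1.fderiv]
  simp

theorem mdifferentiableAt_chart_symm (x₀ : X) {y : E} (hy : y ∈ (chartAt E x₀).target) :
    MDifferentiableAt 𝓘(ℝ, E) 𝓘(ℝ, E) (chartAt E x₀).symm y :=
  mdifferentiableAt_atlas_symm (chart_mem_atlas E x₀) hy

omit [NormedSpace ℂ E] [IsManifold 𝓘(ℂ, E) ω X] in
theorem eventually_transition {x₀ x₁ : X} {y : E} (hy : y ∈ (chartAt E x₀).target)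
    (hy' : (chartAt E x₀).symm y ∈ (chartAt E x₁).source) :
    ∀ᶠ z in 𝓝 y, z ∈ (chartAt E x₀).target ∧ (chartAt E x₀).symm z ∈ (chartAt E x₁).source := by
  refine Filter.Eventually.and ((chartAt E x₀).open_target.mem_nhds hy) ?_
  exact ((chartAt E x₀).symm.continuousAt hy).eventually ((chartAt E x₁).open_source.mem_nhds hy')

theorem chartDeriv_comp_fderiv {x₀ x₁ : X} {y : E} (hy : y ∈ (chartAt E x₀).target)
    (hy' : (chartAt E x₀).symm y ∈ (chartAt E x₁).source) :
    chartDeriv E x₁ (transition E x₀ x₁ y) ∘L fderiv ℝ (transition E x₀ x₁) y =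
      chartDeriv E x₀ y := by
  have h1 : transition E x₀ x₁ y ∈ (chartAt E x₁).target := (chartAt E x₁).map_source hy'
  have h2 := (mdifferentiableAt_chart_symm x₁ h1).hasMFDerivAt
  have h3 := ((contDiffAt_transition ℝ hy hy').differentiableAt (by simp)).hasFDerivAt.hasMFDerivAt
  have h4 := h2.comp y h3
  have h5 : (chartAt E x₀).symm =ᶠ[𝓝 y] (chartAt E x₁).symm ∘ transition E x₀ x₁ := by
    filter_upwards [eventually_transition hy hy'] with z hz
    exact ((chartAt E x₁).left_inv hz.2).symm
  exact (h4.congr_of_eventuallyEq h5).mfderiv.symm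

theorem chartDeriv_self (x : X) : chartDeriv E x (chartAt E x x) = ContinuousLinearMap.id ℝ E := by
  rw [chartDeriv_eq_fderiv x (mem_chart_target E x)]
  have h : transition E x ((chartAt E x).symm (chartAt E x x)) =ᶠ[𝓝 (chartAt E x x)] id := by
    filter_upwards [(chartAt E x).open_target.mem_nhds (mem_chart_target E x)] with z hz
    rw [(chartAt E x).left_inv (mem_chart_source E x)]
    exact (chartAt E x).right_inv hz
  rw [h.fderiv_eq, fderiv_id]

theorem mfderiv_chart_self (x : X) :
    (mfderiv 𝓘(ℝ, E) 𝓘(ℝ, E) (chartAt E x) x : E →L[ℝ] E) = ContinuousLinearMap.id ℝ E := by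
  have h := (mdifferentiable_chart (I := 𝓘(ℝ, E)) x).symm_comp_deriv (mem_chart_source E x)
  have h1 := chartDeriv_self (E := E) x
  rw [chartDeriv] at h1
  ext v
  have h2 := DFunLike.congr_fun h v
  have h3 := DFunLike.congr_fun h1 (mfderiv 𝓘(ℝ, E) 𝓘(ℝ, E) (chartAt E x) x v : E)
  exact h3.symm.trans h2

theorem chartRep_transition {k : ℕ} (α : Form E X k) {x₀ x₁ : X} {y : E}
    (hy : y ∈ (chartAt E x₀).target)
    (hy' : (chartAt E x₀).symm y ∈ (chartAt E x₁).source) :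
    chartRep α x₀ y = (chartRep α x₁ (transition E x₀ x₁ y)).compContinuousLinearMap
      (fderiv ℝ (transition E x₀ x₁) y) := by
  have h := chartDeriv_comp_fderiv hy hy'
  change (α ((chartAt E x₀).symm y)).compContinuousLinearMap (chartDeriv E x₀ y) =
    ((α ((chartAt E x₁).symm (transition E x₀ x₁ y))).compContinuousLinearMap
      (chartDeriv E x₁ _)).compContinuousLinearMap _
  rw [← h]
  have h1 : (chartAt E x₁).symm (transition E x₀ x₁ y) = (chartAt E x₀).symm y :=
    (chartAt E x₁).left_inv hy'
  rw [h1]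
  rfl

theorem chartRep_self {k : ℕ} (α : Form E X k) (x : X) :
    chartRep α x (chartAt E x x) = α x := by
  change (α ((chartAt E x).symm _)).compContinuousLinearMap (chartDeriv E x _) = _
  rw [chartDeriv_self, (chartAt E x).left_inv (mem_chart_source E x)]
  rfl

theorem dForm_apply {k : ℕ} (α : Form E X k) (x : X) :
    dForm α x = extDeriv (chartRep α x) (chartAt E x x) := by
  rw [dForm, mfderiv_chart_self]
  rfl

omit [IsManifold 𝓘(ℂ, E) ω X] in
theorem IsSmoothForm.contDiffAt {k : ℕ} {α : Form E X k} (hα : IsSmoothForm α) (x₀ : X) {y : E}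
    (hy : y ∈ (chartAt E x₀).target) : ContDiffAt ℝ ∞ (chartRep α x₀) y :=
  (hα x₀).contDiffAt ((chartAt E x₀).open_target.mem_nhds hy)

/-- `dForm` uses a different chart at each point. Naturality of the exterior derivative under
transition maps shows that a single chart computes it on its whole target. -/
theorem chartRep_dForm {k : ℕ} {α : Form E X k} (hα : IsSmoothForm α) (x₀ : X) {y : E}
    (hy : y ∈ (chartAt E x₀).target) : chartRep (dForm α) x₀ y = extDeriv (chartRep α x₀) y := by
  set x₁ := (chartAt E x₀).symm y with hx₁
  have hy' : x₁ ∈ (chartAt E x₁).source := mem_chart_source E x₁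
  have h1 : transition E x₀ x₁ y = chartAt E x₁ x₁ := rfl
  rw [chartRep_transition (dForm α) hy hy', h1, chartRep_self, dForm_apply]
  have h2 : chartRep α x₀ =ᶠ[𝓝 y] fun z => (chartRep α x₁ (transition E x₀ x₁ z)).compContinuousLinearMap
      (fderiv ℝ (transition E x₀ x₁) z) := by
    filter_upwards [eventually_transition hy hy'] with z hz
    exact chartRep_transition α hz.1 hz.2
  rw [h2.extDeriv_eq, extDeriv_pullback (r := ω) _ (contDiffAt_transition ℝ hy hy') le_top, h1]
  rw [h1]
  exact (hα.contDiffAt x₁ (mem_chart_target E x₁)).differentiableAt (by simp)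

theorem IsSmoothForm.dForm {k : ℕ} {α : Form E X k} (hα : IsSmoothForm α) :
    IsSmoothForm (dForm α) := by
  intro x₀
  refine ContDiffOn.congr (f := extDeriv (chartRep α x₀)) (fun y hy => ?_)
    fun y hy => chartRep_dForm hα x₀ hy
  refine ContDiffAt.contDiffWithinAt ?_
  have h := (hα.contDiffAt x₀ hy).fderiv_right (m := ∞) (by simp)
  exact (ContinuousAlternatingMap.alternatizeUncurryFinCLM ℝ E ℂ).contDiff.contDiffAt.comp y h

theorem dForm_dForm {k : ℕ} {α : Form E X k} (hα : IsSmoothForm α) : dForm (dForm α) = 0 := by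
  funext x
  rw [dForm_apply]
  have h : chartRep (KahlerIdentities.dForm α) x =ᶠ[𝓝 (chartAt E x x)] extDeriv (chartRep α x) := by
    filter_upwards [(chartAt E x).open_target.mem_nhds (mem_chart_target E x)] with z hz
    exact chartRep_dForm hα x hz
  rw [h.extDeriv_eq]
  exact extDeriv_extDeriv_apply (hα.contDiffAt x (mem_chart_target E x)) (by
    simp only [minSmoothness_of_isRCLikeNormedField]; exact WithTop.coe_le_coe.2 le_top)

variable [FiniteDimensional ℂ E]

/-- It suffices to look at the centre of each preferred chart, as the remaining points of a chart
are reached by transition maps. Adapted frames give information only near such a centre. -/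
theorem isSmoothForm_of_contDiffAt {k : ℕ} {α : Form E X k}
    (h : ∀ x, ContDiffAt ℝ ∞ (chartRep α x) (chartAt E x x)) : IsSmoothForm α := by
  intro x₀ y hy
  refine ContDiffAt.contDiffWithinAt ?_
  set x₁ := (chartAt E x₀).symm y with hx₁
  have hy' : x₁ ∈ (chartAt E x₁).source := mem_chart_source E x₁
  have h2 : chartRep α x₀ =ᶠ[𝓝 y] fun z => (chartRep α x₁ (transition E x₀ x₁ z)).compContinuousLinearMap
      (fderiv ℝ (transition E x₀ x₁) z) := by
    filter_upwards [eventually_transition hy hy'] with z hz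
    exact chartRep_transition α hz.1 hz.2
  have h3 : ContDiffAt ℝ ω (transition E x₀ x₁) y := contDiffAt_transition ℝ hy hy'
  refine (contDiffAt_compContinuousLinearMap ?_ ?_).congr_of_eventuallyEq h2
  · exact ContDiffAt.comp (f := transition E x₀ x₁) y (h x₁) (h3.of_le le_top)
  · exact h3.fderiv_right (by simp)

end Charts

end

/-! ### The metric in charts, and adapted frames for a Kähler metric. -/

section

set_option maxSynthPendingDepth 3

section MetricInCharts

open scoped Topology
open Bundle

variable {E : Type*} [NormedAddCommGroup E] [NormedSpace ℂ E]
  {X : Type*} [TopologicalSpace X] [ChartedSpace E X] [IsManifold 𝓘(ℂ, E) ω X]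

/-- The coordinate vector fields of a chart are smooth. -/
theorem contMDiffAt_coordinate_field (x₀ : X) (u : E) {x : X} (hx : x ∈ (chartAt E x₀).source) :
    ContMDiffAt 𝓘(ℝ, E) (𝓘(ℝ, E).prod 𝓘(ℝ, E)) ∞ (fun z : X =>
      TotalSpace.mk' E (E := (TangentSpace 𝓘(ℝ, E) : X → Type _)) z
        (chartDeriv E x₀ (chartAt E x₀ z) u)) x := by
  refine ((trivializationAt E (TangentSpace 𝓘(ℝ, E) : X → Type _) x₀).contMDiffAt_section_iff
    (by simpa using hx)).2 ?_
  refine (contMDiffAt_const (c := u)).congr_of_eventuallyEq ?_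
  filter_upwards [(chartAt E x₀).open_source.mem_nhds hx] with z hz
  have h1 := congrFun ((trivializationAt E (TangentSpace 𝓘(ℝ, E) : X → Type _)
    x₀).coe_linearMapAt_of_mem (R := ℝ) (b := z) (by simpa using hz))
    (chartDeriv E x₀ (chartAt E x₀ z) u)
  have h2 := TangentBundle.continuousLinearMapAt_trivializationAt (I := 𝓘(ℝ, E)) hz
  refine h1.symm.trans ((DFunLike.congr_fun h2 (chartDeriv E x₀ (chartAt E x₀ z) u)).trans ?_)
  have h := (mdifferentiable_chart (I := 𝓘(ℝ, E)) x₀).comp_symm_deriv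
    ((chartAt E x₀).map_source hz)
  rw [(chartAt E x₀).left_inv hz] at h
  exact DFunLike.congr_fun h u

variable (g : HermitianMetric E X)

/-- The expression of the metric in the chart at `x₀`. -/
def HermitianMetric.chartRep (x₀ : X) (y : E) : E →L[ℝ] E →L[ℝ] ℝ :=
  (g.fibre ((chartAt E x₀).symm y)).inner.bilinearComp (chartDeriv E x₀ y) (chartDeriv E x₀ y)

theorem HermitianMetric.chartRep_apply (x₀ : X) (y u v : E) : g.chartRep x₀ y u v =
    (g.fibre ((chartAt E x₀).symm y)).inner (chartDeriv E x₀ y u) (chartDeriv E x₀ y v) := rfl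

theorem HermitianMetric.contDiffAt_chartRep_apply (x₀ : X) {y : E}
    (hy : y ∈ (chartAt E x₀).target) (u v : E) :
    ContDiffAt ℝ ∞ (fun z => g.chartRep x₀ z u v) y := by
  set x := (chartAt E x₀).symm y with hx
  have hxs : x ∈ (chartAt E x₀).source := (chartAt E x₀).map_target hy
  have h1 : ContMDiffAt 𝓘(ℝ, E) (𝓘(ℝ, E).prod 𝓘(ℝ)) ∞ (fun z : X =>
      TotalSpace.mk' ℝ (E := Bundle.Trivial X ℝ) z (g.inner z
        (chartDeriv E x₀ (chartAt E x₀ z) u) (chartDeriv E x₀ (chartAt E x₀ z) v))) x := by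
    apply ContMDiffAt.clm_bundle_apply₂ (F₁ := E) (F₂ := E)
    · exact g.contMDiff x
    · exact contMDiffAt_coordinate_field x₀ u hxs
    · exact contMDiffAt_coordinate_field x₀ v hxs
  simp only [contMDiffAt_totalSpace] at h1
  have h2 : ContMDiffAt 𝓘(ℝ, E) 𝓘(ℝ, E) ∞ (chartAt E x₀).symm y :=
    (contMDiffOn_chart_symm (n := ∞) (I := 𝓘(ℝ, E)) (x := x₀)).contMDiffAt
      ((chartAt E x₀).open_target.mem_nhds hy)
  have h3 := (h1.2.comp y h2).contDiffAt
  refine h3.congr_of_eventuallyEq ?_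
  filter_upwards [(chartAt E x₀).open_target.mem_nhds hy] with z hz
  change _ = g.inner _ (chartDeriv E x₀ (chartAt E x₀ ((chartAt E x₀).symm z)) u)
    (chartDeriv E x₀ (chartAt E x₀ ((chartAt E x₀).symm z)) v)
  rw [(chartAt E x₀).right_inv hz]
  rfl

variable [FiniteDimensional ℂ E]

theorem HermitianMetric.contDiffAt_chartRep (x₀ : X) {y : E}
    (hy : y ∈ (chartAt E x₀).target) : ContDiffAt ℝ ∞ (g.chartRep x₀) y := by
  have : FiniteDimensional ℝ E := FiniteDimensional.complexToReal E
  have h : ContDiffOn ℝ ∞ (g.chartRep x₀) (chartAt E x₀).target := by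
    refine contDiffOn_clm_apply.2 fun u => contDiffOn_clm_apply.2 fun v z hz => ?_
    exact (g.contDiffAt_chartRep_apply x₀ hz u v).contDiffWithinAt
  exact h.contDiffAt ((chartAt E x₀).open_target.mem_nhds hy)

/-- The Kähler condition in a chart. -/
theorem HermitianMetric.IsKahler.fderiv_chartRep {g : HermitianMetric E X} (hg : g.IsKahler) (p : X)
    (a b c : E) :
    fderiv ℝ (g.chartRep p) (chartAt E p p) a (Complex.I • b) c +
      fderiv ℝ (g.chartRep p) (chartAt E p p) b (Complex.I • c) a +
      fderiv ℝ (g.chartRep p) (chartAt E p p) c (Complex.I • a) b = 0 := by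
  set y₀ := chartAt E p p with hy₀
  have hy : y₀ ∈ (chartAt E p).target := mem_chart_target E p
  have hG := (g.contDiffAt_chartRep p hy).differentiableAt (by simp)
  have hω : ∀ v : Fin 2 → E, (fun z => KahlerIdentities.chartRep g.fundForm p z v) =ᶠ[𝓝 y₀]
      fun z => ((g.chartRep p z (Complex.I • v 0) (v 1) : ℝ) : ℂ) := by
    intro v
    filter_upwards [(chartAt E p).open_target.mem_nhds hy] with z hz
    rw [g.chartRep_apply, chartDeriv_smul p hz]
    rfl
  have hωd : ∀ v : Fin 2 → E, HasFDerivAt (fun z => KahlerIdentities.chartRep g.fundForm p z v)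
      (Complex.ofRealCLM ∘L ((fderiv ℝ (g.chartRep p) y₀).flip (Complex.I • v 0)).flip (v 1)) y₀ := by
    intro v
    refine HasFDerivAt.congr_of_eventuallyEq ?_ (hω v)
    have h1 := (hG.hasFDerivAt.clm_apply (hasFDerivAt_const (Complex.I • v 0) y₀)).clm_apply
      (hasFDerivAt_const (v 1) y₀)
    have h2 := Complex.ofRealCLM.hasFDerivAt.comp y₀ h1
    convert! h2 using 1
    ext w; simp
  have hdiff : DifferentiableAt ℝ (KahlerIdentities.chartRep g.fundForm p) y₀ := by
    refine ContDiffAt.differentiableAt (n := ∞) (contDiffAt_alt fun v => ?_) (by simp)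
    refine ContDiffAt.congr_of_eventuallyEq ?_ (hω v)
    exact Complex.ofRealCLM.contDiff.contDiffAt.comp y₀ (g.contDiffAt_chartRep_apply p hy _ _)
  have h1 : extDeriv (KahlerIdentities.chartRep g.fundForm p) y₀ ![a, b, c] = 0 := by
    rw [← dForm_apply, show dForm g.fundForm = 0 from hg]
    rfl
  -- The middle term of the exterior derivative carries a minus sign and the arguments `(a, c)`;
  -- exchanging them gives the cyclic sum.
  have hanti : HasFDerivAt (fun z => KahlerIdentities.chartRep g.fundForm p z ![a, c])
      (-(Complex.ofRealCLM ∘L ((fderiv ℝ (g.chartRep p) y₀).flip (Complex.I • c)).flip a)) y₀ := by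
    have h2 := (hωd ![c, a]).neg
    convert! h2 using 1
    funext z
    have h3 := (KahlerIdentities.chartRep g.fundForm p z).map_swap ![c, a]
      (i := 0) (j := 1) (by simp)
    refine Eq.trans ?_ h3
    change _ = KahlerIdentities.chartRep g.fundForm p z _
    congr 1
    funext i
    fin_cases i <;> simp
  rw [extDeriv_apply hdiff] at h1
  erw [Fin.sum_univ_three] at h1
  have e0 : (0 : Fin 3).removeNth ![a, b, c] = ![b, c] := by
    funext i; fin_cases i <;> rfl
  have e1 : (1 : Fin 3).removeNth ![a, b, c] = ![a, c] := by
    funext i; fin_cases i <;> rfl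
  have e2 : (2 : Fin 3).removeNth ![a, b, c] = ![a, b] := by
    funext i; fin_cases i <;> rfl
  rw [e0, e1, e2, (hωd ![b, c]).fderiv, hanti.fderiv, (hωd ![a, b]).fderiv] at h1
  simp at h1
  exact_mod_cast h1

/-- A family of complex-linear maps `A y`, defined near `φ(p)` in the chart `φ` at `p`, which
trivialises the metric and osculates to first order. -/
structure HermitianMetric.IsAdapted (g : HermitianMetric E X) (p : X) (A : E → E →L[ℝ] E) :
    Prop where
  contDiffAt : ContDiffAt ℝ ∞ A (chartAt E p p)
  apply_self : A (chartAt E p p) = ContinuousLinearMap.id ℝ E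
  isIso : ∀ᶠ y in 𝓝 (chartAt E p p), (g.fibre p).IsIso (g.fibre ((chartAt E p).symm y))
    (chartDeriv E p y ∘L A y)
  symm : ∀ u v, fderiv ℝ A (chartAt E p p) u v = fderiv ℝ A (chartAt E p p) v u

theorem HermitianMetric.IsKahler.exists_isAdapted {g : HermitianMetric E X} (hg : g.IsKahler)
    (p : X) : ∃ A, g.IsAdapted p A := by
  have : FiniteDimensional ℝ E := FiniteDimensional.complexToReal E
  have hy := mem_chart_target E p
  have hmem : ∀ᶠ y in 𝓝 (chartAt E p p), y ∈ (chartAt E p).target :=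
    (chartAt E p).open_target.mem_nhds hy
  obtain ⟨A, hA, hA0, hiso, hcl⟩ := exists_adapted_frame (g.fibre p) (g.chartRep p) (chartAt E p p)
    (g.contDiffAt_chartRep p hy) (by
      ext u v
      rw [g.chartRep_apply, chartDeriv_self, (chartAt E p).left_inv (mem_chart_source E p)]
      rfl)
    (Filter.Eventually.of_forall fun y u v => (g.fibre _).symm _ _)
    (hmem.mono fun y hy u v => by
      rw [g.chartRep_apply, chartDeriv_smul p hy, chartDeriv_smul p hy, (g.fibre _).J_isometry]
      rfl)
  refine ⟨A, hA, hA0, ?_, hcl (hg.fderiv_chartRep p)⟩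
  filter_upwards [hiso, hmem] with y h1 h2
  have hsmul : ∀ (c : ℂ) v, A y (c • v) = c • A y v := by
    intro c v
    rw [← Complex.re_add_im c, add_smul, add_smul, mul_smul, mul_smul, map_add, Complex.coe_smul,
      Complex.coe_smul, Complex.coe_smul, Complex.coe_smul, map_smul, map_smul, h1.2]
  have hinner : ∀ u v, (g.fibre ((chartAt E p).symm y)).inner ((chartDeriv E p y ∘L A y) u)
    ((chartDeriv E p y ∘L A y) v) = (g.fibre p).inner u v := fun u v => h1.1 u v
  refine ⟨fun c v => ?_, hinner, ?_⟩
  · simp [hsmul, chartDeriv_smul p h2]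
  -- Preserving the scalar product gives injectivity, and in finite dimension surjectivity follows.
  · refine LinearMap.surjective_of_injective (f := (chartDeriv E p y ∘L A y).toLinearMap)
      fun u v huv => (g.fibre p).ext_inner fun w => ?_
    rw [← hinner, ← hinner]
    exact congrArg (fun z => (g.fibre ((chartAt E p).symm y)).inner z _) huv

end MetricInCharts

end

/-! ### Commutation relations by type: the symbols of the Kähler identities. -/

section

set_option maxSynthPendingDepth 3

section Symbols

variable {V : Type*} [NormedAddCommGroup V] [NormedSpace ℂ V] (h : HermInner V)

namespace HermInner

/-- Exterior multiplication by the component of type `(1, 0)` of `g(v, ·)`. -/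
def extHol (v : V) : Module.End ℂ (GA V) := extMul (holPart (h.flat v))

/-- Exterior multiplication by the component of type `(0, 1)` of `g(v, ·)`. -/
def extAntihol (v : V) : Module.End ℂ (GA V) := extMul (antiholPart (h.flat v))

/-- Interior multiplication by the component of type `(1, 0)` of `v`. -/
def _root_.KahlerIdentities.intHol (v : V) : Module.End ℂ (GA V) :=
  (2 : ℂ)⁻¹ • (intMul v - Complex.I • intMul (Complex.I • v))

/-- Interior multiplication by the component of type `(0, 1)` of `v`. -/
def _root_.KahlerIdentities.intAntihol (v : V) : Module.End ℂ (GA V) :=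
  (2 : ℂ)⁻¹ • (intMul v + Complex.I • intMul (Complex.I • v))

theorem extHol_eq (v : V) :
    h.extHol v = (2 : ℂ)⁻¹ • (h.ext v + Complex.I • h.ext (Complex.I • v)) := by
  rw [extHol, h.holPart_flat, extMul_smul, extMul_add, extMul_smul]; rfl

theorem extAntihol_eq (v : V) :
    h.extAntihol v = (2 : ℂ)⁻¹ • (h.ext v - Complex.I • h.ext (Complex.I • v)) := by
  rw [extAntihol, h.antiholPart_flat, extMul_smul, sub_eq_add_neg, ← neg_smul, extMul_add,
    extMul_smul, neg_smul, ← sub_eq_add_neg]; rfl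

theorem extHol_add_extAntihol (v : V) : h.extHol v + h.extAntihol v = h.ext v := by
  rw [extHol, extAntihol, ← extMul_add, holPart_add_antiholPart]; rfl

variable [FiniteDimensional ℂ V]

/-- The `(1, 0)` part of `v^♭` is dual to the `(0, 1)` part of `v`, because the scalar product is
extended bilinearly. This is why `∂̄^*` is built from `∂`. -/
theorem starOp_mul_extHol_mul_starOp (v : V) :
    h.starOp * h.extHol v * h.starOp = intAntihol v := by
  rw [extHol_eq, intAntihol, ← h.starOp_mul_ext_mul_starOp v, ← h.starOp_mul_ext_mul_starOp]
  simp only [mul_smul_comm, smul_mul_assoc, mul_add, add_mul]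

theorem starOp_mul_extAntihol_mul_starOp (v : V) :
    h.starOp * h.extAntihol v * h.starOp = intHol v := by
  rw [extAntihol_eq, intHol, ← h.starOp_mul_ext_mul_starOp v, ← h.starOp_mul_ext_mul_starOp]
  simp only [mul_smul_comm, smul_mul_assoc, mul_sub, sub_mul]

omit [FiniteDimensional ℂ V]

variable {ι : Type*} [Fintype ι] {e : ι → V}

theorem lefOp_mul_extHol (v : V) : h.lefOp e * h.extHol v = h.extHol v * h.lefOp e := by
  simp only [extHol_eq, mul_smul_comm, smul_mul_assoc, mul_add, add_mul, lefOp_mul_ext]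

theorem lefOp_mul_extAntihol (v : V) :
    h.lefOp e * h.extAntihol v = h.extAntihol v * h.lefOp e := by
  simp only [extAntihol_eq, mul_smul_comm, smul_mul_assoc, mul_sub, sub_mul, lefOp_mul_ext]

theorem lamOp_mul_intHol (v : V) : lamOp e * intHol v = intHol v * lamOp e := by
  simp only [intHol, mul_smul_comm, smul_mul_assoc, mul_sub, sub_mul, lamOp_mul_intMul]

theorem lamOp_mul_intAntihol (v : V) : lamOp e * intAntihol v = intAntihol v * lamOp e := by
  simp only [intAntihol, mul_smul_comm, smul_mul_assoc, mul_add, add_mul, lamOp_mul_intMul]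

theorem _root_.KahlerIdentities.I_smul_I_smul {M : Type*} [AddCommGroup M] [Module ℂ M] (v : M) :
    Complex.I • Complex.I • v = -v := by
  rw [smul_smul, Complex.I_mul_I, neg_one_smul]

variable {h}

/-- The symbol of `[Λ, ∂̄] = -i ∂^*`, since `∂^*` has symbol `-ι(v^{1,0})`. It is the `(0, 1)` part
of `[Λ, v^♭ ∧] = ι_{J v}`. -/
theorem IsFrame.lamOp_mul_extAntihol (he : h.IsFrame e) (v : V) :
    lamOp e * h.extAntihol v = h.extAntihol v * lamOp e + Complex.I • intHol v := by
  simp only [extAntihol_eq, intHol, mul_smul_comm, smul_mul_assoc, mul_sub, sub_mul,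
    he.lamOp_mul_ext, I_smul_I_smul, intMul_neg, smul_sub, smul_add, smul_neg,
    smul_comm Complex.I (2 : ℂ)⁻¹]
  abel

theorem IsFrame.lamOp_mul_extHol (he : h.IsFrame e) (v : V) :
    lamOp e * h.extHol v = h.extHol v * lamOp e - Complex.I • intAntihol v := by
  simp only [extHol_eq, intAntihol, mul_smul_comm, smul_mul_assoc, mul_add, add_mul,
    he.lamOp_mul_ext, I_smul_I_smul, intMul_neg, smul_add, smul_neg,
    smul_comm Complex.I (2 : ℂ)⁻¹]
  abel

/-- The symbol of `[∂̄^*, L] = i ∂`; the sign of `∂̄^*` turns the minus into a plus. -/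
theorem IsFrame.intAntihol_mul_lefOp (he : h.IsFrame e) (v : V) :
    intAntihol v * h.lefOp e = h.lefOp e * intAntihol v - Complex.I • h.extHol v := by
  simp only [extHol_eq, intAntihol, mul_smul_comm, smul_mul_assoc, mul_add, add_mul,
    he.intMul_mul_lefOp, I_smul_I_smul, h.ext_neg, smul_add, smul_neg,
    smul_comm Complex.I (2 : ℂ)⁻¹]
  abel

theorem IsFrame.intHol_mul_lefOp (he : h.IsFrame e) (v : V) :
    intHol v * h.lefOp e = h.lefOp e * intHol v + Complex.I • h.extAntihol v := by
  simp only [extAntihol_eq, intHol, mul_smul_comm, smul_mul_assoc, mul_sub, sub_mul,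
    he.intMul_mul_lefOp, I_smul_I_smul, h.ext_neg, smul_sub, smul_add, smul_neg,
    smul_comm Complex.I (2 : ℂ)⁻¹]
  abel

end HermInner

end Symbols

/-! ### Covariant derivatives in an adapted frame. -/

section Jets

open scoped Topology

variable {E : Type*} [NormedAddCommGroup E] [NormedSpace ℂ E]
  {X : Type*} [TopologicalSpace X] [ChartedSpace E X]

/-- The value of a form at a point. -/
def valueAt (α : GForm E X) (x : X) : GA E := ⟨fun k => α k x⟩

omit [TopologicalSpace X] [ChartedSpace E X] in
@[simp] theorem valueAt_apply (α : GForm E X) (x : X) (k : ℕ) : valueAt α x k = α k x := rfl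

/-- A form in the chart at `p` and the frame `A`. -/
def adaptedRep (A : E → E →L[ℝ] E) (p : X) (α : GForm E X) (y : E) : GA E :=
  pull (A y) ⟨fun k => chartRep (α k) p y⟩

/-- The covariant derivative of a form at `p`, computed in an adapted frame. -/
def jet (A : E → E →L[ℝ] E) (p : X) (v : E) (α : GForm E X) : GA E :=
  ⟨fun k => fderiv ℝ (fun y => adaptedRep A p α y k) (chartAt E p p) v⟩

theorem adaptedRep_eq (A : E → E →L[ℝ] E) (p : X) (α : GForm E X) (y : E) :
    adaptedRep A p α y =
      pull (chartDeriv E p y ∘L A y) (valueAt α ((chartAt E p).symm y)) := rfl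

variable [IsManifold 𝓘(ℂ, E) ω X] {g : HermitianMetric E X}

/-- The action on forms of operators on the exterior algebra of a Hermitian vector space. -/
def HermitianMetric.act (g : HermitianMetric E X) (T : HermInner E → Module.End ℂ (GA E))
    (α : GForm E X) : GForm E X :=
  fun k x => T (g.fibre x) (valueAt α x) k

variable [FiniteDimensional ℂ E] {A : E → E →L[ℝ] E} {p : X}

theorem HermitianMetric.IsAdapted.contDiffAt_adaptedRep (hA : g.IsAdapted p A) {α : GForm E X}
    (hα : IsSmooth α) (k : ℕ) :
    ContDiffAt ℝ ∞ (fun y => adaptedRep A p α y k) (chartAt E p p) :=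
  contDiffAt_compContinuousLinearMap ((hα k).contDiffAt p (mem_chart_target E p)) hA.contDiffAt

theorem HermitianMetric.IsAdapted.differentiableAt_adaptedRep (hA : g.IsAdapted p A)
    {α : GForm E X} (hα : IsSmooth α) (k : ℕ) :
    DifferentiableAt ℝ (fun y => adaptedRep A p α y k) (chartAt E p p) :=
  (hA.contDiffAt_adaptedRep hα k).differentiableAt (by simp)

variable {T : HermInner E → Module.End ℂ (GA E)}

omit [FiniteDimensional ℂ E] in
theorem HermitianMetric.IsAdapted.adaptedRep_act (hA : g.IsAdapted p A) (hT : IsNatural T)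
    (α : GForm E X) : ∀ᶠ y in 𝓝 (chartAt E p p),
      adaptedRep A p (g.act T α) y = T (g.fibre p) (adaptedRep A p α y) := by
  filter_upwards [hA.isIso] with y hy
  rw [adaptedRep_eq, adaptedRep_eq]
  exact LinearMap.congr_fun (hT _ _ _ hy) (valueAt α ((chartAt E p).symm y))

/-- Operators that are natural for Hermitian isometries are parallel. -/
theorem HermitianMetric.IsAdapted.jet_act (hA : g.IsAdapted p A) (hT : IsNatural T)
    {α : GForm E X} (hα : IsSmooth α) (v : E) :
    jet A p v (g.act T α) = T (g.fibre p) (jet A p v α) := by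
  ext1 k
  have h : (fun y => adaptedRep A p (g.act T α) y k) =ᶠ[𝓝 (chartAt E p p)]
      fun y => T (g.fibre p) (adaptedRep A p α y) k :=
    (hA.adaptedRep_act hT α).mono fun y hy => congrArg (fun β : GA E => β k) hy
  change fderiv ℝ _ _ v = _
  rw [h.fderiv_eq, fderiv_end_apply _ (hA.differentiableAt_adaptedRep hα)]
  rfl

/-- In the adapted frame the operator is the fixed one at `p`, so it preserves smoothness; pulling
back by the inverse of `A`, which exists near the centre, returns to the chart. In this way no
smoothness of the arbitrarily chosen orthonormal bases is needed. -/
theorem HermitianMetric.IsAdapted.contDiffAt_chartRep_act (hA : g.IsAdapted p A)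
    (hT : IsNatural T) {α : GForm E X} (hα : IsSmooth α) (k : ℕ) :
    ContDiffAt ℝ ∞ (KahlerIdentities.chartRep (g.act T α k) p) (chartAt E p p) := by
  have : FiniteDimensional ℝ E := FiniteDimensional.complexToReal E
  have : CompleteSpace E := FiniteDimensional.complete ℝ E
  have h1 : ContDiffAt ℝ ∞ (fun y => adaptedRep A p (g.act T α) y k) (chartAt E p p) := by
    refine (contDiffAt_end_apply (T (g.fibre p)) (hA.contDiffAt_adaptedRep hα)
      k).congr_of_eventuallyEq ?_
    exact (hA.adaptedRep_act hT α).mono fun y hy => congrArg (fun β : GA E => β k) hy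
  have hinv : ContDiffAt ℝ ∞ (Ring.inverse : (E →L[ℝ] E) → E →L[ℝ] E) (A (chartAt E p p)) := by
    rw [hA.apply_self]
    exact contDiffAt_ringInverse ℝ (1 : (E →L[ℝ] E)ˣ)
  have h2 : ContDiffAt ℝ ∞ (fun y => Ring.inverse (A y)) (chartAt E p p) :=
    ContDiffAt.comp (f := A) _ hinv hA.contDiffAt
  have hunit : ∀ᶠ y in 𝓝 (chartAt E p p), IsUnit (A y) := by
    refine hA.contDiffAt.continuousAt.eventually (Units.isOpen.mem_nhds ?_)
    rw [hA.apply_self]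
    exact isUnit_one
  refine (contDiffAt_compContinuousLinearMap h1 h2).congr_of_eventuallyEq ?_
  filter_upwards [hunit] with y hy
  have h3 : A y ∘L Ring.inverse (A y) = ContinuousLinearMap.id ℝ E := Ring.mul_inverse_cancel _ hy
  change _ = (KahlerIdentities.chartRep (g.act T α k) p y).compContinuousLinearMap
    (A y ∘L Ring.inverse (A y))
  rw [h3]
  rfl

theorem HermitianMetric.IsKahler.isSmooth_act (hg : g.IsKahler) (hT : IsNatural T)
    {α : GForm E X} (hα : IsSmooth α) : IsSmooth (g.act T α) := fun k =>
  isSmoothForm_of_contDiffAt fun p =>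
    let ⟨_, hA⟩ := hg.exists_isAdapted p
    hA.contDiffAt_chartRep_act hT hα k

/-- The exterior derivative in terms of the covariant derivative. -/
theorem HermitianMetric.IsAdapted.dForm_eq (hA : g.IsAdapted p A) {α : GForm E X}
    (hα : IsSmooth α) (k : ℕ) : dForm (α k) p =
      ∑ a, extMulHom k ((g.fibre p).flat ((g.fibre p).frame a))
        (jet A p ((g.fibre p).frame a) α k) := by
  have hy := mem_chart_target E p
  set y₀ := chartAt E p p with hy₀
  set D := fderiv ℝ (fun y => adaptedRep A p α y k) y₀ with hD
  have h1 : D = fderiv ℝ (KahlerIdentities.chartRep (α k) p) y₀ +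
      (KahlerIdentities.chartRep (α k) p y₀).fderivCompContinuousLinearMap (A y₀) ∘L
        fderiv ℝ A y₀ := by
    have := fderiv_continuousAlternatingMapCompContinuousLinearMap
      (((hα k).contDiffAt p hy).differentiableAt (by simp))
      (hA.contDiffAt.differentiableAt (by simp))
    refine this.trans ?_
    congr 1
    ext w v
    have h0 : A y₀ = ContinuousLinearMap.id ℝ E := hA.apply_self
    simp [h0]
  have h2 : dForm (α k) p = ContinuousAlternatingMap.alternatizeUncurryFin D := by
    -- Alternation kills the term containing the derivative of `A`, because that derivative is
    -- symmetric: the connection has no torsion.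
    rw [h1, ContinuousAlternatingMap.alternatizeUncurryFin_add,
      ContinuousAlternatingMap.alternatizeUncurryFin_fderivCompContinuousLinearMap_eq_zero _ _
        hA.symm, add_zero, dForm_apply]
    rfl
  have h3 : D = ∑ a, ((g.fibre p).flat ((g.fibre p).frame a)).smulRight
      (D ((g.fibre p).frame a)) := by
    ext w v
    conv_lhs => rw [← (g.fibre p).isFrame_frame w, _root_.map_sum]
    simp
  rw [h2]
  refine (congrArg (ContinuousAlternatingMap.alternatizeUncurryFinCLM ℝ E ℂ) h3).trans ?_
  rw [_root_.map_sum]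
  rfl

omit [FiniteDimensional ℂ E] in
theorem typeProj_sum {k : ℕ} (p q : ℕ) {ι : Type*} (s : Finset ι) (β : ι → Alt E k) :
    typeProj p q (∑ i ∈ s, β i) = ∑ i ∈ s, typeProj p q (β i) :=
  _root_.map_sum (AddMonoidHom.mk' (typeProj p q : Alt E k → Alt E k) (typeProj_add p q)) β s

theorem HermitianMetric.IsAdapted.dForm_typeProj_eq (hA : g.IsAdapted p A) (hg : g.IsKahler)
    {α : GForm E X} (hα : IsSmooth α) (k r s : ℕ) :
    dForm (fun y => typeProj r s (α k y)) p =
      ∑ a, extMulHom k ((g.fibre p).flat ((g.fibre p).frame a))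
        (typeProj r s (jet A p ((g.fibre p).frame a) α k)) := by
  have h := hA.dForm_eq (hg.isSmooth_act (isNatural_typeOp r s) hα) k
  simp_rw [hA.jet_act (isNatural_typeOp r s) hα] at h
  exact h

/-- The projections onto types are natural, hence pass through the covariant derivative, and what
remains is the symbol computed in `sum_typeProj_extMulHom`. -/
theorem HermitianMetric.IsAdapted.valueAt_del (hA : g.IsAdapted p A) (hg : g.IsKahler)
    {α : GForm E X} (hα : IsSmooth α) : valueAt (del α) p =
      ∑ a, (g.fibre p).extHol ((g.fibre p).frame a)
        (jet A p ((g.fibre p).frame a) α) := by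
  ext1 k
  rw [GA.sum_apply]
  cases k with
  | zero => simp [del, HermInner.extHol]
  | succ k =>
    change ∑ pq ∈ Finset.HasAntidiagonal.antidiagonal k, typeProj (pq.1 + 1) pq.2
      (dForm (fun y => typeProj pq.1 pq.2 (α k y)) p) = _
    simp_rw [hA.dForm_typeProj_eq hg hα, typeProj_sum]
    rw [Finset.sum_comm]
    exact Finset.sum_congr rfl fun a _ => sum_typeProj_extMulHom _ _

theorem HermitianMetric.IsAdapted.valueAt_delBar (hA : g.IsAdapted p A) (hg : g.IsKahler)
    {α : GForm E X} (hα : IsSmooth α) : valueAt (delBar α) p =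
      ∑ a, (g.fibre p).extAntihol ((g.fibre p).frame a)
        (jet A p ((g.fibre p).frame a) α) := by
  ext1 k
  rw [GA.sum_apply]
  cases k with
  | zero => simp [delBar, HermInner.extAntihol]
  | succ k =>
    change ∑ pq ∈ Finset.HasAntidiagonal.antidiagonal k, typeProj pq.1 (pq.2 + 1)
      (dForm (fun y => typeProj pq.1 pq.2 (α k y)) p) = _
    simp_rw [hA.dForm_typeProj_eq hg hα, typeProj_sum]
    rw [Finset.sum_comm]
    exact Finset.sum_congr rfl fun a _ => sum_typeProj_extMulHom' _ _

theorem HermitianMetric.IsAdapted.valueAt_d (hA : g.IsAdapted p A)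
    {α : GForm E X} (hα : IsSmooth α) : valueAt (d α) p =
      ∑ a, (g.fibre p).ext ((g.fibre p).frame a) (jet A p ((g.fibre p).frame a) α) := by
  ext1 k
  rw [GA.sum_apply]
  cases k with
  | zero => simp [d, HermInner.ext]
  | succ k => exact hA.dForm_eq hα k

end Jets

end

/-! ### Smooth forms and the adjoint operators. -/

section

set_option maxSynthPendingDepth 3

section Identities

variable {E : Type*} [NormedAddCommGroup E] [NormedSpace ℂ E]
  {X : Type*} [TopologicalSpace X] [ChartedSpace E X]

omit [TopologicalSpace X] [ChartedSpace E X] in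
theorem ext_valueAt {α β : GForm E X} (h : ∀ x, valueAt α x = valueAt β x) : α = β := by
  funext k x
  exact congrArg (fun γ : GA E => γ k) (h x)

omit [TopologicalSpace X] [ChartedSpace E X] in
@[simp] theorem valueAt_add (α β : GForm E X) (x : X) :
    valueAt (α + β) x = valueAt α x + valueAt β x := rfl

omit [TopologicalSpace X] [ChartedSpace E X] in
@[simp] theorem valueAt_sub (α β : GForm E X) (x : X) :
    valueAt (α - β) x = valueAt α x - valueAt β x := rfl

omit [TopologicalSpace X] [ChartedSpace E X] in
@[simp] theorem valueAt_neg (α : GForm E X) (x : X) : valueAt (-α) x = -valueAt α x := rfl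

omit [TopologicalSpace X] [ChartedSpace E X] in
@[simp] theorem valueAt_smul (c : ℂ) (α : GForm E X) (x : X) :
    valueAt (c • α) x = c • valueAt α x := rfl

theorem IsSmooth.add {α β : GForm E X} (hα : IsSmooth α) (hβ : IsSmooth β) : IsSmooth (α + β) :=
  fun k x₀ => (hα k x₀).add (hβ k x₀)

theorem IsSmooth.const_smul {α : GForm E X} (c : ℂ) (hα : IsSmooth α) : IsSmooth (c • α) :=
  fun k x₀ => (hα k x₀).const_smul c

theorem isSmooth_zero : IsSmooth (0 : GForm E X) := fun _ _ => contDiffOn_const (c := 0)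

/-- The space of smooth forms. -/
def smoothForms (E X : Type*) [NormedAddCommGroup E] [NormedSpace ℂ E] [TopologicalSpace X]
    [ChartedSpace E X] : Submodule ℂ (GForm E X) where
  carrier := {α | IsSmooth α}
  zero_mem' := isSmooth_zero
  add_mem' := IsSmooth.add
  smul_mem' c _ := IsSmooth.const_smul c

variable [IsManifold 𝓘(ℂ, E) ω X] {g : HermitianMetric E X}

@[simp] theorem valueAt_act (T : HermInner E → Module.End ℂ (GA E)) (α : GForm E X) (x : X) :
    valueAt (g.act T α) x = T (g.fibre x) (valueAt α x) := rfl

theorem IsSmooth.d {α : GForm E X} (hα : IsSmooth α) : IsSmooth (d α)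
  | 0 => isSmooth_zero 0
  | k + 1 => (hα k).dForm

theorem d_d {α : GForm E X} (hα : IsSmooth α) : d (d α) = 0 := by
  funext k
  match k with
  | 0 => rfl
  | 1 =>
    funext x
    change dForm (0 : Form E X 0) x = 0
    rw [dForm_apply]
    have : chartRep (0 : Form E X 0) x = 0 := rfl
    rw [this, extDeriv]
    simp only [fderiv_zero, Pi.zero_apply]
    exact (ContinuousAlternatingMap.alternatizeUncurryFinCLM ℝ E ℂ).map_zero
  | k + 2 => exact dForm_dForm (hα k)

variable [FiniteDimensional ℂ E]

theorem HermitianMetric.L_eq (α : GForm E X) : g.L α = g.act (fun h => h.lefOp h.frame) α := by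
  funext k x
  exact (g.fibre x).lef_eq _ k

theorem HermitianMetric.Lam_eq (α : GForm E X) :
    g.Lam α = g.act (fun h => HermInner.lamOp h.frame) α := by
  funext k x
  exact (g.fibre x).lam_eq _ k

theorem HermitianMetric.star_eq (α : GForm E X) :
    g.star α = g.act (fun h => h.starOp) α := rfl

namespace HermitianMetric

/-- Treats `∂` and `∂̄` together, with `(a, b) = (1, 0)` and `(0, 1)`. -/
theorem IsKahler.isSmooth_sum_typeProj (hg : g.IsKahler) {α : GForm E X} (hα : IsSmooth α)
    (k a b : ℕ) :
    IsSmoothForm fun x => ∑ pq ∈ Finset.HasAntidiagonal.antidiagonal k,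
      typeProj (pq.1 + a) (pq.2 + b) (dForm (fun y => typeProj pq.1 pq.2 (α k y)) x) := by
  have key (p q r s : ℕ) : IsSmoothForm fun x =>
      typeProj r s (dForm (fun y => typeProj p q (α k y)) x) :=
    hg.isSmooth_act (isNatural_typeOp r s) (hg.isSmooth_act (isNatural_typeOp p q) hα).d (k + 1)
  intro x₀
  have := ContDiffOn.sum (s := Finset.HasAntidiagonal.antidiagonal k) (t := (chartAt E x₀).target)
    fun pq _ => key pq.1 pq.2 (pq.1 + a) (pq.2 + b) x₀
  convert! this using 1
  funext y
  exact _root_.map_sum (ContinuousAlternatingMap.compContinuousLinearMapCLM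
    (chartDeriv E x₀ y)) _ _

theorem IsKahler.isSmooth_del (hg : g.IsKahler) {α : GForm E X} (hα : IsSmooth α) :
    IsSmooth (del α)
  | 0 => isSmooth_zero 0
  | k + 1 => hg.isSmooth_sum_typeProj hα k 1 0

theorem IsKahler.isSmooth_delBar (hg : g.IsKahler) {α : GForm E X} (hα : IsSmooth α) :
    IsSmooth (delBar α)
  | 0 => isSmooth_zero 0
  | k + 1 => hg.isSmooth_sum_typeProj hα k 0 1

theorem IsKahler.isSmooth_L (hg : g.IsKahler) {α : GForm E X} (hα : IsSmooth α) :
    IsSmooth (g.L α) := by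
  rw [g.L_eq]
  exact hg.isSmooth_act HermInner.isNatural_lefOp hα

theorem IsKahler.isSmooth_Lam (hg : g.IsKahler) {α : GForm E X} (hα : IsSmooth α) :
    IsSmooth (g.Lam α) := by
  rw [g.Lam_eq]
  exact hg.isSmooth_act HermInner.isNatural_lamOp hα

theorem IsKahler.isSmooth_star (hg : g.IsKahler) {α : GForm E X} (hα : IsSmooth α) :
    IsSmooth (g.star α) :=
  hg.isSmooth_act HermInner.isNatural_starOp hα

variable {A : E → E →L[ℝ] E} {p : X}

/-- The operator `*` commutes with the covariant derivative, so both factors `*` act on the symbol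
of `∂̄`. -/
theorem IsAdapted.valueAt_delStar (hA : g.IsAdapted p A) (hg : g.IsKahler) {α : GForm E X}
    (hα : IsSmooth α) : valueAt (g.delStar α) p =
      -∑ a, intHol ((g.fibre p).frame a) (jet A p ((g.fibre p).frame a) α) := by
  rw [delStar, valueAt_neg, g.star_eq (delBar _), valueAt_act,
    hA.valueAt_delBar hg (hg.isSmooth_star hα), _root_.map_sum]
  refine congrArg _ (Finset.sum_congr rfl fun a _ => ?_)
  rw [g.star_eq α, hA.jet_act HermInner.isNatural_starOp hα,
    ← (g.fibre p).starOp_mul_extAntihol_mul_starOp]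
  rfl

theorem IsAdapted.valueAt_delBarStar (hA : g.IsAdapted p A) (hg : g.IsKahler) {α : GForm E X}
    (hα : IsSmooth α) : valueAt (g.delBarStar α) p =
      -∑ a, intAntihol ((g.fibre p).frame a) (jet A p ((g.fibre p).frame a) α) := by
  rw [delBarStar, valueAt_neg, g.star_eq (del _), valueAt_act,
    hA.valueAt_del hg (hg.isSmooth_star hα), _root_.map_sum]
  refine congrArg _ (Finset.sum_congr rfl fun a _ => ?_)
  rw [g.star_eq α, hA.jet_act HermInner.isNatural_starOp hα,
    ← (g.fibre p).starOp_mul_extHol_mul_starOp]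
  rfl

theorem IsAdapted.jet_L (hA : g.IsAdapted p A) {α : GForm E X} (hα : IsSmooth α) (v : E) :
    jet A p v (g.L α) = (g.fibre p).lefOp (g.fibre p).frame (jet A p v α) := by
  rw [g.L_eq, hA.jet_act HermInner.isNatural_lefOp hα]

theorem IsAdapted.jet_Lam (hA : g.IsAdapted p A) {α : GForm E X} (hα : IsSmooth α) (v : E) :
    jet A p v (g.Lam α) = HermInner.lamOp (g.fibre p).frame (jet A p v α) := by
  rw [g.Lam_eq, hA.jet_act HermInner.isNatural_lamOp hα]

theorem valueAt_L (α : GForm E X) (x : X) :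
    valueAt (g.L α) x = (g.fibre x).lefOp (g.fibre x).frame (valueAt α x) := by
  rw [g.L_eq, valueAt_act]

theorem valueAt_Lam (α : GForm E X) (x : X) :
    valueAt (g.Lam α) x = HermInner.lamOp (g.fibre x).frame (valueAt α x) := by
  rw [g.Lam_eq, valueAt_act]

end HermitianMetric

end Identities

end

/-! ### The commutation identities. -/

section

set_option maxSynthPendingDepth 3

section End

variable {M : Type*} [AddCommGroup M] [Module ℂ M] {a b c f s : Module.End ℂ M}

theorem apply_apply_of_mul_eq (h : a * b = c * f) (x : M) : a (b x) = c (f x) :=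
  LinearMap.congr_fun h x

theorem apply_apply_of_mul_eq_add {z : ℂ} (h : a * b = c * f + z • s) (x : M) :
    a (b x) = c (f x) + z • s x :=
  LinearMap.congr_fun h x

theorem apply_apply_of_mul_eq_sub {z : ℂ} (h : a * b = c * f - z • s) (x : M) :
    a (b x) = c (f x) - z • s x :=
  LinearMap.congr_fun h x

end End

section Identities

variable {E : Type*} [NormedAddCommGroup E] [NormedSpace ℂ E]
  {X : Type*} [TopologicalSpace X] [ChartedSpace E X]

variable [IsManifold 𝓘(ℂ, E) ω X] {g : HermitianMetric E X} [FiniteDimensional ℂ E]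

namespace HermitianMetric

/-- The pattern of all eight commutators: evaluate at a point in an adapted frame, move `L` or `Λ`
through the covariant derivative, and apply the relation between symbols term by term. -/
theorem IsKahler.comm_L_del (hg : g.IsKahler) {α : GForm E X} (hα : IsSmooth α) :
    comm g.L del α = 0 := by
  refine ext_valueAt fun p => ?_
  obtain ⟨A, hA⟩ := hg.exists_isAdapted p
  rw [comm, valueAt_sub, valueAt_L, hA.valueAt_del hg hα, hA.valueAt_del hg (hg.isSmooth_L hα),
    _root_.map_sum, ← Finset.sum_sub_distrib]
  refine Finset.sum_eq_zero fun a _ => ?_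
  rw [hA.jet_L hα, sub_eq_zero]
  exact apply_apply_of_mul_eq ((g.fibre p).lefOp_mul_extHol _) _

theorem IsKahler.comm_L_delBar (hg : g.IsKahler) {α : GForm E X} (hα : IsSmooth α) :
    comm g.L delBar α = 0 := by
  refine ext_valueAt fun p => ?_
  obtain ⟨A, hA⟩ := hg.exists_isAdapted p
  rw [comm, valueAt_sub, valueAt_L, hA.valueAt_delBar hg hα,
    hA.valueAt_delBar hg (hg.isSmooth_L hα), _root_.map_sum, ← Finset.sum_sub_distrib]
  refine Finset.sum_eq_zero fun a _ => ?_
  rw [hA.jet_L hα, sub_eq_zero]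
  exact apply_apply_of_mul_eq ((g.fibre p).lefOp_mul_extAntihol _) _

theorem IsKahler.comm_Lam_delStar (hg : g.IsKahler) {α : GForm E X} (hα : IsSmooth α) :
    comm g.Lam g.delStar α = 0 := by
  refine ext_valueAt fun p => ?_
  obtain ⟨A, hA⟩ := hg.exists_isAdapted p
  rw [comm, valueAt_sub, valueAt_Lam, hA.valueAt_delStar hg hα,
    hA.valueAt_delStar hg (hg.isSmooth_Lam hα), _root_.map_neg, _root_.map_sum, sub_neg_eq_add,
    neg_add_eq_sub, ← Finset.sum_sub_distrib]
  refine Finset.sum_eq_zero fun a _ => ?_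
  rw [hA.jet_Lam hα, sub_eq_zero]
  exact (apply_apply_of_mul_eq (HermInner.lamOp_mul_intHol _) _).symm

theorem IsKahler.comm_Lam_delBarStar (hg : g.IsKahler) {α : GForm E X} (hα : IsSmooth α) :
    comm g.Lam g.delBarStar α = 0 := by
  refine ext_valueAt fun p => ?_
  obtain ⟨A, hA⟩ := hg.exists_isAdapted p
  rw [comm, valueAt_sub, valueAt_Lam, hA.valueAt_delBarStar hg hα,
    hA.valueAt_delBarStar hg (hg.isSmooth_Lam hα), _root_.map_neg, _root_.map_sum, sub_neg_eq_add,
    neg_add_eq_sub, ← Finset.sum_sub_distrib]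
  refine Finset.sum_eq_zero fun a _ => ?_
  rw [hA.jet_Lam hα, sub_eq_zero]
  exact (apply_apply_of_mul_eq (HermInner.lamOp_mul_intAntihol _) _).symm

theorem IsKahler.comm_Lam_delBar (hg : g.IsKahler) {α : GForm E X} (hα : IsSmooth α) :
    comm g.Lam delBar α = -Complex.I • g.delStar α := by
  refine ext_valueAt fun p => ?_
  obtain ⟨A, hA⟩ := hg.exists_isAdapted p
  rw [comm, valueAt_sub, valueAt_Lam, valueAt_smul, hA.valueAt_delBar hg hα,
    hA.valueAt_delBar hg (hg.isSmooth_Lam hα), hA.valueAt_delStar hg hα, smul_neg, neg_smul,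
    neg_neg, _root_.map_sum, ← Finset.sum_sub_distrib, Finset.smul_sum]
  refine Finset.sum_congr rfl fun a _ => ?_
  rw [hA.jet_Lam hα, apply_apply_of_mul_eq_add ((g.fibre p).isFrame_frame.lamOp_mul_extAntihol _),
    add_sub_cancel_left]

theorem IsKahler.comm_Lam_del (hg : g.IsKahler) {α : GForm E X} (hα : IsSmooth α) :
    comm g.Lam del α = Complex.I • g.delBarStar α := by
  refine ext_valueAt fun p => ?_
  obtain ⟨A, hA⟩ := hg.exists_isAdapted p
  rw [comm, valueAt_sub, valueAt_Lam, valueAt_smul, hA.valueAt_del hg hα,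
    hA.valueAt_del hg (hg.isSmooth_Lam hα), hA.valueAt_delBarStar hg hα, smul_neg,
    _root_.map_sum, ← Finset.sum_sub_distrib, Finset.smul_sum, ← Finset.sum_neg_distrib]
  refine Finset.sum_congr rfl fun a _ => ?_
  rw [hA.jet_Lam hα, apply_apply_of_mul_eq_sub ((g.fibre p).isFrame_frame.lamOp_mul_extHol _),
    sub_sub_cancel_left]

theorem IsKahler.comm_delBarStar_L (hg : g.IsKahler) {α : GForm E X} (hα : IsSmooth α) :
    comm g.delBarStar g.L α = Complex.I • del α := by
  refine ext_valueAt fun p => ?_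
  obtain ⟨A, hA⟩ := hg.exists_isAdapted p
  rw [comm, valueAt_sub, valueAt_L, valueAt_smul, hA.valueAt_del hg hα,
    hA.valueAt_delBarStar hg (hg.isSmooth_L hα), hA.valueAt_delBarStar hg hα, _root_.map_neg,
    _root_.map_sum, sub_neg_eq_add, neg_add_eq_sub, ← Finset.sum_sub_distrib, Finset.smul_sum]
  refine Finset.sum_congr rfl fun a _ => ?_
  rw [hA.jet_L hα, apply_apply_of_mul_eq_sub ((g.fibre p).isFrame_frame.intAntihol_mul_lefOp _),
    sub_sub_cancel]

theorem IsKahler.comm_delStar_L (hg : g.IsKahler) {α : GForm E X} (hα : IsSmooth α) :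
    comm g.delStar g.L α = -Complex.I • delBar α := by
  refine ext_valueAt fun p => ?_
  obtain ⟨A, hA⟩ := hg.exists_isAdapted p
  rw [comm, valueAt_sub, valueAt_L, valueAt_smul, hA.valueAt_delBar hg hα,
    hA.valueAt_delStar hg (hg.isSmooth_L hα), hA.valueAt_delStar hg hα, _root_.map_neg,
    _root_.map_sum, sub_neg_eq_add, neg_add_eq_sub, ← Finset.sum_sub_distrib, Finset.smul_sum]
  refine Finset.sum_congr rfl fun a _ => ?_
  rw [hA.jet_L hα, apply_apply_of_mul_eq_add ((g.fibre p).isFrame_frame.intHol_mul_lefOp _),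
    sub_add_cancel_left, neg_smul]

end HermitianMetric

end Identities

end

/-! ### The Laplacians. -/

section

set_option maxSynthPendingDepth 3

section Laplacians

/-- The identities between the three Laplacians follow formally from `∂² = ∂∂̄ + ∂̄∂ = ∂̄² = 0` and
the expression of `∂^*` and `∂̄^*` as commutators. -/
theorem laplacian_identities {R : Type*} [Ring R] [Algebra ℂ R] {D B S T Λ : R}
    (hD : D * D = 0) (hB : B * B = 0) (hDB : D * B + B * D = 0)
    (hS : Λ * B - B * Λ = -Complex.I • S) (hT : Λ * D - D * Λ = Complex.I • T) :
    D * S + S * D = B * T + T * B ∧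
      D * S + S * D = (1 / 2 : ℂ) • ((D + B) * (S + T) + (S + T) * (D + B)) := by
  have hS' : S = Complex.I • (Λ * B - B * Λ) := by
    rw [hS, smul_smul, mul_neg, Complex.I_mul_I, neg_neg, one_smul]
  have hT' : T = -(Complex.I • (Λ * D - D * Λ)) := by
    rw [hT, smul_smul, Complex.I_mul_I, neg_one_smul, neg_neg]
  have hBD : B * D = -(D * B) := eq_neg_of_add_eq_zero_right hDB
  have h1 : D * S + S * D = B * T + T * B := by
    rw [hS', hT']
    simp only [mul_smul_comm, smul_mul_assoc, mul_neg, neg_mul, ← smul_add, ← smul_neg]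
    congr 1
    have e1 : Λ * B * D = -(Λ * D * B) := by rw [mul_assoc, hBD, mul_neg, mul_assoc]
    have e2 : B * (D * Λ) = -(D * (B * Λ)) := by rw [← mul_assoc, hBD, neg_mul, mul_assoc]
    simp only [mul_sub, sub_mul, e1, e2, mul_assoc]
    abel
  -- The mixed term telescopes: `D(ΛD - DΛ) + (ΛD - DΛ)D` vanishes because `D² = 0`.
  have h2 : D * T + T * D = 0 := by
    rw [hT']
    simp only [mul_smul_comm, smul_mul_assoc, mul_neg, neg_mul, ← smul_add, ← smul_neg]
    rw [mul_sub, sub_mul, ← mul_assoc D D, mul_assoc Λ D D, hD, ← mul_assoc D Λ D]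
    simp
  have h3 : B * S + S * B = 0 := by
    rw [hS']
    simp only [mul_smul_comm, smul_mul_assoc, ← smul_add]
    rw [mul_sub, sub_mul, ← mul_assoc B B, mul_assoc Λ B B, hB, ← mul_assoc B Λ B]
    simp
  refine ⟨h1, ?_⟩
  have h4 : (D + B) * (S + T) + (S + T) * (D + B) =
      (D * S + S * D) + (B * T + T * B) + (D * T + T * D) + (B * S + S * B) := by noncomm_ring
  rw [h4, h2, h3, ← h1, add_zero, add_zero, ← two_smul ℂ, smul_smul]
  norm_num

/-- If the square of `c a + c̄ b` vanishes for all `c ≠ 0`, so does each of its components. -/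
theorem components_of_sq_eq_zero {R : Type*} [Ring R] [Algebra ℂ R] {D B : R}
    (h : ∀ c : ℂ, c ≠ 0 →
      (c • D + starRingEnd ℂ c • B) * (c • D + starRingEnd ℂ c • B) = 0) :
    D * D = 0 ∧ B * B = 0 ∧ D * B + B * D = 0 := by
  have key (c : ℂ) (hc : c ≠ 0) : (c * c) • (D * D) + (c * starRingEnd ℂ c) • (D * B + B * D) +
      (starRingEnd ℂ c * starRingEnd ℂ c) • (B * B) = 0 := by
    rw [← h c hc]
    simp only [add_mul, mul_add, mul_smul_comm, smul_mul_assoc, smul_smul, smul_add]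
    rw [mul_comm (starRingEnd ℂ c) c]
    abel
  -- The values `1`, `i` and `1 + i` of `c` already separate the functions `c²`, `|c|²` and `c̄²`.
  have h1 := key 1 one_ne_zero
  have h2 := key Complex.I Complex.I_ne_zero
  have h3 := key (1 + Complex.I) (by
    intro h; simpa using congrArg Complex.re h)
  have e1 : (1 + Complex.I) * (1 + Complex.I) = 2 * Complex.I := by
    linear_combination Complex.I_sq
  have e2 : (1 + Complex.I) * (1 + -Complex.I) = 2 := by
    linear_combination -Complex.I_sq
  have e3 : (1 + -Complex.I) * (1 + -Complex.I) = -(2 * Complex.I) := by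
    linear_combination Complex.I_sq
  simp only [map_add, map_one, Complex.conj_I, mul_one, one_smul, Complex.I_mul_I, mul_neg,
    neg_neg, neg_mul, e1, e2, e3] at h1 h2 h3
  set x := D * D
  set y := D * B + B * D
  set z := B * B
  have hy : y = 0 := by
    have : (2 : ℂ) • y = 0 := by linear_combination (norm := module) h1 + h2
    exact (smul_eq_zero.1 this).resolve_left two_ne_zero
  rw [hy] at h1 h3
  have hx : x = 0 := by
    have : (4 * Complex.I) • x = 0 := by
      linear_combination (norm := module) h3 + (2 * Complex.I) • h1
    exact (smul_eq_zero.1 this).resolve_left (by simp)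
  have hz : z = 0 := by
    rw [hx] at h1; simpa using h1
  exact ⟨hx, hz, hy⟩

variable {E : Type*} [NormedAddCommGroup E] [NormedSpace ℂ E]
  {X : Type*} [TopologicalSpace X] [ChartedSpace E X] [IsManifold 𝓘(ℂ, E) ω X]
  [FiniteDimensional ℂ E] {g : HermitianMetric E X}

/-- An operator on forms whose restriction to smooth forms is linear. -/
structure IsSmoothLinear (P : GForm E X → GForm E X) : Prop where
  isSmooth : ∀ {α}, IsSmooth α → IsSmooth (P α)
  map_add : ∀ {α β}, IsSmooth α → IsSmooth β → P (α + β) = P α + P β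
  map_smul : ∀ (c : ℂ) {α}, IsSmooth α → P (c • α) = c • P α

omit [IsManifold 𝓘(ℂ, E) ω X] [FiniteDimensional ℂ E] in
/-- The restriction of an operator to smooth forms. -/
def IsSmoothLinear.toEnd {P : GForm E X → GForm E X} (hP : IsSmoothLinear P) :
    Module.End ℂ (smoothForms E X) where
  toFun α := ⟨P α, hP.isSmooth α.2⟩
  map_add' α β := Subtype.ext (hP.map_add α.2 β.2)
  map_smul' c α := Subtype.ext (hP.map_smul c α.2)

namespace HermitianMetric

variable {A : E → E →L[ℝ] E} {p : X}

theorem IsAdapted.jet_add (hA : g.IsAdapted p A) {α β : GForm E X} (hα : IsSmooth α)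
    (hβ : IsSmooth β) (v : E) : jet A p v (α + β) = jet A p v α + jet A p v β := by
  ext1 k
  have h := (hA.differentiableAt_adaptedRep hα k).hasFDerivAt.add
    (hA.differentiableAt_adaptedRep hβ k).hasFDerivAt
  exact DFunLike.congr_fun h.fderiv v

theorem IsAdapted.jet_smul (hA : g.IsAdapted p A) (c : ℂ) {α : GForm E X} (hα : IsSmooth α)
    (v : E) : jet A p v (c • α) = c • jet A p v α := by
  ext1 k
  have h := (hA.differentiableAt_adaptedRep hα k).hasFDerivAt.const_smul c
  exact DFunLike.congr_fun h.fderiv v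

/-- Linearity is read off from the expression by covariant derivatives. It is asserted only on
smooth forms, since additivity of the derivative requires differentiability. -/
theorem IsKahler.isSmoothLinear_of_jet (hg : g.IsKahler) {P : GForm E X → GForm E X}
    (hP : ∀ {α}, IsSmooth α → IsSmooth (P α)) (T : X → E → Module.End ℂ (GA E))
    (hPT : ∀ p A, g.IsAdapted p A → ∀ {α}, IsSmooth α → valueAt (P α) p =
      ∑ a, T p ((g.fibre p).frame a) (jet A p ((g.fibre p).frame a) α)) :
    IsSmoothLinear P where
  isSmooth := hP
  map_add hα hβ := ext_valueAt fun p => by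
    obtain ⟨A, hA⟩ := hg.exists_isAdapted p
    rw [valueAt_add, hPT p A hA hα, hPT p A hA hβ, hPT p A hA (hα.add hβ),
      ← Finset.sum_add_distrib]
    exact Finset.sum_congr rfl fun a _ => by rw [hA.jet_add hα hβ, _root_.map_add]
  map_smul c α hα := ext_valueAt fun p => by
    obtain ⟨A, hA⟩ := hg.exists_isAdapted p
    rw [valueAt_smul, hPT p A hA hα, hPT p A hA (hα.const_smul c), Finset.smul_sum]
    exact Finset.sum_congr rfl fun a _ => by rw [hA.jet_smul c hα, _root_.map_smul]

theorem IsKahler.isSmoothLinear_del (hg : g.IsKahler) :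
    IsSmoothLinear (del : GForm E X → GForm E X) :=
  hg.isSmoothLinear_of_jet hg.isSmooth_del (fun p v => (g.fibre p).extHol v)
    fun _ _ hA _ hα => hA.valueAt_del hg hα

theorem IsKahler.isSmoothLinear_delBar (hg : g.IsKahler) :
    IsSmoothLinear (delBar : GForm E X → GForm E X) :=
  hg.isSmoothLinear_of_jet hg.isSmooth_delBar (fun p v => (g.fibre p).extAntihol v)
    fun _ _ hA _ hα => hA.valueAt_delBar hg hα

theorem IsKahler.isSmooth_delStar (hg : g.IsKahler) {α : GForm E X} (hα : IsSmooth α) :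
    IsSmooth (g.delStar α) := by
  have := (hg.isSmooth_star (hg.isSmooth_delBar (hg.isSmooth_star hα))).const_smul (-1)
  rwa [neg_one_smul] at this

theorem IsKahler.isSmooth_delBarStar (hg : g.IsKahler) {α : GForm E X} (hα : IsSmooth α) :
    IsSmooth (g.delBarStar α) := by
  have := (hg.isSmooth_star (hg.isSmooth_del (hg.isSmooth_star hα))).const_smul (-1)
  rwa [neg_one_smul] at this

theorem IsKahler.isSmoothLinear_delStar (hg : g.IsKahler) : IsSmoothLinear g.delStar :=
  hg.isSmoothLinear_of_jet hg.isSmooth_delStar (fun _ v => -intHol v) fun _ _ hA _ hα => by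
    rw [hA.valueAt_delStar hg hα, ← Finset.sum_neg_distrib]; rfl

theorem IsKahler.isSmoothLinear_delBarStar (hg : g.IsKahler) : IsSmoothLinear g.delBarStar :=
  hg.isSmoothLinear_of_jet hg.isSmooth_delBarStar (fun _ v => -intAntihol v) fun _ _ hA _ hα => by
    rw [hA.valueAt_delBarStar hg hα, ← Finset.sum_neg_distrib]; rfl

theorem IsKahler.isSmoothLinear_act (hg : g.IsKahler) {T : HermInner E → Module.End ℂ (GA E)}
    (hT : IsNatural T) : IsSmoothLinear (g.act T) where
  isSmooth := hg.isSmooth_act hT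
  map_add {α β} _ _ := ext_valueAt fun x => (T (g.fibre x)).map_add (valueAt α x) (valueAt β x)
  map_smul c α _ := ext_valueAt fun x => (T (g.fibre x)).map_smul c (valueAt α x)

theorem IsKahler.isSmoothLinear_Lam (hg : g.IsKahler) : IsSmoothLinear g.Lam := by
  rw [show g.Lam = _ from funext g.Lam_eq]
  exact hg.isSmoothLinear_act HermInner.isNatural_lamOp

theorem IsKahler.d_eq (hg : g.IsKahler) {α : GForm E X} (hα : IsSmooth α) :
    d α = del α + delBar α := by
  refine ext_valueAt fun p => ?_
  obtain ⟨A, hA⟩ := hg.exists_isAdapted p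
  rw [valueAt_add, hA.valueAt_d hα, hA.valueAt_del hg hα, hA.valueAt_delBar hg hα,
    ← Finset.sum_add_distrib]
  refine Finset.sum_congr rfl fun a _ => ?_
  rw [← HermInner.extHol_add_extAntihol]; rfl

theorem IsKahler.dStar_eq (hg : g.IsKahler) {α : GForm E X} (hα : IsSmooth α) :
    g.dStar α = g.delStar α + g.delBarStar α := by
  have h := (hg.isSmoothLinear_act HermInner.isNatural_starOp).map_add
    (hg.isSmooth_del (hg.isSmooth_star hα)) (hg.isSmooth_delBar (hg.isSmooth_star hα))
  rw [dStar, delStar, delBarStar, hg.d_eq (hg.isSmooth_star hα), ← neg_add,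
    add_comm (g.star (delBar _))]
  exact congrArg _ h

/-- Rotation of the tangent spaces by `c`. -/
def rot (g : HermitianMetric E X) (c : ℂ) : GForm E X → GForm E X :=
  g.act fun _ => pull (mulC E c)

/-- This expresses that `∂` has type `(1, 0)` and `∂̄` type `(0, 1)`: pull-back by `c` multiplies
the symbol of `∂` by `c` and that of `∂̄` by `c̄`. The factors `c̄` and `c` on the right make both
terms acquire `c c̄`. -/
theorem IsKahler.d_rot (hg : g.IsKahler) (c : ℂ) {α : GForm E X} (hα : IsSmooth α) :
    c • starRingEnd ℂ c • d (g.rot c α) =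
      g.rot c (starRingEnd ℂ c • del α + c • delBar α) := by
  refine ext_valueAt fun p => ?_
  obtain ⟨A, hA⟩ := hg.exists_isAdapted p
  rw [rot, valueAt_smul, valueAt_smul, valueAt_act, valueAt_add, valueAt_smul, valueAt_smul,
    hA.valueAt_d (hg.isSmooth_act (isNatural_pull_mulC c) hα), hA.valueAt_del hg hα,
    hA.valueAt_delBar hg hα, _root_.map_add, _root_.map_smul, _root_.map_smul, _root_.map_sum,
    _root_.map_sum]
  simp only [Finset.smul_sum, ← Finset.sum_add_distrib]
  refine Finset.sum_congr rfl fun a _ => ?_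
  rw [hA.jet_act (isNatural_pull_mulC c) hα, ← HermInner.extHol_add_extAntihol]
  set v := (g.fibre p).frame a
  set β := jet A p v α
  have h1 : pull (mulC E c) * (g.fibre p).extHol v =
      c • ((g.fibre p).extHol v * pull (mulC E c)) := by
    rw [HermInner.extHol, pull_mul_extMul, ← smul_mul_assoc, ← extMul_smul]
    congr 2
    ext w
    exact holPart_smul _ _ _
  have h2 : pull (mulC E c) * (g.fibre p).extAntihol v =
      starRingEnd ℂ c • ((g.fibre p).extAntihol v * pull (mulC E c)) := by
    rw [HermInner.extAntihol, pull_mul_extMul, ← smul_mul_assoc, ← extMul_smul]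
    congr 2
    ext w
    exact antiholPart_smul _ _ _
  have h1' : pull (mulC E c) ((g.fibre p).extHol v β) =
      c • (g.fibre p).extHol v (pull (mulC E c) β) := LinearMap.congr_fun h1 β
  have h2' : pull (mulC E c) ((g.fibre p).extAntihol v β) =
      starRingEnd ℂ c • (g.fibre p).extAntihol v (pull (mulC E c) β) := LinearMap.congr_fun h2 β
  rw [h1', h2', LinearMap.add_apply, smul_add, smul_add, smul_comm c (starRingEnd ℂ c),
    smul_comm c (starRingEnd ℂ c)]

omit [FiniteDimensional ℂ E] in
theorem rot_injective (g : HermitianMetric E X) {c : ℂ} (hc : c ≠ 0) :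
    Function.Injective (g.rot c) := by
  refine Function.LeftInverse.injective (g := g.rot c⁻¹) fun α => ?_
  funext k x
  ext v
  change α k x (fun i => c • c⁻¹ • v i) = _
  simp only [smul_inv_smul₀ hc]

/-- `∂² = ∂̄² = ∂∂̄ + ∂̄∂ = 0`. -/
theorem IsKahler.del_delBar_relations (hg : g.IsKahler) :
    hg.isSmoothLinear_del.toEnd * hg.isSmoothLinear_del.toEnd = 0 ∧
    hg.isSmoothLinear_delBar.toEnd * hg.isSmoothLinear_delBar.toEnd = 0 ∧
    hg.isSmoothLinear_del.toEnd * hg.isSmoothLinear_delBar.toEnd +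
      hg.isSmoothLinear_delBar.toEnd * hg.isSmoothLinear_del.toEnd = 0 := by
  set D := hg.isSmoothLinear_del.toEnd with hD
  set B := hg.isSmoothLinear_delBar.toEnd with hB
  have key (c : ℂ) (hc : c ≠ 0) :
      (starRingEnd ℂ c • D + c • B) * (starRingEnd ℂ c • D + c • B) = 0 := by
    set R := (hg.isSmoothLinear_act (isNatural_pull_mulC c)).toEnd with hR
    -- Here `D + B` is `d`, whose square is zero; the intertwining relation transfers this to `c̄ D
    -- + c B`, as `R` is injective.
    have h1 : (c • starRingEnd ℂ c • (D + B)) * R = R * (starRingEnd ℂ c • D + c • B) := by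
      refine LinearMap.ext fun α => Subtype.ext ?_
      have h2 := hg.d_rot c α.2
      rw [hg.d_eq (α := g.rot c α) (hg.isSmooth_act (isNatural_pull_mulC c) α.2)] at h2
      exact h2
    have h2 : (D + B) * (D + B) = 0 := by
      refine LinearMap.ext fun α => Subtype.ext ?_
      have h3 := d_d α.2
      rw [hg.d_eq α.2.d, hg.d_eq α.2] at h3
      exact h3
    have h3 : R * ((starRingEnd ℂ c • D + c • B) * (starRingEnd ℂ c • D + c • B)) = 0 := by
      rw [← mul_assoc, ← h1, mul_assoc, ← h1, ← mul_assoc]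
      simp only [smul_mul_assoc, mul_smul_comm, h2, zero_mul, smul_zero]
    refine LinearMap.ext fun α => Subtype.ext (g.rot_injective hc ?_)
    have h4 := congrArg Subtype.val (LinearMap.congr_fun h3 α)
    exact h4.trans (congrArg Subtype.val (R.map_zero)).symm
  refine components_of_sq_eq_zero fun c hc => ?_
  have := key (starRingEnd ℂ c) (by simpa using hc)
  rwa [Complex.conj_conj] at this

/-- The formal argument takes place in the ring of linear endomorphisms of the space of smooth
forms, on which all the operators are defined and linear. -/
theorem IsKahler.laplacians (hg : g.IsKahler) {α : GForm E X} (hα : IsSmooth α) :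
    g.lapDel α = g.lapDelBar α ∧ g.lapDel α = (1 / 2 : ℂ) • g.lap α := by
  obtain ⟨hD, hB, hDB⟩ := hg.del_delBar_relations
  have h := laplacian_identities (Λ := hg.isSmoothLinear_Lam.toEnd)
    (S := hg.isSmoothLinear_delStar.toEnd) (T := hg.isSmoothLinear_delBarStar.toEnd) hD hB hDB
    (LinearMap.ext fun β => Subtype.ext (hg.comm_Lam_delBar β.2))
    (LinearMap.ext fun β => Subtype.ext (hg.comm_Lam_del β.2))
  have h1 := congrArg Subtype.val (LinearMap.congr_fun h.1 ⟨α, hα⟩)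
  have h2 := congrArg Subtype.val (LinearMap.congr_fun h.2 ⟨α, hα⟩)
  refine ⟨h1, ?_⟩
  rw [lap, hg.dStar_eq hα, hg.dStar_eq hα.d, hg.d_eq hα,
    hg.d_eq ((hg.isSmooth_delStar hα).add (hg.isSmooth_delBarStar hα))]
  exact h2

end HermitianMetric

end Laplacians

end

end KahlerIdentities

end

open KahlerIdentities in
theorem mainTheorem4 {E : Type*} [NormedAddCommGroup E] [NormedSpace ℂ E] [FiniteDimensional ℂ E]
    {X : Type*} [TopologicalSpace X] [T2Space X] [SecondCountableTopology X] [ChartedSpace E X]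
    [IsManifold 𝓘(ℂ, E) ω X] (g : HermitianMetric E X) (hg : g.IsKahler)
    (α : GForm E X) (hα : IsSmooth α) :
    (comm g.L del α = 0 ∧ comm g.L delBar α = 0 ∧
      comm g.Lam g.delStar α = 0 ∧ comm g.Lam g.delBarStar α = 0) ∧
    (comm g.Lam delBar α = -Complex.I • g.delStar α ∧
      comm g.Lam del α = Complex.I • g.delBarStar α) ∧
    (comm g.delBarStar g.L α = Complex.I • del α ∧
      comm g.delStar g.L α = -Complex.I • delBar α) ∧
    (g.lapDel α = g.lapDelBar α ∧ g.lapDel α = (1 / 2 : ℂ) • g.lap α) := by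
  exact ⟨⟨hg.comm_L_del hα, hg.comm_L_delBar hα, hg.comm_Lam_delStar hα, hg.comm_Lam_delBarStar hα⟩,
    ⟨hg.comm_Lam_delBar hα, hg.comm_Lam_del hα⟩,
    ⟨hg.comm_delBarStar_L hα, hg.comm_delStar_L hα⟩, hg.laplacians hα⟩
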